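/- **Conventions.** Chain complexes are unbounded and homologically graded ($\mathrm d:V_n\to V_{n-1}$, $n\in\mathbb Z$). An *unshifted Poisson complex* $(V,\tau)$ is a chain complex $V$ of real vector spaces with a chain map $\tau:V\wedge V\to\mathbb R$, i.e. a $0$-cycle of the mapping complex $\underline{\mathrm{hom}}(\bigwedge^2V,\mathbb R)$, where $\bigwedge^2$ is the graded exterior square; equivalently, a family of bilinear maps $V_p\times V_q\to\mathbb R$, zero unless $p+q=0$, with $\tau(v,w)=-(-1)^{|v||w|}\tau(w,v)$ and $\tau(\mathrm dv,w)+(-1)^{|v|}\tau(v,\mathrm dw)=0$. More generally, an $n$-chain of $\underline{\mathrm{hom}}(\bigwedge^2V,\mathbb R)$ is a graded antisymmetric family of bilinear maps $V_p\times V_q\to\mathbb R$ that vanish unless $p+q+n=0$, and for a $1$-chain $\rho$ one has $\partial\rho(v,w)=\rho(\mathrm dv,w)+(-1)^{|v|}\rho(v,\mathrm dw)$. A morphism $f:(V,\tau)\to(V',\tau')$ in $\mathbf{PoCh}_{\mathbb R}$ is a chain map with $\tau'(f v,f w)=\tau(v,w)$. A dg $*$-algebra over $\mathbb C$ is a $\mathbb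 Z$-graded unital associative $\mathbb C$-algebra with a differential of degree $-1$ satisfying the graded Leibniz rule and a degree-preserving antilinear involution commuting with $\mathrm d$ and satisfying $(ab)^*=(-1)^{|a||b|}b^*a^*$; morphisms in $\mathbf{dg}^*\mathbf{Alg}_{\mathbb C}$ are unital algebra maps preserving degrees, differentials and involutions. Let $T_{\mathbb C}V=\bigoplus_{n\ge0}(V\otimes\mathbb C)^{\otimes n}$ be the free dg $*$-algebra on $V$, with $v^*=v$ for $v\in V$, and let $\mathfrak{CCR}(V,\tau)$ be its quotient by the two-sided dg $*$-ideal generated by $$v\otimes w-(-1)^{|v||w|}\,w\otimes v-i\,\tau(v,w)\,\mathbb 1,\qquad v,w\in V\text{ homogeneous}.$$ This defines a functor $\mathfrak{CCR}:\mathbf{PoCh}_{\mathbb R}\to\mathbf{dg}^*\mathbf{Alg}_{\mathbb C}$. In both categories a weak equivalence is a morphism whose underlying chain map is a quasi-isomorphism. **Proposition.** (a) The functor $\mathfrak{CCR}$ preserves weak equivalences: if $f:(V,\tau)\to(V',\tau')$ is a morphism in $\mathbf{PoCh}_{\mathbb R}$ whose underlying chain map is a quasi-isomorphism, then $\mathfrak{CCR}(f)$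 is a quasi-isomorphism. (b) Let $(V,\tau)$ be an unshifted Poisson complex and $\rho\in\underline{\mathrm{hom}}(\bigwedge^2V,\mathbb R)_1$ a $1$-chain. Then there is a zig-zag of weak equivalences in $\mathbf{dg}^*\mathbf{Alg}_{\mathbb C}$ $$\mathfrak{CCR}(V,\tau)\;\xleftarrow{\ \sim\ }\;A_{(V,\tau,\rho)}\;\xrightarrow{\ \sim\ }\;\mathfrak{CCR}(V,\tau+\partial\rho).$$ Here $A_{(V,\tau,\rho)}$ can be taken to be the unital enveloping algebra of the enlarged Heisenberg dg Lie $*$-algebra $(V\otimes\mathbb C)\oplus(\mathbb Cx\oplus\mathbb Cy)\oplus\mathbb C\mathbb 1$, that is, the dg $*$-algebra generated by $V$ and self-adjoint elements $x$ of degree $0$ and $y=\mathrm dx$ of degree $-1$, subject to the relations that $x$ and $y$ are central in the graded sense and $$v\,w-(-1)^{|v||w|}\,w\,v=i\,\partial\rho(v,w)\,x+i\,\rho(v,w)\,y+i\,\tau(v,w)\,\mathbb 1$$ for all homogeneous $v,w\in V$. -/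

import Mathlib

open CategoryTheory
open scoped DirectSum TensorProduct ComplexConjugate

universe u

noncomputable section

/-! ## Differential graded `*`-algebras over `ℂ` -/

/-- A differential graded unital associative `*`-algebra over `ℂ` (homological grading by `ℤ`):
a `ℤ`-graded `ℂ`-algebra with a differential `d` of degree `-1` obeying the graded Leibniz rule
and a degree preserving antilinear involution `star` with `(ab)^* = (-1)^{|a||b|} b^* a^*`,
which commutes with `d`. -/
structure DGStarAlg where
  carrier : Type u
  [ring : Ring carrier]
  [algebra : Algebra ℂ carrier]
  /-- the submodule of elements of degree `n` -/
  gr : ℤ → Submodule ℂ carrier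
  [graded : GradedAlgebra gr]
  d : carrier →ₗ[ℂ] carrier
  star : carrier →ₗ⋆[ℂ] carrier
  d_mem : ∀ (n : ℤ) (a : carrier), a ∈ gr n → d a ∈ gr (n - 1)
  d_d : ∀ a : carrier, d (d a) = 0
  leibniz : ∀ (n : ℤ) (a b : carrier), a ∈ gr n → d (a * b) = d a * b + (-1 : ℂ) ^ n • (a * d b)
  star_mem : ∀ (n : ℤ) (a : carrier), a ∈ gr n → star a ∈ gr n
  star_star : ∀ a : carrier, star (star a) = a
  star_mul : ∀ (m n : ℤ) (a b : carrier), a ∈ gr m → b ∈ gr n →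
    star (a * b) = (-1 : ℂ) ^ (m * n) • (star b * star a)
  star_d : ∀ a : carrier, star (d a) = d (star a)

namespace DGStarAlg

attribute [instance] ring algebra graded

/-- Morphisms of dg `*`-algebras: unital algebra homomorphisms that preserve degrees and commute
with the differentials and the involutions. -/
@[ext]
structure Hom (A B : DGStarAlg.{u}) where
  toAlgHom : A.carrier →ₐ[ℂ] B.carrier
  map_mem : ∀ (n : ℤ) (a : A.carrier), a ∈ A.gr n → toAlgHom a ∈ B.gr n
  map_d : ∀ a : A.carrier, toAlgHom (A.d a) = B.d (toAlgHom a)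
  map_star : ∀ a : A.carrier, toAlgHom (A.star a) = B.star (toAlgHom a)

/-- The category of dg `*`-algebras. -/
instance : Category DGStarAlg.{u} where
  Hom := Hom
  id A := ⟨AlgHom.id ℂ A.carrier, fun _ _ h => h, fun _ => rfl, fun _ => rfl⟩
  comp f g := ⟨g.toAlgHom.comp f.toAlgHom,
    fun n a h => g.map_mem n _ (f.map_mem n a h),
    fun a => by simp [f.map_d, g.map_d], fun a => by simp [f.map_star, g.map_star]⟩

theorem id_toAlgHom (A : DGStarAlg.{u}) : Hom.toAlgHom (𝟙 A) = AlgHom.id ℂ A.carrier := rfl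

theorem comp_toAlgHom {A B C : DGStarAlg.{u}} (f : A ⟶ B) (g : B ⟶ C) (a : A.carrier) :
    (f ≫ g).toAlgHom a = g.toAlgHom (f.toAlgHom a) := rfl

/-- The component `A_i → A_j` of the differential (zero unless `i = j + 1`). -/
def dComp (A : DGStarAlg.{u}) (i j : ℤ) : A.gr i →ₗ[ℂ] A.gr j :=
  if h : j + 1 = i then
    A.d.restrict (fun a ha => by
      have := A.d_mem i a ha
      rwa [show i - 1 = j by omega] at this)
  else 0

theorem dComp_apply (A : DGStarAlg.{u}) (i j : ℤ) (h : j + 1 = i) (a : A.gr i) :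
    (A.dComp i j a : A.carrier) = A.d a := by
  simp [dComp, h]

/-- The underlying chain complex of complex vector spaces of a dg `*`-algebra. -/
def complex (A : DGStarAlg.{u}) : ChainComplex (ModuleCat.{u} ℂ) ℤ where
  X n := ModuleCat.of ℂ (A.gr n)
  d i j := ModuleCat.ofHom (A.dComp i j)
  shape i j h := by
    have h' : ¬ j + 1 = i := h
    ext a
    simp [dComp, h']
  d_comp_d' i j k hij hjk := by
    have h1 : j + 1 = i := hij
    have h2 : k + 1 = j := hjk
    ext a
    change ((A.dComp j k (A.dComp i j a) : A.gr k) : A.carrier) = 0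
    rw [dComp_apply _ _ _ h2, dComp_apply _ _ _ h1, A.d_d]

/-- The functor from dg `*`-algebras to chain complexes of complex vector spaces. -/
def toComplex : DGStarAlg.{u} ⥤ ChainComplex (ModuleCat.{u} ℂ) ℤ where
  obj A := A.complex
  map {A B} φ :=
    { f := fun n => ModuleCat.ofHom
        (φ.toAlgHom.toLinearMap.restrict (p := A.gr n) (q := B.gr n) (φ.map_mem n))
      comm' := fun i j hij => by
        have h1 : j + 1 = i := hij
        ext a
        apply Subtype.ext
        exact (B.dComp_apply i j h1 _).trans ((φ.map_d _).symm.trans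
          (congrArg φ.toAlgHom (A.dComp_apply i j h1 a).symm)) }

/-- Weak equivalences of dg `*`-algebras: the underlying chain map is a quasi-isomorphism. -/
def weq : MorphismProperty DGStarAlg.{u} := fun _ _ φ => QuasiIso (toComplex.map φ)

/-! ### Quotients by dg `*`-ideals -/

/-- Two-sided differential graded `*`-ideals. -/
structure IsDGStarIdeal (A : DGStarAlg.{u}) (I : Ideal A.carrier) : Prop where
  mul_mem_right : ∀ a b : A.carrier, a ∈ I → a * b ∈ I
  homogeneous : ∀ (n : ℤ) (a : A.carrier), a ∈ I →
    ((DirectSum.decompose A.gr a n : A.gr n) : A.carrier) ∈ I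
  d_mem : ∀ a : A.carrier, a ∈ I → A.d a ∈ I
  star_mem : ∀ a : A.carrier, a ∈ I → A.star a ∈ I

/-- The two-sided dg `*`-ideal generated by a set `S` (the smallest one that contains `S`). -/
def dgIdeal (A : DGStarAlg.{u}) (S : Set A.carrier) : Ideal A.carrier :=
  sInf {I | A.IsDGStarIdeal I ∧ S ⊆ I}

theorem dgIdeal_isDGStarIdeal (A : DGStarAlg.{u}) (S : Set A.carrier) :
    A.IsDGStarIdeal (A.dgIdeal S) where
  mul_mem_right a b h := by
    simp only [dgIdeal, Submodule.mem_sInf] at h ⊢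
    exact fun I hI => hI.1.mul_mem_right a b (h I hI)
  homogeneous n a h := by
    simp only [dgIdeal, Submodule.mem_sInf] at h ⊢
    exact fun I hI => hI.1.homogeneous n a (h I hI)
  d_mem a h := by
    simp only [dgIdeal, Submodule.mem_sInf] at h ⊢
    exact fun I hI => hI.1.d_mem a (h I hI)
  star_mem a h := by
    simp only [dgIdeal, Submodule.mem_sInf] at h ⊢
    exact fun I hI => hI.1.star_mem a (h I hI)

theorem subset_dgIdeal (A : DGStarAlg.{u}) (S : Set A.carrier) : S ⊆ A.dgIdeal S := by
  intro a ha
  simp only [dgIdeal, SetLike.mem_coe, Submodule.mem_sInf]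
  exact fun I hI => hI.2 ha

theorem dgIdeal_le (A : DGStarAlg.{u}) (S : Set A.carrier) (I : Ideal A.carrier)
    (hI : A.IsDGStarIdeal I) (hS : S ⊆ I) : A.dgIdeal S ≤ I :=
  sInf_le ⟨hI, hS⟩

instance (A : DGStarAlg.{u}) (S : Set A.carrier) : (A.dgIdeal S).IsTwoSided :=
  ⟨fun b h => (A.dgIdeal_isDGStarIdeal S).mul_mem_right _ b h⟩

section Quotient

variable (A : DGStarAlg.{u}) (S : Set A.carrier)

/-- The quotient map `A → A / I` as an algebra homomorphism. -/
abbrev qmk : A.carrier →ₐ[ℂ] A.carrier ⧸ A.dgIdeal S := Ideal.Quotient.mkₐ ℂ (A.dgIdeal S)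

theorem qmk_surjective : Function.Surjective (A.qmk S) := Ideal.Quotient.mkₐ_surjective _ _

theorem qmk_eq_zero {a : A.carrier} : A.qmk S a = 0 ↔ a ∈ A.dgIdeal S :=
  Ideal.Quotient.eq_zero_iff_mem

/-- A semilinear map that vanishes on the ideal descends to the quotient. -/
def qlift {M : Type*} [AddCommGroup M] [Module ℂ M] {σ : ℂ →+* ℂ} (f : A.carrier →ₛₗ[σ] M)
    (hf : ∀ a ∈ A.dgIdeal S, f a = 0) : (A.carrier ⧸ A.dgIdeal S) →ₛₗ[σ] M where
  toFun := QuotientAddGroup.lift _ f.toAddMonoidHom hf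
  map_add' := map_add _
  map_smul' c x := by
    obtain ⟨a, rfl⟩ := A.qmk_surjective S x
    rw [← map_smul]
    exact f.map_smulₛₗ c a

@[simp]
theorem qlift_qmk {M : Type*} [AddCommGroup M] [Module ℂ M] {σ : ℂ →+* ℂ}
    (f : A.carrier →ₛₗ[σ] M) (hf : ∀ a ∈ A.dgIdeal S, f a = 0) (a : A.carrier) :
    A.qlift S f hf (A.qmk S a) = f a := rfl

/-- The grading of the quotient: the classes of elements of degree `n`. -/
def qgr (n : ℤ) : Submodule ℂ (A.carrier ⧸ A.dgIdeal S) := (A.gr n).map (A.qmk S).toLinearMap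

theorem qmk_mem {n : ℤ} {a : A.carrier} (h : a ∈ A.gr n) : A.qmk S a ∈ A.qgr S n :=
  ⟨a, h, rfl⟩

/-- Auxiliary map that sends `a` to the classes of its homogeneous components. -/
def qdecAux : A.carrier →ₗ[ℂ] ⨁ n, A.qgr S n :=
  (DirectSum.lmap fun n => (A.qmk S).toLinearMap.restrict (p := A.gr n) (q := A.qgr S n)
    (fun _ h => A.qmk_mem S h)) ∘ₗ (DirectSum.decomposeLinearEquiv A.gr).toLinearMap

theorem qdecAux_apply (a : A.carrier) (n : ℤ) :
    (A.qdecAux S a n : A.carrier ⧸ A.dgIdeal S) = A.qmk S (DirectSum.decompose A.gr a n) := by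
  rw [qdecAux, LinearMap.comp_apply, DirectSum.lmap_apply]
  rfl

theorem qdecAux_of_mem {n : ℤ} {a : A.carrier} (h : a ∈ A.gr n) :
    A.qdecAux S a = DirectSum.of (fun n => A.qgr S n) n ⟨A.qmk S a, A.qmk_mem S h⟩ := by
  ext m
  rw [qdecAux_apply, DirectSum.decompose_of_mem _ h]
  by_cases hm : n = m
  · subst hm; simp
  · rw [DirectSum.of_eq_of_ne _ _ _ (Ne.symm hm), DirectSum.of_eq_of_ne _ _ _ (Ne.symm hm)]; simp

instance qgraded : GradedAlgebra (A.qgr S) where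
  one_mem := ⟨1, SetLike.GradedOne.one_mem, map_one (A.qmk S)⟩
  mul_mem := by
    rintro i j _ _ ⟨a, ha, rfl⟩ ⟨b, hb, rfl⟩
    exact ⟨a * b, SetLike.GradedMul.mul_mem ha hb, map_mul (A.qmk S) a b⟩
  decompose' := A.qlift S (A.qdecAux S) (by
    intro a ha
    ext n
    rw [qdecAux_apply]
    simpa using (A.qmk_eq_zero S).2 ((A.dgIdeal_isDGStarIdeal S).homogeneous n a ha))
  left_inv x := by
    obtain ⟨a, rfl⟩ := A.qmk_surjective S x
    rw [qlift_qmk]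
    induction a using DirectSum.Decomposition.inductionOn A.gr with
    | zero => simp
    | homogeneous a => rw [qdecAux_of_mem A S a.2]; simp
    | add a b ha hb => simp only [map_add, ha, hb]
  right_inv x := by
    induction x using DirectSum.induction_on with
    | zero => simp
    | of n x =>
      obtain ⟨_, a, ha, rfl⟩ := x
      simp only [DirectSum.coeAddMonoidHom_of]
      exact A.qdecAux_of_mem S ha
    | add x y hx hy => simp only [map_add, hx, hy]

/-- The quotient `A / I` of a dg `*`-algebra by the two-sided dg `*`-ideal generated by `S`. -/
def quotient : DGStarAlg.{u} where
  carrier := A.carrier ⧸ A.dgIdeal S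
  gr := A.qgr S
  d := A.qlift S ((A.qmk S).toLinearMap ∘ₗ A.d) (fun a ha =>
    (A.qmk_eq_zero S).2 ((A.dgIdeal_isDGStarIdeal S).d_mem a ha))
  star := A.qlift S ((A.qmk S).toLinearMap.comp A.star) (fun a ha =>
    (A.qmk_eq_zero S).2 ((A.dgIdeal_isDGStarIdeal S).star_mem a ha))
  d_mem := by
    rintro n _ ⟨a, ha, rfl⟩
    exact ⟨A.d a, A.d_mem n a ha, rfl⟩
  d_d x := by
    obtain ⟨a, rfl⟩ := A.qmk_surjective S x
    change A.qmk S (A.d (A.d a)) = 0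
    rw [A.d_d, map_zero]
  leibniz := by
    intro n _ y ⟨a, ha, h⟩
    obtain ⟨b, rfl⟩ := A.qmk_surjective S y
    subst h
    change A.qmk S (A.d (a * b)) = _
    rw [A.leibniz n a b ha, map_add, map_smul, map_mul, map_mul]
    rfl
  star_mem := by
    rintro n _ ⟨a, ha, rfl⟩
    exact ⟨A.star a, A.star_mem n a ha, rfl⟩
  star_star x := by
    obtain ⟨a, rfl⟩ := A.qmk_surjective S x
    change A.qmk S (A.star (A.star a)) = _
    rw [A.star_star]
  star_mul := by
    rintro m n _ _ ⟨a, ha, rfl⟩ ⟨b, hb, rfl⟩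
    change A.qmk S (A.star (a * b)) = _
    rw [A.star_mul m n a b ha hb, map_smul, map_mul]
    rfl
  star_d x := by
    obtain ⟨a, rfl⟩ := A.qmk_surjective S x
    change A.qmk S (A.star (A.d a)) = A.qmk S (A.d (A.star a))
    rw [A.star_d]

/-- The quotient map as a morphism of dg `*`-algebras. -/
def proj : A ⟶ A.quotient S where
  toAlgHom := A.qmk S
  map_mem _ _ h := A.qmk_mem S h
  map_d _ := rfl
  map_star _ := rfl

end Quotient

/-- The dg `*`-ideal generated by `S` is contained in the preimage of the one generated by `S'`,
for every morphism that maps `S` into `S'`. -/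
theorem map_mem_dgIdeal {A B : DGStarAlg.{u}} (φ : A ⟶ B) {S : Set A.carrier} {S' : Set B.carrier}
    (h : ∀ a ∈ S, φ.toAlgHom a ∈ S') (a : A.carrier) (ha : a ∈ A.dgIdeal S) :
    φ.toAlgHom a ∈ B.dgIdeal S' := by
  have hI := B.dgIdeal_isDGStarIdeal S'
  refine A.dgIdeal_le S ((B.dgIdeal S').comap φ.toAlgHom) ⟨?_, ?_, ?_, ?_⟩ ?_ ha
  · intro a b h
    rw [Ideal.mem_comap] at h ⊢
    rw [map_mul]
    exact hI.mul_mem_right _ _ h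
  · intro n a h
    rw [Ideal.mem_comap] at h ⊢
    have key : φ.toAlgHom (DirectSum.decompose A.gr a n : A.gr n) =
        (DirectSum.decompose B.gr (φ.toAlgHom a) n : B.gr n) := by
      clear h
      induction a using DirectSum.Decomposition.inductionOn A.gr with
      | zero => simp
      | @homogeneous i a =>
        rw [DirectSum.decompose_coe, DirectSum.decompose_of_mem _ (φ.map_mem i a a.2)]
        by_cases hm : i = n
        · subst hm; simp
        · rw [DirectSum.of_eq_of_ne _ _ _ (Ne.symm hm), DirectSum.of_eq_of_ne _ _ _ (Ne.symm hm)]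
          simp
      | add a b ha hb => simp [ha, hb]
    rw [key]
    exact hI.homogeneous n _ h
  · intro a h
    rw [Ideal.mem_comap] at h ⊢
    rw [φ.map_d]
    exact hI.d_mem _ h
  · intro a h
    rw [Ideal.mem_comap] at h ⊢
    rw [φ.map_star]
    exact hI.star_mem _ h
  · intro a ha
    exact B.subset_dgIdeal S' (h a ha)

/-- The morphism of quotients induced by a morphism that maps `S` into `S'`. -/
def quotientMap {A B : DGStarAlg.{u}} (φ : A ⟶ B) {S : Set A.carrier} {S' : Set B.carrier}
    (h : ∀ a ∈ S, φ.toAlgHom a ∈ S') : A.quotient S ⟶ B.quotient S' where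
  toAlgHom := Ideal.Quotient.liftₐ (A.dgIdeal S) ((B.qmk S').comp φ.toAlgHom)
    (fun a ha => (B.qmk_eq_zero S').2 (map_mem_dgIdeal φ h a ha))
  map_mem := by
    rintro n _ ⟨a, ha, rfl⟩
    exact ⟨φ.toAlgHom a, φ.map_mem n a ha, rfl⟩
  map_d x := by
    obtain ⟨a, rfl⟩ := A.qmk_surjective S x
    change B.qmk S' (φ.toAlgHom (A.d a)) = B.qmk S' (B.d (φ.toAlgHom a))
    rw [φ.map_d]
  map_star x := by
    obtain ⟨a, rfl⟩ := A.qmk_surjective S x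
    change B.qmk S' (φ.toAlgHom (A.star a)) = B.qmk S' (B.star (φ.toAlgHom a))
    rw [φ.map_star]

@[simp]
theorem quotientMap_proj {A B : DGStarAlg.{u}} (φ : A ⟶ B) {S : Set A.carrier}
    {S' : Set B.carrier} (h : ∀ a ∈ S, φ.toAlgHom a ∈ S') (a : A.carrier) :
    (quotientMap φ h).toAlgHom ((A.proj S).toAlgHom a) = (B.proj S').toAlgHom (φ.toAlgHom a) := rfl

end DGStarAlg

/-! ## The free dg `*`-algebra on a real chain complex -/

/-- `(-1)^n` as a complex number is an involution. -/
theorem neg_one_zpow_mul_self (n : ℤ) : (-1 : ℂ) ^ n * (-1 : ℂ) ^ n = 1 := by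
  rw [← mul_zpow]; simp

/-- `T_ℂ V`, the tensor algebra over `ℂ` of the complexification of a real chain complex `V`. -/
def TAlg (V : ChainComplex (ModuleCat.{u} ℝ) ℤ) : Type u :=
  TensorAlgebra ℂ (ℂ ⊗[ℝ] (⨁ n : ℤ, V.X n))

namespace TAlg

instance (V : ChainComplex (ModuleCat.{u} ℝ) ℤ) : Ring (TAlg V) :=
  inferInstanceAs (Ring (TensorAlgebra ℂ (ℂ ⊗[ℝ] (⨁ n : ℤ, V.X n))))

instance (V : ChainComplex (ModuleCat.{u} ℝ) ℤ) : Algebra ℂ (TAlg V) :=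
  inferInstanceAs (Algebra ℂ (TensorAlgebra ℂ (ℂ ⊗[ℝ] (⨁ n : ℤ, V.X n))))

variable (V : ChainComplex (ModuleCat.{u} ℝ) ℤ)

/-- The inclusion of the complexification of `V` into `T_ℂ V`. -/
def ι : ℂ ⊗[ℝ] (⨁ n : ℤ, V.X n) →ₗ[ℂ] TAlg V := TensorAlgebra.ι ℂ

/-- The inclusion of the elements of `V` of degree `n` into `T_ℂ V`. -/
def gen (n : ℤ) : V.X n →ₗ[ℝ] TAlg V :=
  (ι V).restrictScalars ℝ ∘ₗ TensorProduct.mk ℝ ℂ (⨁ n : ℤ, V.X n) 1 ∘ₗ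
    DirectSum.lof ℝ ℤ (fun n => V.X n) n

variable {V}

/-- Real linear maps from the components of `V` extend to `T_ℂ V` as algebra homomorphisms. -/
def lift {B : Type*} [Ring B] [Algebra ℂ B] (f : ∀ n, V.X n →ₗ[ℝ] B) : TAlg V →ₐ[ℂ] B :=
  TensorAlgebra.lift ℂ (LinearMap.liftBaseChange ℂ (DirectSum.toModule ℝ ℤ B f))

@[simp]
theorem lift_gen {B : Type*} [Ring B] [Algebra ℂ B] (f : ∀ n, V.X n →ₗ[ℝ] B) (n : ℤ) (v : V.X n) :
    lift f (gen V n v) = f n v := by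
  change TensorAlgebra.lift ℂ _ (TensorAlgebra.ι ℂ ((1 : ℂ) ⊗ₜ[ℝ] DirectSum.lof ℝ ℤ (fun n => V.X n) n v)) = _
  simp

theorem induction {C : TAlg V → Prop} (h1 : ∀ c : ℂ, C (algebraMap ℂ _ c))
    (hg : ∀ n v, C (gen V n v)) (hm : ∀ a b, C a → C b → C (a * b))
    (ha : ∀ a b, C a → C b → C (a + b)) (a : TAlg V) : C a := by
  have h0 : C 0 := by simpa using h1 0
  have hι : ∀ x, C (ι V x) := by
    intro x
    induction x using TensorProduct.induction_on with
    | zero => simpa using h0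
    | add x y hx hy => rw [map_add]; exact ha _ _ hx hy
    | tmul c w =>
      induction w using DirectSum.induction_on with
      | zero => simpa using h0
      | add x y hx hy => rw [TensorProduct.tmul_add, map_add]; exact ha _ _ hx hy
      | of n v =>
        have : ι V (c ⊗ₜ[ℝ] DirectSum.of (fun n => V.X n) n v) =
            algebraMap ℂ (TAlg V) c * gen V n v := by
          rw [← Algebra.smul_def]
          change _ = c • ι V ((1 : ℂ) ⊗ₜ[ℝ] DirectSum.of (fun n => V.X n) n v)
          rw [← map_smul, TensorProduct.smul_tmul', smul_eq_mul, mul_one]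
        rw [this]
        exact hm _ _ (h1 c) (hg n v)
  exact TensorAlgebra.induction (C := C) h1 hι hm ha a

theorem algHom_ext {B : Type*} [Ring B] [Algebra ℂ B] {f g : TAlg V →ₐ[ℂ] B}
    (h : ∀ n v, f (gen V n v) = g (gen V n v)) : f = g := by
  apply AlgHom.ext
  intro a
  induction a using induction with
  | h1 c => simp
  | hg n v => exact h n v
  | hm a b ha hb => simp [ha, hb]
  | ha a b ha hb => simp [ha, hb]

variable (V)

/-- The degree `n` part of `T_ℂ V`: the complex span of the products `v_1 ⋯ v_k` of homogeneous
elements of `V` with `|v_1| + ⋯ + |v_k| = n`. -/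
def gr (n : ℤ) : Submodule ℂ (TAlg V) :=
  Submodule.span ℂ {a | ∃ l : List (Σ k : ℤ, V.X k), (l.map Sigma.fst).sum = n ∧
    a = (l.map fun v => gen V v.1 v.2).prod}

theorem gen_mem (n : ℤ) (v : V.X n) : gen V n v ∈ gr V n :=
  Submodule.subset_span ⟨[⟨n, v⟩], by simp, by simp⟩

instance : SetLike.GradedMonoid (gr V) where
  one_mem := Submodule.subset_span ⟨[], by simp, by simp⟩
  mul_mem := by
    intro i j a b ha hb
    have h := Submodule.mul_mem_mul ha hb
    rw [gr, gr, Submodule.span_mul_span] at h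
    refine Submodule.span_mono ?_ h
    rintro _ ⟨_, ⟨l, hl, rfl⟩, _, ⟨l', hl', rfl⟩, rfl⟩
    exact ⟨l ++ l', by simp [hl, hl'], by simp⟩

variable {V}

/-- Induction for homogeneous elements. -/
theorem gr_induction {C : ∀ (n : ℤ) (a : TAlg V), a ∈ gr V n → Prop}
    (h0 : ∀ n, C n 0 (zero_mem _))
    (ha : ∀ n a b p q, C n a p → C n b q → C n (a + b) (add_mem p q))
    (hs : ∀ n (c : ℂ) a p, C n a p → C n (c • a) (Submodule.smul_mem _ c p))
    (h1 : C 0 1 SetLike.GradedOne.one_mem)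
    (hm : ∀ m n v a p, C n a p → C (m + n) (gen V m v * a)
      (SetLike.GradedMul.mul_mem (gen_mem V m v) p)) {n : ℤ} {a : TAlg V}
    (h : a ∈ gr V n) : C n a h := by
  induction h using Submodule.span_induction with
  | zero => exact h0 n
  | add a b _ _ h h' => exact ha n a b _ _ h h'
  | smul c a _ h => exact hs n c a _ h
  | mem a h =>
    obtain ⟨l, rfl, rfl⟩ := h
    induction l with
    | nil => simpa using h1
    | cons v l ih =>
      simpa only [List.map_cons, List.sum_cons, List.prod_cons] using
        hm v.1 _ v.2 _ (Submodule.subset_span ⟨l, rfl, rfl⟩) ih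

/-- The map that decomposes elements of `T_ℂ V` into homogeneous components. -/
def decompAux : TAlg V →ₐ[ℂ] ⨁ n, gr V n :=
  lift (B := ⨁ n, gr V n) fun n =>
    { toFun := fun v => DirectSum.of (fun n => gr V n) n ⟨gen V n v, gen_mem V n v⟩
      map_add' := fun v w => by
        rw [← map_add]
        congr 1
        exact Subtype.ext (map_add _ _ _)
      map_smul' := fun c v => by
        rw [RingHom.id_apply, ← Complex.coe_smul]
        refine Eq.trans ?_ ((DirectSum.lof ℂ ℤ (fun n => gr V n) n).map_smul (c : ℂ) _)
        refine congrArg (DirectSum.of (fun n => gr V n) n) (Subtype.ext ?_)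
        exact ((gen V n).map_smul c v).trans (Complex.coe_smul c (gen V n v)).symm }

theorem decompAux_of_mem {n : ℤ} {a : TAlg V} (h : a ∈ gr V n) :
    decompAux a = DirectSum.of (fun n => gr V n) n ⟨a, h⟩ := by
  induction h using gr_induction with
  | h0 n => rw [map_zero]; exact (map_zero _).symm
  | ha n a b p q h h' =>
    rw [map_add, h, h', ← map_add]
    rfl
  | hs n c a p h =>
    rw [map_smul, h]
    exact ((DirectSum.lof ℂ ℤ (fun n => gr V n) n).map_smul c ⟨a, p⟩).symm
  | h1 => rw [map_one]; rfl
  | hm m n v a p h =>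
    rw [map_mul, h, decompAux, lift_gen]
    exact DirectSum.of_mul_of (A := fun n => gr V n) ⟨gen V m v, gen_mem V m v⟩ ⟨a, p⟩

instance : GradedAlgebra (gr V) :=
  GradedAlgebra.ofAlgHom (gr V) decompAux
    (by
      apply algHom_ext
      intro n v
      rw [AlgHom.comp_apply, decompAux_of_mem (gen_mem V n v), AlgHom.id_apply]
      exact DirectSum.coeAlgHom_of (gr V) n ⟨gen V n v, gen_mem V n v⟩)
    (fun n a => decompAux_of_mem a.2)

/-! ### The differential -/

variable (V)

/-- The algebra automorphism `a ↦ (-1)^{|a|} a`. -/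
def parity : TAlg V →ₐ[ℂ] TAlg V := lift fun n => (-1 : ℂ) ^ n • gen V n

/-- The homomorphism `a ↦ ((-1)^{|a|} a, d a; 0, a)` into upper triangular matrices, which
encodes the graded derivation `d` that extends the differential of `V`. -/
def dMatrix : TAlg V →ₐ[ℂ] Matrix (Fin 2) (Fin 2) (TAlg V) :=
  lift fun n =>
    { toFun := fun v => !![(-1 : ℂ) ^ n • gen V n v, gen V (n - 1) (V.d n (n - 1) v);
        0, gen V n v]
      map_add' := fun v w => by
        ext i j; fin_cases i <;> fin_cases j <;> simp
      map_smul' := fun c v => by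
        rw [RingHom.id_apply, ← Complex.coe_smul]
        ext i j
        fin_cases i <;> fin_cases j <;> simp [← Complex.coe_smul, smul_comm (c : ℂ)] }

/-- The differential of `T_ℂ V`: the graded derivation that extends the differential of `V`. -/
def d : TAlg V →ₗ[ℂ] TAlg V := Matrix.entryLinearMap ℂ (TAlg V) 0 1 ∘ₗ (dMatrix V).toLinearMap

theorem dMatrix_apply (a : TAlg V) : dMatrix V a = !![parity V a, d V a; 0, a] := by
  have h : dMatrix V a 0 0 = parity V a ∧ dMatrix V a 1 0 = 0 ∧ dMatrix V a 1 1 = a := by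
    induction a using induction with
    | h1 c => simp [Matrix.algebraMap_matrix_apply]
    | hg n v => simp [dMatrix, parity]
    | hm a b ha hb =>
      obtain ⟨h1, h2, h3⟩ := ha
      obtain ⟨h1', h2', h3'⟩ := hb
      simp [map_mul, Matrix.mul_apply, Fin.sum_univ_two, *]
    | ha a b ha hb => simp [ha, hb]
  ext i j
  fin_cases i <;> fin_cases j <;> simp [h, d]

@[simp]
theorem parity_gen (n : ℤ) (v : V.X n) : parity V (gen V n v) = (-1 : ℂ) ^ n • gen V n v := by
  simp [parity]

@[simp]
theorem d_gen (n : ℤ) (v : V.X n) : d V (gen V n v) = gen V (n - 1) (V.d n (n - 1) v) := by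
  simp [d, dMatrix]

theorem d_mul (a b : TAlg V) : d V (a * b) = d V a * b + parity V a * d V b := by
  have h := congrFun (congrFun (map_mul (dMatrix V) a b) 0) 1
  rw [dMatrix_apply, dMatrix_apply, dMatrix_apply] at h
  simp [Matrix.mul_apply, Fin.sum_univ_two] at h
  rw [h, add_comm]

theorem d_algebraMap (c : ℂ) : d V (algebraMap ℂ _ c) = 0 := by
  simp [d, Matrix.algebraMap_matrix_apply]

@[simp]
theorem d_one : d V 1 = 0 := by simpa using d_algebraMap V 1

theorem parity_of_mem {n : ℤ} {a : TAlg V} (h : a ∈ gr V n) : parity V a = (-1 : ℂ) ^ n • a := by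
  induction h using gr_induction with
  | h0 n => simp
  | ha n a b _ _ h h' => simp [h, h']
  | hs n c a _ h => rw [map_smul, h, smul_comm]
  | h1 => simp
  | hm m n v a _ h =>
    rw [map_mul, h, parity_gen, smul_mul_smul_comm, zpow_add₀ (by norm_num)]

theorem d_mem (n : ℤ) (a : TAlg V) (h : a ∈ gr V n) : d V a ∈ gr V (n - 1) := by
  induction h using gr_induction with
  | h0 n => simp
  | ha n a b _ _ h h' => rw [map_add]; exact add_mem h h'
  | hs n c a _ h => rw [map_smul]; exact Submodule.smul_mem _ c h
  | h1 => simp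
  | hm m n v a ha h =>
    rw [d_mul, parity_gen, smul_mul_assoc, d_gen]
    refine add_mem ?_ (Submodule.smul_mem _ _ ?_)
    · rw [show m + n - 1 = (m - 1) + n by ring]
      exact SetLike.GradedMul.mul_mem (gen_mem V _ _) ha
    · rw [show m + n - 1 = m + (n - 1) by ring]
      exact SetLike.GradedMul.mul_mem (gen_mem V _ _) h

theorem parity_parity (a : TAlg V) : parity V (parity V a) = a := by
  have : (parity V).comp (parity V) = AlgHom.id ℂ _ := by
    apply algHom_ext
    intro n v
    simp [smul_smul, neg_one_zpow_mul_self]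
  exact DFunLike.congr_fun this a

theorem parity_d (a : TAlg V) : parity V (d V a) = - d V (parity V a) := by
  induction a using induction with
  | h1 c => simp [d_algebraMap]
  | hg n v =>
    rw [d_gen, parity_gen, parity_gen, map_smul, d_gen, zpow_sub_one₀ (by norm_num)]
    simp
  | hm a b ha hb =>
    rw [d_mul, map_add, map_mul, map_mul, map_mul, d_mul, ha, hb]
    simp [add_comm]
  | ha a b ha hb => simp only [map_add, ha, hb, neg_add]

theorem d_d (a : TAlg V) : d V (d V a) = 0 := by
  induction a using induction with
  | h1 c => simp [d_algebraMap]
  | hg n v =>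
    rw [d_gen, d_gen]
    have := congrArg (fun f => f.hom v) (V.d_comp_d n (n - 1) (n - 1 - 1))
    simp only [ModuleCat.hom_comp, LinearMap.comp_apply] at this
    rw [this]
    simp
  | hm a b ha hb =>
    rw [d_mul, map_add, d_mul, d_mul, ha, hb, parity_d, parity_parity]
    simp
  | ha a b ha hb => simp only [map_add, ha, hb, add_zero]

/-! ### The involution -/

/-- The opposite algebra with the complex conjugate scalar multiplication. -/
def ConjOp : Type u := (TAlg V)ᵐᵒᵖ

instance : Ring (ConjOp V) := inferInstanceAs (Ring (TAlg V)ᵐᵒᵖ)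

instance : Algebra ℂ (ConjOp V) :=
  ((algebraMap ℂ (TAlg V)ᵐᵒᵖ).comp (starRingEnd ℂ)).toAlgebra' fun c x =>
    Algebra.commutes (A := (TAlg V)ᵐᵒᵖ) (conj c) x

/-- The identity `T_ℂ V → ConjOp V`. -/
def toOp (a : TAlg V) : ConjOp V := MulOpposite.op a

/-- The identity `ConjOp V → T_ℂ V`. -/
def ofOp (x : ConjOp V) : TAlg V := MulOpposite.unop (α := TAlg V) x

/-- The sign `(-1)^{n(n-1)/2}`. -/
def revSign (n : ℤ) : ℂ := (-1 : ℂ) ^ (n * (n - 1) / 2)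

theorem revSign_add (m n : ℤ) :
    revSign (m + n) = (-1 : ℂ) ^ (m * n) * (revSign m * revSign n) := by
  rw [revSign, revSign, revSign, ← zpow_add₀ (by norm_num), ← zpow_add₀ (by norm_num)]
  congr 1
  obtain ⟨a, ha⟩ := (Int.even_mul_pred_self m).two_dvd
  obtain ⟨b, hb⟩ := (Int.even_mul_pred_self n).two_dvd
  have hc : (m + n) * (m + n - 1) = 2 * (m * n + (a + b)) := by linear_combination ha + hb
  rw [ha, hb, hc]
  simp

theorem revSign_mul_self (n : ℤ) : revSign n * revSign n = 1 := neg_one_zpow_mul_self _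

theorem conj_revSign (n : ℤ) : conj (revSign n) = revSign n := by simp [revSign]

theorem conjOp_smul (c : ℂ) (x : ConjOp V) : c • x = toOp V (conj c • ofOp V x) := by
  rw [Algebra.smul_def, Algebra.smul_def]
  exact Algebra.commutes c x

/-- The antilinear anti-automorphism of `T_ℂ V` (without Koszul signs for products) that sends a
homogeneous `v` in `V` to `(-1)^{|v|(|v|-1)/2} v`. -/
def revHom : TAlg V →ₐ[ℂ] ConjOp V :=
  lift fun n =>
    { toFun := fun v => toOp V (revSign n • gen V n v)
      map_add' := fun v w => by rw [map_add, smul_add]; rfl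
      map_smul' := fun c v => by
        rw [RingHom.id_apply, ← Complex.coe_smul, conjOp_smul, map_smul, Complex.conj_ofReal,
          ← Complex.coe_smul, smul_comm]
        rfl }

/-- `revHom` as an antilinear map of `T_ℂ V`. -/
def rev : TAlg V →ₗ⋆[ℂ] TAlg V where
  toFun a := ofOp V (revHom V a)
  map_add' a b := by rw [map_add]; rfl
  map_smul' c a := congrArg (ofOp V) ((map_smul (revHom V) c a).trans (conjOp_smul V c _))

theorem rev_mul (a b : TAlg V) : rev V (a * b) = rev V b * rev V a :=
  congrArg (ofOp V) (map_mul (revHom V) a b)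

theorem rev_one : rev V 1 = 1 := congrArg (ofOp V) (map_one (revHom V))

theorem rev_gen (n : ℤ) (v : V.X n) : rev V (gen V n v) = revSign n • gen V n v :=
  congrArg (ofOp V) (lift_gen _ n v)

theorem rev_mem {n : ℤ} {a : TAlg V} (h : a ∈ gr V n) : rev V a ∈ gr V n := by
  induction h using gr_induction with
  | h0 n => simp
  | ha n a b _ _ h h' => rw [map_add]; exact add_mem h h'
  | hs n c a _ h => rw [LinearMap.map_smulₛₗ]; exact Submodule.smul_mem _ _ h
  | h1 => rw [rev_one]; exact SetLike.GradedOne.one_mem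
  | hm m n v a _ h =>
    rw [rev_mul, rev_gen, add_comm]
    exact SetLike.GradedMul.mul_mem h (Submodule.smul_mem _ _ (gen_mem V m v))

theorem rev_rev {n : ℤ} {a : TAlg V} (h : a ∈ gr V n) : rev V (rev V a) = a := by
  induction h using gr_induction with
  | h0 n => simp
  | ha n a b _ _ h h' => rw [map_add, map_add, h, h']
  | hs n c a _ h => rw [LinearMap.map_smulₛₗ, LinearMap.map_smulₛₗ, h]; simp
  | h1 => rw [rev_one, rev_one]
  | hm m n v a _ h =>
    rw [rev_mul, rev_mul, h, rev_gen, LinearMap.map_smulₛₗ, rev_gen, conj_revSign, smul_smul,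
      revSign_mul_self, one_smul]

/-- Multiplication of the degree `n` component by `(-1)^{n(n-1)/2}`. -/
def signMap : TAlg V →ₗ[ℂ] TAlg V :=
  DirectSum.toModule ℂ ℤ (TAlg V) (fun n => revSign n • (gr V n).subtype) ∘ₗ
    (DirectSum.decomposeLinearEquiv (gr V)).toLinearMap

theorem signMap_of_mem {n : ℤ} {a : TAlg V} (h : a ∈ gr V n) : signMap V a = revSign n • a := by
  rw [signMap, LinearMap.comp_apply]
  have : (DirectSum.decomposeLinearEquiv (gr V)).toLinearMap a =
      DirectSum.lof ℂ ℤ (fun n => gr V n) n ⟨a, h⟩ := DirectSum.decompose_of_mem (gr V) h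
  rw [this, DirectSum.toModule_lof]
  rfl

/-- The antilinear involution of `T_ℂ V`, determined by `v^* = v` for `v` in `V` and
`(ab)^* = (-1)^{|a||b|} b^* a^*` (see `star_gen`, `star_mul`). -/
def star : TAlg V →ₗ⋆[ℂ] TAlg V := (rev V).comp (signMap V)

theorem star_of_mem {n : ℤ} {a : TAlg V} (h : a ∈ gr V n) : star V a = revSign n • rev V a := by
  rw [star, LinearMap.comp_apply, signMap_of_mem V h, LinearMap.map_smulₛₗ, conj_revSign]

theorem star_gen (n : ℤ) (v : V.X n) : star V (gen V n v) = gen V n v := by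
  rw [star_of_mem V (gen_mem V n v), rev_gen, smul_smul, revSign_mul_self, one_smul]

theorem star_one : star V 1 = 1 := by
  rw [star_of_mem V (n := 0) SetLike.GradedOne.one_mem, rev_one]
  simp [revSign]

theorem star_mem (n : ℤ) (a : TAlg V) (h : a ∈ gr V n) : star V a ∈ gr V n := by
  rw [star_of_mem V h]
  exact Submodule.smul_mem _ _ (rev_mem V h)

theorem star_mul (m n : ℤ) (a b : TAlg V) (ha : a ∈ gr V m) (hb : b ∈ gr V n) :
    star V (a * b) = (-1 : ℂ) ^ (m * n) • (star V b * star V a) := by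
  rw [star_of_mem V ha, star_of_mem V hb, star_of_mem V (SetLike.GradedMul.mul_mem ha hb), rev_mul,
    smul_mul_smul_comm, smul_smul, revSign_add, mul_comm (revSign m)]

theorem star_star (a : TAlg V) : star V (star V a) = a := by
  induction a using DirectSum.Decomposition.inductionOn (gr V) with
  | zero => simp
  | @homogeneous n a =>
    rw [star_of_mem V (star_mem V n _ a.2), star_of_mem V a.2, LinearMap.map_smulₛₗ,
      rev_rev V a.2, conj_revSign, smul_smul, revSign_mul_self, one_smul]
  | add a b ha hb => rw [map_add, map_add, ha, hb]

theorem leibniz (n : ℤ) (a b : TAlg V) (h : a ∈ gr V n) :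
    d V (a * b) = d V a * b + (-1 : ℂ) ^ n • (a * d V b) := by
  rw [d_mul, parity_of_mem V h, smul_mul_assoc]

theorem star_d (a : TAlg V) : star V (d V a) = d V (star V a) := by
  induction a using DirectSum.Decomposition.inductionOn (gr V) with
  | zero => simp
  | add a b ha hb => simp only [map_add, ha, hb]
  | @homogeneous n a =>
    obtain ⟨a, h⟩ := a
    simp only
    induction h using gr_induction with
    | h0 n => simp
    | ha n a b _ _ h h' => simp only [map_add, h, h']
    | hs n c a _ h => rw [map_smul, LinearMap.map_smulₛₗ, LinearMap.map_smulₛₗ, map_smul, h]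
    | h1 => rw [star_one, d_one, map_zero]
    | hm m n v a p h =>
      rw [leibniz V m _ _ (gen_mem V m v), map_add, d_gen, LinearMap.map_smulₛₗ,
        star_mul V (m - 1) n _ _ (gen_mem V _ _) p,
        star_mul V m (n - 1) _ _ (gen_mem V _ _) (d_mem V n a p),
        star_mul V m n _ _ (gen_mem V _ _) p, map_smul, star_gen, star_gen, h,
        leibniz V n _ _ (star_mem V n a p), d_gen, smul_add, smul_smul, smul_smul, add_comm]
      have h1 : (-1 : ℂ) ^ ((m - 1) * n) = (-1 : ℂ) ^ (m * n) * (-1 : ℂ) ^ n := by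
        rw [sub_mul, one_mul, zpow_sub₀ (by norm_num), div_eq_mul_inv, ← inv_zpow]
        norm_num
      have h2 : conj ((-1 : ℂ) ^ m) * (-1 : ℂ) ^ (m * (n - 1)) = (-1 : ℂ) ^ (m * n) := by
        rw [map_zpow₀, map_neg, map_one, ← zpow_add₀ (by norm_num)]
        congr 1
        ring
      rw [h1, h2]

end TAlg

/-- The free dg `*`-algebra `T_ℂ V` on a real chain complex `V`. -/
def freeDG (V : ChainComplex (ModuleCat.{u} ℝ) ℤ) : DGStarAlg.{u} where
  carrier := TAlg V
  gr := TAlg.gr V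
  d := TAlg.d V
  star := TAlg.star V
  d_mem := TAlg.d_mem V
  d_d := TAlg.d_d V
  leibniz := TAlg.leibniz V
  star_mem := TAlg.star_mem V
  star_star := TAlg.star_star V
  star_mul := TAlg.star_mul V
  star_d := TAlg.star_d V

/-- The inclusion of the elements of `V` of degree `n` into the free dg `*`-algebra. -/
abbrev freeDG.gen (V : ChainComplex (ModuleCat.{u} ℝ) ℤ) (n : ℤ) :
    V.X n →ₗ[ℝ] (freeDG V).carrier := TAlg.gen V n

/-- The morphism of free dg `*`-algebras induced by a chain map. -/
def freeDG.map {V W : ChainComplex (ModuleCat.{u} ℝ) ℤ} (f : V ⟶ W) : freeDG V ⟶ freeDG W :=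
  let F : TAlg V →ₐ[ℂ] TAlg W := TAlg.lift fun n => TAlg.gen W n ∘ₗ (f.f n).hom
  have hF : ∀ n v, F (TAlg.gen V n v) = TAlg.gen W n (f.f n v) := fun n v => TAlg.lift_gen _ n v
  have hmem : ∀ (n : ℤ) (a : TAlg V), a ∈ TAlg.gr V n → F a ∈ TAlg.gr W n := by
    intro n a h
    induction h using TAlg.gr_induction with
    | h0 n => simp
    | ha n a b _ _ h h' => rw [map_add]; exact add_mem h h'
    | hs n c a _ h => rw [map_smul]; exact Submodule.smul_mem _ _ h
    | h1 => rw [map_one]; exact SetLike.GradedOne.one_mem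
    | hm m n v a _ h =>
      rw [map_mul, hF]
      exact SetLike.GradedMul.mul_mem (TAlg.gen_mem W m _) h
  have hd : ∀ a : TAlg V, F (TAlg.d V a) = TAlg.d W (F a) := by
    intro a
    have h1 : ∀ a, F (TAlg.parity V a) = TAlg.parity W (F a) := by
      intro a
      have : F.comp (TAlg.parity V) = (TAlg.parity W).comp F :=
        TAlg.algHom_ext fun n v => by simp [hF]
      exact DFunLike.congr_fun this a
    induction a using TAlg.induction with
    | h1 c => simp [TAlg.d_algebraMap]
    | hg n v =>
      rw [TAlg.d_gen, hF, hF, TAlg.d_gen]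
      have := congrArg (fun g => g.hom v) (f.comm n (n - 1))
      simp only [ModuleCat.hom_comp, LinearMap.comp_apply] at this
      rw [this]
    | hm a b ha hb => rw [TAlg.d_mul, map_add, map_mul, map_mul, ha, hb, h1, map_mul, TAlg.d_mul]
    | ha a b ha hb => simp only [map_add, ha, hb]
  have hs : ∀ a : TAlg V, F (TAlg.star V a) = TAlg.star W (F a) := by
    intro a
    induction a using DirectSum.Decomposition.inductionOn (TAlg.gr V) with
    | zero => simp
    | add a b ha hb => simp only [map_add, ha, hb]
    | @homogeneous n a =>
      obtain ⟨a, h⟩ := a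
      simp only
      induction h using TAlg.gr_induction with
      | h0 n => simp
      | ha n a b _ _ h h' => simp only [map_add, h, h']
      | hs n c a _ h => rw [LinearMap.map_smulₛₗ, map_smul, map_smul, LinearMap.map_smulₛₗ, h]
      | h1 => rw [TAlg.star_one, map_one, TAlg.star_one]
      | hm m n v a p h =>
        rw [TAlg.star_mul V m n _ _ (TAlg.gen_mem V m v) p, map_smul, map_mul, map_mul, h,
          TAlg.star_gen, hF, TAlg.star_mul W m n _ _ (TAlg.gen_mem W m _) (hmem n a p),
          TAlg.star_gen]
  ⟨F, hmem, hd, hs⟩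

@[simp]
theorem freeDG.map_gen {V W : ChainComplex (ModuleCat.{u} ℝ) ℤ} (f : V ⟶ W) (n : ℤ) (v : V.X n) :
    (freeDG.map f).toAlgHom (freeDG.gen V n v) = freeDG.gen W n (f.f n v) :=
  TAlg.lift_gen _ n v

/-! ## The mapping complex `hom(⋀² V, ℝ)` -/

section ExtSq

variable (V : ChainComplex (ModuleCat.{u} ℝ) ℤ)

/-- Families of bilinear maps `V_p × V_q → ℝ` for all degrees `p`, `q`. -/
def BilinFamily : Type u := ∀ p q : ℤ, V.X p →ₗ[ℝ] V.X q →ₗ[ℝ] ℝ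

instance : AddCommGroup (BilinFamily V) :=
  inferInstanceAs (AddCommGroup (∀ p q : ℤ, V.X p →ₗ[ℝ] V.X q →ₗ[ℝ] ℝ))

instance : Module ℝ (BilinFamily V) :=
  inferInstanceAs (Module ℝ (∀ p q : ℤ, V.X p →ₗ[ℝ] V.X q →ₗ[ℝ] ℝ))

theorem BilinFamily.add_apply (α β : BilinFamily V) (p q : ℤ) : (α + β) p q = α p q + β p q := rfl

theorem BilinFamily.smul_apply (c : ℝ) (β : BilinFamily V) (p q : ℤ) :
    (c • β) p q = c • β p q := rfl

theorem BilinFamily.zero_apply (p q : ℤ) : (0 : BilinFamily V) p q = 0 := rfl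

/-- The vector space of `n`-chains of the mapping complex from `⋀² V` to `ℝ`. By the universal
properties of the graded tensor product and of its quotient `⋀² V = V ⊗ V / (v ⊗ w +
(-1)^{|v||w|} w ⊗ v)`, linear maps `(⋀² V)_m → ℝ_{m+n}`, `m ∈ ℤ`, with `ℝ` in degree `0`, are the
same as graded antisymmetric families of bilinear maps `V_p × V_q → ℝ` that vanish unless
`p + q + n = 0`. -/
def extForm (n : ℤ) : Submodule ℝ (BilinFamily V) where
  carrier := {β | (∀ p q, p + q + n ≠ 0 → β p q = 0) ∧
    ∀ p q v w, β p q v w = -((-1 : ℝ) ^ (p * q) * β q p w v)}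
  add_mem' := by
    rintro α β ⟨h1, h2⟩ ⟨h3, h4⟩
    refine ⟨fun p q h => ?_, fun p q v w => ?_⟩
    · simp [BilinFamily.add_apply, h1 p q h, h3 p q h]
    · simp only [BilinFamily.add_apply, LinearMap.add_apply]
      rw [h2, h4]
      ring
  zero_mem' := ⟨fun _ _ _ => rfl, fun p q v w => by simp [BilinFamily.zero_apply]⟩
  smul_mem' := by
    rintro c β ⟨h1, h2⟩
    refine ⟨fun p q h => ?_, fun p q v w => ?_⟩
    · simp [BilinFamily.smul_apply, h1 p q h]
    · simp only [BilinFamily.smul_apply, LinearMap.smul_apply, smul_eq_mul]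
      rw [h2]
      ring

/-- The differential `∂β = d ∘ β - (-1)^n β ∘ d` of the mapping complex in degree `n`, where
`d ∘ β = 0` as the differential of `ℝ` vanishes; `β ∘ d` is evaluated on
`d (v ∧ w) = dv ∧ w + (-1)^{|v|} v ∧ dw`. -/
def boundaryFun (n : ℤ) (β : BilinFamily V) : BilinFamily V := fun p q =>
  -((-1 : ℝ) ^ n) • ((β (p - 1) q).comp (V.d p (p - 1)).hom +
    (-1 : ℝ) ^ p • (β p (q - 1)).compl₂ (V.d q (q - 1)).hom)

theorem boundaryFun_apply (n : ℤ) (β : BilinFamily V) (p q : ℤ) (v : V.X p) (w : V.X q) :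
    boundaryFun V n β p q v w = -((-1 : ℝ) ^ n) *
      (β (p - 1) q (V.d p (p - 1) v) w + (-1 : ℝ) ^ p * β p (q - 1) v (V.d q (q - 1) w)) :=
  rfl

/-- `boundaryFun` as a linear map. -/
def extBoundary (n : ℤ) : BilinFamily V →ₗ[ℝ] BilinFamily V where
  toFun := boundaryFun V n
  map_add' α β := by
    funext p q
    ext v w
    simp only [boundaryFun_apply, BilinFamily.add_apply, LinearMap.add_apply]
    ring
  map_smul' c β := by
    funext p q
    ext v w
    simp only [boundaryFun_apply, BilinFamily.smul_apply, LinearMap.smul_apply, smul_eq_mul,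
      RingHom.id_apply]
    ring

theorem extBoundary_apply (n : ℤ) (β : BilinFamily V) (p q : ℤ) (v : V.X p) (w : V.X q) :
    extBoundary V n β p q v w = -((-1 : ℝ) ^ n) *
      (β (p - 1) q (V.d p (p - 1) v) w + (-1 : ℝ) ^ p * β p (q - 1) v (V.d q (q - 1) w)) :=
  rfl

theorem extBoundary_mem (n : ℤ) (β : BilinFamily V) (h : β ∈ extForm V n) :
    extBoundary V n β ∈ extForm V (n - 1) := by
  obtain ⟨h1, h2⟩ := h
  refine ⟨fun p q h => ?_, fun p q v w => ?_⟩
  · ext v w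
    rw [extBoundary_apply, h1 (p - 1) q (by omega), h1 p (q - 1) (by omega)]
    simp
  · rw [extBoundary_apply, extBoundary_apply, h2 (p - 1) q, h2 p (q - 1)]
    have e1 : (-1 : ℝ) ^ ((p - 1) * q) = (-1 : ℝ) ^ (p * q) * (-1 : ℝ) ^ q := by
      rw [sub_mul, one_mul, zpow_sub₀ (by norm_num), div_eq_mul_inv, ← inv_zpow]
      norm_num
    have e2 : (-1 : ℝ) ^ (p * (q - 1)) = (-1 : ℝ) ^ (p * q) * (-1 : ℝ) ^ p := by
      rw [mul_sub, mul_one, zpow_sub₀ (by norm_num), div_eq_mul_inv, ← inv_zpow]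
      norm_num
    have e3 : (-1 : ℝ) ^ p * (-1 : ℝ) ^ p = 1 := by rw [← mul_zpow]; simp
    rw [e1, e2]
    linear_combination (-1 : ℝ) ^ n * (-1 : ℝ) ^ (p * q) * β (q - 1) p (V.d q (q - 1) w) v * e3

theorem extBoundary_extBoundary (n : ℤ) (β : BilinFamily V) :
    extBoundary V (n - 1) (extBoundary V n β) = 0 := by
  have hd : ∀ (p : ℤ) (v : V.X p), V.d (p - 1) (p - 1 - 1) (V.d p (p - 1) v) = 0 := by
    intro p v
    exact congrArg (fun f => f.hom v) (V.d_comp_d p (p - 1) (p - 1 - 1))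
  funext p q
  ext v w
  rw [extBoundary_apply, extBoundary_apply, extBoundary_apply, hd, hd,
    zpow_sub_one₀ (by norm_num) p, BilinFamily.zero_apply]
  simp only [map_zero, LinearMap.zero_apply, mul_zero, zero_add, add_zero]
  rw [mul_eq_zero]
  right
  ring

/-- The mapping complex `hom(⋀² V, ℝ)`. -/
def homExtSq : ChainComplex (ModuleCat.{u} ℝ) ℤ where
  X n := ModuleCat.of ℝ (extForm V n)
  d i j := ModuleCat.ofHom (if h : j + 1 = i then
    (extBoundary V i).restrict (fun β hβ => by
      have := extBoundary_mem V i β hβ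
      rwa [show i - 1 = j by omega] at this) else 0)
  shape i j h := by
    have h' : ¬ j + 1 = i := h
    ext a
    simp [h']
  d_comp_d' i j k hij hjk := by
    have h1 : j + 1 = i := hij
    have h2 : k + 1 = j := hjk
    obtain rfl : j = i - 1 := by omega
    rw [dif_pos h1, dif_pos h2, ← ModuleCat.ofHom_comp]
    apply ModuleCat.hom_ext
    apply LinearMap.ext
    intro a
    exact Subtype.ext (p := fun β => β ∈ extForm V k) (a2 := 0) (extBoundary_extBoundary V i a.1)

variable {V}

/-- The value `β(v, w)` of a chain `β` of `hom(⋀² V, ℝ)`. -/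
def evalForm {n : ℤ} (β : (homExtSq V).X n) (p q : ℤ) : V.X p →ₗ[ℝ] V.X q →ₗ[ℝ] ℝ :=
  (show extForm V n from β).1 p q

theorem evalForm_d (n : ℤ) (β : (homExtSq V).X (n + 1)) (p q : ℤ) (v : V.X p) (w : V.X q) :
    evalForm ((homExtSq V).d (n + 1) n β) p q v w = (-1 : ℝ) ^ n *
      (evalForm β (p - 1) q (V.d p (p - 1) v) w +
        (-1 : ℝ) ^ p * evalForm β p (q - 1) v (V.d q (q - 1) w)) := by
  have h : (homExtSq V).d (n + 1) n = ModuleCat.ofHom ((extBoundary V (n + 1)).restrict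
      (fun β hβ => by simpa using extBoundary_mem V (n + 1) β hβ)) := by
    simp [homExtSq]
  rw [h]
  refine (extBoundary_apply V (n + 1) _ p q v w).trans ?_
  rw [zpow_add_one₀ (by norm_num)]
  simp [evalForm]

end ExtSq

/-! ## Unshifted Poisson complexes and their CCR quantization -/

/-- An unshifted Poisson complex: a chain complex `V` of real vector spaces with a chain map
`τ : V ∧ V → ℝ`, i.e. a `0`-cycle of `hom(⋀² V, ℝ)`. -/
structure PoCh where
  V : ChainComplex (ModuleCat.{u} ℝ) ℤ
  τ : (homExtSq V).X 0
  closed : (homExtSq V).d 0 (-1) τ = 0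

namespace PoCh

/-- Morphisms of unshifted Poisson complexes: chain maps that preserve the Poisson structures. -/
@[ext]
structure Hom (P Q : PoCh.{u}) where
  hom : P.V ⟶ Q.V
  map_τ : ∀ (p q : ℤ) (v : P.V.X p) (w : P.V.X q),
    evalForm Q.τ p q (hom.f p v) (hom.f q w) = evalForm P.τ p q v w

/-- The category of unshifted Poisson complexes. -/
instance : Category PoCh.{u} where
  Hom := Hom
  id P := ⟨𝟙 P.V, fun _ _ _ _ => rfl⟩
  comp f g := ⟨f.hom ≫ g.hom, fun p q v w =>
    (g.map_τ p q (f.hom.f p v) (f.hom.f q w)).trans (f.map_τ p q v w)⟩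

/-- Weak equivalences of unshifted Poisson complexes: the underlying chain map is a
quasi-isomorphism. -/
def weq : MorphismProperty PoCh.{u} := fun _ _ f => QuasiIso f.hom

/-- The unshifted Poisson complex `(V, τ + ∂ρ)` for a `1`-chain `ρ` of `hom(⋀² V, ℝ)`. -/
def perturb (P : PoCh.{u}) (ρ : (homExtSq P.V).X 1) : PoCh.{u} where
  V := P.V
  τ := P.τ + (homExtSq P.V).d 1 0 ρ
  closed := by
    rw [map_add, P.closed, zero_add]
    exact congrArg (fun f => f.hom ρ) ((homExtSq P.V).d_comp_d 1 0 (-1))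

/-- The canonical commutation relations
`v ⊗ w - (-1)^{|v||w|} w ⊗ v - i τ(v, w) 1` for homogeneous `v`, `w` in `V`. -/
def ccrRel (P : PoCh.{u}) : Set (freeDG P.V).carrier :=
  {r | ∃ (p q : ℤ) (v : P.V.X p) (w : P.V.X q),
    r = freeDG.gen P.V p v * freeDG.gen P.V q w
      - (-1 : ℂ) ^ (p * q) • (freeDG.gen P.V q w * freeDG.gen P.V p v)
      - (Complex.I * (evalForm P.τ p q v w : ℂ)) • (1 : (freeDG P.V).carrier)}

theorem map_ccrRel {P Q : PoCh.{u}} (f : P ⟶ Q) :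
    ∀ r ∈ P.ccrRel, (freeDG.map f.hom).toAlgHom r ∈ Q.ccrRel := by
  rintro _ ⟨p, q, v, w, rfl⟩
  refine ⟨p, q, f.hom.f p v, f.hom.f q w, ?_⟩
  rw [map_sub, map_sub, map_smul, map_smul, map_mul, map_mul, map_one, freeDG.map_gen,
    freeDG.map_gen, f.map_τ]

end PoCh

/-- Morphisms out of a quotient of a free dg `*`-algebra agree if they agree on `V`. -/
theorem freeDG.quotient_hom_ext {V : ChainComplex (ModuleCat.{u} ℝ) ℤ}
    {S : Set (freeDG V).carrier} {B : DGStarAlg.{u}} {φ ψ : (freeDG V).quotient S ⟶ B}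
    (h : ∀ n v, φ.toAlgHom (((freeDG V).proj S).toAlgHom (freeDG.gen V n v)) =
      ψ.toAlgHom (((freeDG V).proj S).toAlgHom (freeDG.gen V n v))) : φ = ψ := by
  apply DGStarAlg.Hom.ext
  apply AlgHom.ext
  intro x
  obtain ⟨a, rfl⟩ := (freeDG V).qmk_surjective S x
  have : φ.toAlgHom.comp ((freeDG V).proj S).toAlgHom =
      ψ.toAlgHom.comp ((freeDG V).proj S).toAlgHom := TAlg.algHom_ext h
  exact DFunLike.congr_fun this a

/-- The CCR quantization functor: `(V, τ)` is sent to the quotient of the free dg `*`-algebra on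
`V` by the two-sided dg `*`-ideal generated by the canonical commutation relations. -/
def CCR : PoCh.{u} ⥤ DGStarAlg.{u} where
  obj P := (freeDG P.V).quotient P.ccrRel
  map f := DGStarAlg.quotientMap (freeDG.map f.hom) (PoCh.map_ccrRel f)
  map_id P := by
    apply freeDG.quotient_hom_ext
    intro n v
    rw [DGStarAlg.quotientMap_proj, freeDG.map_gen]
    rfl
  map_comp f g := by
    apply freeDG.quotient_hom_ext
    intro n v
    rw [DGStarAlg.comp_toAlgHom, DGStarAlg.quotientMap_proj, DGStarAlg.quotientMap_proj,
      DGStarAlg.quotientMap_proj, freeDG.map_gen, freeDG.map_gen, freeDG.map_gen]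
    rfl

/-! ## The enveloping algebra of the enlarged Heisenberg Lie algebra -/

/-- The components of the acyclic complex `D = (ℝ ← ℝ)` in degrees `-1` and `0`. -/
def diskX (n : ℤ) : Submodule ℝ ℝ := if n = 0 ∨ n = -1 then ⊤ else ⊥

/-- The differential of `D`: the identity from degree `0` to degree `-1`. -/
def diskD (i j : ℤ) : diskX i →ₗ[ℝ] diskX j :=
  if h : i = 0 ∧ j = -1 then
    (diskX i).subtype.codRestrict (diskX j) (fun _ => by simp [diskX, h.2]) else 0

/-- The chain complex `V ⊕ D`. -/
def withDisk (V : ChainComplex (ModuleCat.{u} ℝ) ℤ) : ChainComplex (ModuleCat.{u} ℝ) ℤ where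
  X n := ModuleCat.of ℝ (V.X n × diskX n)
  d i j := ModuleCat.ofHom ((V.d i j).hom.prodMap (diskD i j))
  shape i j h := by
    have h' : ¬ j + 1 = i := h
    have h2 : diskD i j = 0 := by
      rw [diskD, dif_neg]
      rintro ⟨rfl, rfl⟩
      exact h' (by norm_num)
    rw [V.shape i j h, h2]
    rfl
  d_comp_d' i j k _ _ := by
    have h1 : (V.d j k).hom ∘ₗ (V.d i j).hom = 0 := by
      rw [← ModuleCat.hom_comp, V.d_comp_d, ModuleCat.hom_zero]
    have h2 : diskD j k ∘ₗ diskD i j = 0 := by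
      by_cases h : i = 0 ∧ j = -1
      · rw [diskD, dif_neg (by omega), LinearMap.zero_comp]
      · rw [diskD, diskD, dif_neg h, LinearMap.comp_zero]
    rw [← ModuleCat.ofHom_comp, LinearMap.prodMap_comp, h1, h2, LinearMap.prodMap_zero]
    rfl

namespace PoCh

variable (P : PoCh.{u}) (ρ : (homExtSq P.V).X 1)

/-- The generator in the free dg `*`-algebra on `V ⊕ D` given by `v` in `V_n`. -/
def vGen (n : ℤ) (v : P.V.X n) : (freeDG (withDisk P.V)).carrier :=
  freeDG.gen (withDisk P.V) n ((v, 0) : P.V.X n × diskX n)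

/-- The generator `x` of degree `0` that spans `D_0`. -/
def xGen : (freeDG (withDisk P.V)).carrier :=
  freeDG.gen (withDisk P.V) 0 ((0, ⟨1, by simp [diskX]⟩) : P.V.X 0 × diskX 0)

/-- The generator `y = d x` of degree `-1`. -/
def yGen : (freeDG (withDisk P.V)).carrier := (freeDG (withDisk P.V)).d P.xGen

/-- The relations of the enveloping algebra of the enlarged Heisenberg Lie algebra
`V_ℂ ⊕ (ℂ x ⊕ ℂ y) ⊕ ℂ 1`: the graded commutators are
`[v, w] = i ∂ρ(v, w) x + i ρ(v, w) y + i τ(v, w) 1`, and `x`, `y` are central in the graded sense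
(`u` is an arbitrary generator of degree `p`). -/
def enlargedRel : Set (freeDG (withDisk P.V)).carrier :=
  {r | ∃ (p q : ℤ) (v : P.V.X p) (w : P.V.X q),
    r = P.vGen p v * P.vGen q w - (-1 : ℂ) ^ (p * q) • (P.vGen q w * P.vGen p v)
      - (Complex.I * (evalForm ((homExtSq P.V).d 1 0 ρ) p q v w : ℂ)) • P.xGen
      - (Complex.I * (evalForm ρ p q v w : ℂ)) • P.yGen
      - (Complex.I * (evalForm P.τ p q v w : ℂ)) • (1 : (freeDG (withDisk P.V)).carrier)} ∪
  {r | ∃ (p : ℤ) (u : (withDisk P.V).X p),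
    r = P.xGen * freeDG.gen (withDisk P.V) p u - freeDG.gen (withDisk P.V) p u * P.xGen} ∪
  {r | ∃ (p : ℤ) (u : (withDisk P.V).X p),
    r = P.yGen * freeDG.gen (withDisk P.V) p u
      - (-1 : ℂ) ^ p • (freeDG.gen (withDisk P.V) p u * P.yGen)}

/-- The dg `*`-algebra `A_{(V,τ,ρ)}`: the unital enveloping algebra of the enlarged Heisenberg
dg Lie `*`-algebra. -/
def enlarged : DGStarAlg.{u} := (freeDG (withDisk P.V)).quotient (P.enlargedRel ρ)

end PoCh

end

/-!
The commutation relations of `CCR(V, τ)` and of the enlarged Heisenberg algebra have the common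
form `[v, w] = ω(v, w)` in a free dg `*`-algebra `T_ℂ V`, where `ω` is closed and takes values in
central elements (`CentralForm`). The mechanism of the proof is that, as a chain complex, such an
algebra does not depend on `ω`: it is naturally isomorphic to the graded symmetric algebra `Sym V`,
which is the case `ω = 0`.

The isomorphism is symmetrization, written without permutations or a Poincaré–Birkhoff–Witt
theorem. `CentralForm.changeForm c` is the linear automorphism `Φ` of `T_ℂ V` determined by
`Φ(1) = 1` and `Φ(v a) = v Φ(a) + c ι_v Φ(a)`, where `ι_v` is the graded derivation
`w ↦ ω(v, w)`. It commutes with the differential, its inverse is `changeForm (-c)`, it carries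
the ideal of the relations for `t ω` to the ideal for `(t - 2 c) ω`, and it is natural for maps
that preserve the forms and are affine on generators. With `c = 1/2` it identifies the algebra of
`ω` with `Sym V` (`PoCh.isoSym`), so that quasi-isomorphisms need only be checked on symmetric
algebras (`PoCh.weq_quotientMap_iff`).

`Sym` preserves quasi-isomorphisms. If `h` contracts `V` onto the image of an idempotent `π`,
the derivation extending `h`, divided by the number of factors in the complement of that image,
contracts `Sym V` onto the image of `Sym π` (`TAlg.numberOp_invWeight`, `PoCh.symHomotopyEquiv`).
Over a field every complex retracts in this way onto a complex with zero differential
(`PoCh.exists_retract`), and a quasi-isomorphism between complexes with zero differential is an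
isomorphism. This gives the invariance of `CCR` under weak equivalences.

For the zig-zag, let `D` be the acyclic complex spanned by `x` and `y = dx`. The evaluations
`x ↦ c`, `y ↦ 0` with `c = 0` and `c = 1` map the enlarged Heisenberg algebra to `CCR(V, τ)` and to
`CCR(V, τ + ∂ρ)`. On symmetric algebras they become maps `Sym (V ⊕ D) → Sym V`, which are left
inverse to the quasi-isomorphism `Sym V → Sym (V ⊕ D)` (`PoCh.weq_symEval`).
-/

noncomputable section

/-! ### Graded derivations of the tensor algebra -/

namespace TAlg

variable {V : ChainComplex (ModuleCat.{u} ℝ) ℤ}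

variable (V) in
/-- The algebra automorphism `a ↦ (-1)^{p|a|} a`, the Koszul sign of moving a symbol of degree `p`
past `a`. -/
def twist (p : ℤ) : TAlg V →ₐ[ℂ] TAlg V := lift fun n => (-1 : ℂ) ^ (p * n) • gen V n

@[simp]
theorem twist_gen (p n : ℤ) (v : V.X n) :
    twist V p (gen V n v) = (-1 : ℂ) ^ (p * n) • gen V n v := by
  simp [twist]

theorem twist_of_mem (p : ℤ) {n : ℤ} {a : TAlg V} (h : a ∈ gr V n) :
    twist V p a = (-1 : ℂ) ^ (p * n) • a := by
  induction h using gr_induction with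
  | h0 n => simp
  | ha n a b _ _ h h' => simp [h, h']
  | hs n c a _ h => rw [map_smul, h, smul_comm]
  | h1 => simp
  | hm m n v a _ h =>
    rw [map_mul, h, twist_gen, smul_mul_smul_comm, mul_add, zpow_add₀ (by norm_num)]

theorem twist_mem (p : ℤ) {n : ℤ} {a : TAlg V} (h : a ∈ gr V n) : twist V p a ∈ gr V n := by
  rw [twist_of_mem p h]
  exact Submodule.smul_mem _ _ h

theorem twist_twist (p q : ℤ) (a : TAlg V) : twist V p (twist V q a) = twist V (p + q) a := by
  have : (twist V p).comp (twist V q) = twist V (p + q) := by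
    apply algHom_ext
    intro n v
    simp only [AlgHom.comp_apply, twist_gen, map_smul, smul_smul]
    rw [← zpow_add₀ (by norm_num)]
    congr 2
    ring
  exact DFunLike.congr_fun this a

theorem twist_one : twist V 1 = parity V := by
  apply algHom_ext
  intro n v
  simp

theorem homogeneous_induction {C : TAlg V → Prop} (h0 : C 0)
    (ha : ∀ a b, C a → C b → C (a + b)) (hh : ∀ n, ∀ a ∈ gr V n, C a) (a : TAlg V) : C a := by
  induction a using DirectSum.Decomposition.inductionOn (gr V) with
  | zero => exact h0
  | homogeneous a => exact hh _ _ a.2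
  | add a b h h' => exact ha a b h h'

/-- `D` raises degrees by `p`. -/
def HasDegree (p : ℤ) (D : TAlg V →ₗ[ℂ] TAlg V) : Prop := ∀ n, ∀ a ∈ gr V n, D a ∈ gr V (n + p)

theorem HasDegree.twist_comm {p : ℤ} {D : TAlg V →ₗ[ℂ] TAlg V} (h : HasDegree p D) (q : ℤ)
    (a : TAlg V) : twist V q (D a) = (-1 : ℂ) ^ (p * q) • D (twist V q a) := by
  induction a using homogeneous_induction with
  | h0 => simp
  | ha a b ha hb => simp only [map_add, ha, hb, smul_add]
  | hh n a ha =>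
    rw [twist_of_mem q (h n a ha), twist_of_mem q ha, map_smul, smul_smul, mul_add,
      zpow_add₀ (by norm_num), mul_comm q p, mul_comm]

/-- `D` is a graded derivation of `T_ℂ V` of parity `p`:
`D(ab) = D(a) b + (-1)^{p|a|} a D(b)`. -/
def IsSkewDer (p : ℤ) (D : TAlg V →ₗ[ℂ] TAlg V) : Prop :=
  ∀ a b, D (a * b) = D a * b + twist V p a * D b

theorem isSkewDer_d : IsSkewDer 1 (d V) := fun a b => by rw [d_mul, twist_one]

theorem hasDegree_d : HasDegree (-1) (d V) := fun n a h => d_mem V n a h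

namespace IsSkewDer

variable {p q : ℤ} {D D' : TAlg V →ₗ[ℂ] TAlg V}

theorem map_one (h : IsSkewDer p D) : D 1 = 0 := by
  have h1 := h 1 1
  rw [mul_one, mul_one, _root_.map_one (twist V p), one_mul] at h1
  simpa using h1

theorem map_algebraMap (h : IsSkewDer p D) (c : ℂ) : D (algebraMap ℂ _ c) = 0 := by
  rw [Algebra.algebraMap_eq_smul_one, map_smul, h.map_one, smul_zero]

theorem ext (h : IsSkewDer p D) (h' : IsSkewDer p D')
    (hg : ∀ n v, D (gen V n v) = D' (gen V n v)) : D = D' := by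
  apply LinearMap.ext
  intro a
  induction a using induction with
  | h1 c => rw [h.map_algebraMap, h'.map_algebraMap]
  | hg n v => exact hg n v
  | hm a b ha hb => rw [h, h', ha, hb]
  | ha a b ha hb => rw [map_add, map_add, ha, hb]

theorem zero : IsSkewDer p (0 : TAlg V →ₗ[ℂ] TAlg V) := fun a b => by simp

theorem add (h : IsSkewDer p D) (h' : IsSkewDer p D') : IsSkewDer p (D + D') := fun a b => by
  simp only [LinearMap.add_apply, h a b, h' a b]
  noncomm_ring

theorem smul (h : IsSkewDer p D) (c : ℂ) : IsSkewDer p (c • D) := fun a b => by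
  simp only [LinearMap.smul_apply, h a b, smul_add, smul_mul_assoc, mul_smul_comm]

theorem congr (h : IsSkewDer p D) (hpq : twist V p = twist V q) : IsSkewDer q D := fun a b => by
  rw [← hpq, h]

/-- The graded commutator of two graded derivations is a graded derivation. The sign exponent `r` is
the product of the degrees of `D` and `D'`, which enters through the commutation with `twist`. -/
theorem bracket {r s : ℤ} (h : IsSkewDer p D) (h' : IsSkewDer q D')
    (hs : ∀ a, twist V p (D' a) = (-1 : ℂ) ^ r • D' (twist V p a))
    (hs' : ∀ a, twist V q (D a) = (-1 : ℂ) ^ r • D (twist V q a)) (hps : p + q = s) :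
    IsSkewDer s (D ∘ₗ D' - (-1 : ℂ) ^ r • D' ∘ₗ D) := fun a b => by
  subst hps
  have e : (-1 : ℂ) ^ r * (-1 : ℂ) ^ r = 1 := neg_one_zpow_mul_self r
  simp only [LinearMap.sub_apply, LinearMap.smul_apply, LinearMap.comp_apply, h _ _, h' _ _,
    map_add, hs, hs', twist_twist, smul_add, smul_mul_assoc, smul_smul, e, one_smul, sub_mul,
    mul_sub, mul_smul_comm, add_comm q p]
  abel

end IsSkewDer

theorem twist_add_two (p : ℤ) : twist V (p + 2) = twist V p := by
  apply algHom_ext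
  intro n v
  rw [twist_gen, twist_gen, add_mul, zpow_add₀ (by norm_num), zpow_mul (-1 : ℂ) 2 n]
  norm_num

/-- The homomorphism `a ↦ ((-1)^{p|a|} a, D a; 0, a)` into upper triangular matrices that encodes
the graded derivation `D` with prescribed values `f` on the generators. It reduces the existence of
`D` to the universal property of `T_ℂ V`. -/
def skewDerMatrix (p : ℤ) (f : ∀ n, V.X n →ₗ[ℝ] TAlg V) :
    TAlg V →ₐ[ℂ] Matrix (Fin 2) (Fin 2) (TAlg V) :=
  lift fun n =>
    { toFun := fun v => !![(-1 : ℂ) ^ (p * n) • gen V n v, f n v; 0, gen V n v]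
      map_add' := fun v w => by
        ext i j; fin_cases i <;> fin_cases j <;> simp
      map_smul' := fun c v => by
        rw [RingHom.id_apply, ← Complex.coe_smul]
        ext i j
        fin_cases i <;> fin_cases j <;> simp [← Complex.coe_smul, smul_comm (c : ℂ)] }

/-- The graded derivation of parity `p` of `T_ℂ V` with prescribed values `f` on the generators. -/
def skewDer (p : ℤ) (f : ∀ n, V.X n →ₗ[ℝ] TAlg V) : TAlg V →ₗ[ℂ] TAlg V :=
  Matrix.entryLinearMap ℂ (TAlg V) 0 1 ∘ₗ (skewDerMatrix p f).toLinearMap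

theorem skewDerMatrix_apply (p : ℤ) (f : ∀ n, V.X n →ₗ[ℝ] TAlg V) (a : TAlg V) :
    skewDerMatrix p f a = !![twist V p a, skewDer p f a; 0, a] := by
  have h : skewDerMatrix p f a 0 0 = twist V p a ∧ skewDerMatrix p f a 1 0 = 0 ∧
      skewDerMatrix p f a 1 1 = a := by
    induction a using induction with
    | h1 c => simp [Matrix.algebraMap_matrix_apply]
    | hg n v => simp [skewDerMatrix]
    | hm a b ha hb =>
      obtain ⟨h1, h2, h3⟩ := ha
      obtain ⟨h1', h2', h3'⟩ := hb
      simp [map_mul, Matrix.mul_apply, Fin.sum_univ_two, *]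
    | ha a b ha hb => simp [ha, hb]
  ext i j
  fin_cases i <;> fin_cases j <;> simp [h, skewDer]

@[simp]
theorem skewDer_gen (p : ℤ) (f : ∀ n, V.X n →ₗ[ℝ] TAlg V) (n : ℤ) (v : V.X n) :
    skewDer p f (gen V n v) = f n v := by
  simp [skewDer, skewDerMatrix]

theorem isSkewDer_skewDer (p : ℤ) (f : ∀ n, V.X n →ₗ[ℝ] TAlg V) : IsSkewDer p (skewDer p f) := by
  intro a b
  have h := congrFun (congrFun (map_mul (skewDerMatrix p f) a b) 0) 1
  rw [skewDerMatrix_apply, skewDerMatrix_apply, skewDerMatrix_apply] at h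
  simp [Matrix.mul_apply, Fin.sum_univ_two] at h
  rw [h, add_comm]

theorem IsSkewDer.hasDegree {p q : ℤ} {D : TAlg V →ₗ[ℂ] TAlg V} (h : IsSkewDer p D)
    (hg : ∀ n v, D (gen V n v) ∈ gr V (n + q)) : HasDegree q D := by
  intro n a ha
  induction ha using gr_induction with
  | h0 n => simp
  | ha n a b _ _ h h' => rw [map_add]; exact add_mem h h'
  | hs n c a _ h => rw [map_smul]; exact Submodule.smul_mem _ c h
  | h1 => rw [h.map_one]; exact zero_mem _
  | hm m n v a ha ih =>
    rw [h]
    refine add_mem ?_ ?_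
    · rw [show m + n + q = (m + q) + n by ring]
      exact SetLike.GradedMul.mul_mem (hg m v) ha
    · rw [add_assoc]
      exact SetLike.GradedMul.mul_mem (twist_mem p (gen_mem V m v)) ih

end TAlg

/-! ### Two-sided ideals and chain maps of quotients -/

namespace DGStarAlg

section TwoSided

variable (A : DGStarAlg.{u}) (S : Set A.carrier)

/-- The two-sided ideal generated by `S`, as the span of the products `a r b` with `r ∈ S`. -/
def twoSided : Submodule ℂ A.carrier :=
  Submodule.span ℂ {x | ∃ a b, ∃ r ∈ S, x = a * r * b}

variable {A S}

theorem mem_twoSided (a b : A.carrier) {r : A.carrier} (h : r ∈ S) : a * r * b ∈ A.twoSided S :=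
  Submodule.subset_span ⟨a, b, r, h, rfl⟩

theorem subset_twoSided {r : A.carrier} (h : r ∈ S) : r ∈ A.twoSided S := by
  simpa using mem_twoSided (A := A) 1 1 h

theorem mul_left_mem_twoSided (a : A.carrier) {x : A.carrier} (h : x ∈ A.twoSided S) :
    a * x ∈ A.twoSided S := by
  induction h using Submodule.span_induction with
  | zero => simp
  | add x y _ _ hx hy => rw [mul_add]; exact add_mem hx hy
  | smul c x _ hx => rw [mul_smul_comm]; exact Submodule.smul_mem _ c hx
  | mem x h =>
    obtain ⟨b, c, r, hr, rfl⟩ := h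
    rw [← mul_assoc, ← mul_assoc]
    exact mem_twoSided _ _ hr

theorem mul_right_mem_twoSided (a : A.carrier) {x : A.carrier} (h : x ∈ A.twoSided S) :
    x * a ∈ A.twoSided S := by
  induction h using Submodule.span_induction with
  | zero => simp
  | add x y _ _ hx hy => rw [add_mul]; exact add_mem hx hy
  | smul c x _ hx => rw [smul_mul_assoc]; exact Submodule.smul_mem _ c hx
  | mem x h =>
    obtain ⟨b, c, r, hr, rfl⟩ := h
    rw [mul_assoc]
    exact mem_twoSided _ _ hr

/-- Products `a r b` with homogeneous `a` and `b` suffice. -/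
theorem twoSided_induction {C : A.carrier → Prop} (h0 : C 0)
    (ha : ∀ x y, C x → C y → C (x + y)) (hs : ∀ (c : ℂ) x, C x → C (c • x))
    (hm : ∀ i j, ∀ a ∈ A.gr i, ∀ b ∈ A.gr j, ∀ r ∈ S, C (a * r * b))
    {x : A.carrier} (hx : x ∈ A.twoSided S) : C x := by
  induction hx using Submodule.span_induction with
  | zero => exact h0
  | add x y _ _ hx hy => exact ha _ _ hx hy
  | smul c x _ hx => exact hs c _ hx
  | mem x h =>
    obtain ⟨a, b, r, hr, rfl⟩ := h
    induction a using DirectSum.Decomposition.inductionOn A.gr with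
    | zero => simpa using h0
    | add a a' h h' => rw [add_mul, add_mul]; exact ha _ _ h h'
    | @homogeneous i a =>
      induction b using DirectSum.Decomposition.inductionOn A.gr with
      | zero => simpa using h0
      | add b b' h h' => rw [mul_add]; exact ha _ _ h h'
      | @homogeneous j b => exact hm i j a a.2 b b.2 r hr

/-- If `S` consists of homogeneous elements and if `d` and the involution map `S` into the
two-sided ideal generated by `S`, then this ideal is already a dg `*`-ideal. -/
theorem mem_dgIdeal_iff (hS : ∀ r ∈ S, ∃ n, r ∈ A.gr n) (hd : ∀ r ∈ S, A.d r ∈ A.twoSided S)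
    (hs : ∀ r ∈ S, A.star r ∈ A.twoSided S) (x : A.carrier) :
    x ∈ A.dgIdeal S ↔ x ∈ A.twoSided S := by
  constructor
  · let I : Ideal A.carrier :=
      { carrier := A.twoSided S
        add_mem' := add_mem
        zero_mem' := zero_mem _
        smul_mem' := fun a _ h => mul_left_mem_twoSided a h }
    refine fun h => A.dgIdeal_le S I ⟨?_, ?_, ?_, ?_⟩ (fun r hr => subset_twoSided hr) h
    · exact fun a b h => mul_right_mem_twoSided b h
    · intro n a h
      change _ ∈ A.twoSided S
      refine twoSided_induction (S := S)
        (C := fun a => ((DirectSum.decompose A.gr a n : A.gr n) : A.carrier) ∈ A.twoSided S)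
        ?_ ?_ ?_ ?_ h
      · simp
      · intro x y hx hy
        simpa using add_mem hx hy
      · intro c x hx
        rw [DirectSum.decompose_smul]
        exact Submodule.smul_mem _ c hx
      · intro i j a ha b hb r hr
        obtain ⟨k, hk⟩ := hS r hr
        have h1 : a * r * b ∈ A.gr (i + k + j) :=
          SetLike.GradedMul.mul_mem (SetLike.GradedMul.mul_mem ha hk) hb
        rw [DirectSum.decompose_of_mem _ h1]
        by_cases hn : i + k + j = n
        · subst hn
          rw [DirectSum.of_eq_same]
          exact mem_twoSided a b hr
        · rw [DirectSum.of_eq_of_ne _ _ _ (Ne.symm hn)]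
          exact zero_mem _
    · intro a h
      refine twoSided_induction (S := S) (C := fun a => A.d a ∈ A.twoSided S) ?_ ?_ ?_ ?_ h
      · simp
      · intro x y hx hy
        rw [map_add]
        exact add_mem hx hy
      · intro c x hx
        rw [map_smul]
        exact Submodule.smul_mem _ c hx
      · intro i j a ha b hb r hr
        obtain ⟨k, hk⟩ := hS r hr
        rw [A.leibniz (i + k) _ b (SetLike.GradedMul.mul_mem ha hk), A.leibniz i a r ha, add_mul,
          smul_mul_assoc]
        refine add_mem (add_mem (mem_twoSided _ _ hr) (Submodule.smul_mem _ _ ?_))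
          (Submodule.smul_mem _ _ (mem_twoSided _ _ hr))
        exact mul_right_mem_twoSided _ (mul_left_mem_twoSided _ (hd r hr))
    · intro a h
      refine twoSided_induction (S := S) (C := fun a => A.star a ∈ A.twoSided S) ?_ ?_ ?_ ?_ h
      · simp
      · intro x y hx hy
        rw [map_add]
        exact add_mem hx hy
      · intro c x hx
        rw [LinearMap.map_smulₛₗ]
        exact Submodule.smul_mem _ _ hx
      · intro i j a ha b hb r hr
        obtain ⟨k, hk⟩ := hS r hr
        rw [A.star_mul (i + k) j _ b (SetLike.GradedMul.mul_mem ha hk) hb, A.star_mul i k a r ha hk]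
        refine Submodule.smul_mem _ _ (mul_left_mem_twoSided _ ?_)
        exact Submodule.smul_mem _ _ (mul_right_mem_twoSided _ (hs r hr))
  · intro h
    have hI := A.dgIdeal_isDGStarIdeal S
    induction h using Submodule.span_induction with
    | zero => exact zero_mem _
    | add x y _ _ hx hy => exact add_mem hx hy
    | smul c x _ hx =>
      rw [← one_mul x, ← smul_mul_assoc]
      exact Ideal.mul_mem_left _ _ hx
    | mem x h =>
      obtain ⟨a, b, r, hr, rfl⟩ := h
      exact hI.mul_mem_right _ _ (Ideal.mul_mem_left _ _ (A.subset_dgIdeal S hr))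

end TwoSided

section ComplexMap

variable {A B C : DGStarAlg.{u}} {S : Set A.carrier} {T : Set B.carrier} {U : Set C.carrier}

/-- A linear map `L : A → B`, not necessarily multiplicative, that induces a chain map
`A / (S) → B / (T)` of the quotients by the generated dg `*`-ideals. -/
structure IsChainMap (S : Set A.carrier) (T : Set B.carrier) (L : A.carrier →ₗ[ℂ] B.carrier) :
    Prop where
  map_mem : ∀ n, ∀ a ∈ A.gr n, L a ∈ B.gr n
  map_d : ∀ a, L (A.d a) = B.d (L a)
  map_ideal : ∀ a ∈ A.dgIdeal S, L a ∈ B.dgIdeal T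

/-- The linear map of quotients induced by a linear map that maps one ideal into the other. -/
def qmap (L : A.carrier →ₗ[ℂ] B.carrier) (h : ∀ a ∈ A.dgIdeal S, L a ∈ B.dgIdeal T) :
    (A.quotient S).carrier →ₗ[ℂ] (B.quotient T).carrier :=
  A.qlift S ((B.qmk T).toLinearMap ∘ₗ L) fun a ha => (B.qmk_eq_zero T).2 (h a ha)

theorem qmap_mem (L : A.carrier →ₗ[ℂ] B.carrier) (h : ∀ a ∈ A.dgIdeal S, L a ∈ B.dgIdeal T)
    {m n : ℤ} (hL : ∀ a ∈ A.gr m, L a ∈ B.gr n) :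
    ∀ x ∈ (A.quotient S).gr m, qmap L h x ∈ (B.quotient T).gr n := by
  rintro _ ⟨a, ha, rfl⟩
  exact ⟨L a, hL a ha, rfl⟩

/-- The chain map of quotients induced by a linear map. -/
def complexMap {L : A.carrier →ₗ[ℂ] B.carrier} (h : IsChainMap S T L) :
    toComplex.obj (A.quotient S) ⟶ toComplex.obj (B.quotient T) where
  f n := ModuleCat.ofHom ((qmap L h.map_ideal).restrict
    (qmap_mem L h.map_ideal (m := n) (n := n) (h.map_mem n)))
  comm' i j hij := by
    have h1 : j + 1 = i := hij
    ext ⟨_, a, ha, rfl⟩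
    apply Subtype.ext
    refine ((B.quotient T).dComp_apply i j h1 _).trans (Eq.trans ?_
      (congrArg (qmap L h.map_ideal) ((A.quotient S).dComp_apply i j h1 _).symm))
    exact congrArg (B.qmk T) (h.map_d a).symm

theorem toComplex_map_quotientMap (φ : A ⟶ B) (h : ∀ a ∈ S, φ.toAlgHom a ∈ T)
    (h' : IsChainMap S T φ.toAlgHom.toLinearMap) :
    toComplex.map (quotientMap φ h) = complexMap h' := by
  ext n ⟨_, a, ha, rfl⟩
  rfl

theorem isChainMap_of_hom (φ : A ⟶ B) (h : ∀ a ∈ S, φ.toAlgHom a ∈ T) :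
    IsChainMap S T φ.toAlgHom.toLinearMap :=
  ⟨φ.map_mem, φ.map_d, map_mem_dgIdeal φ h⟩

theorem IsChainMap.comp {L : A.carrier →ₗ[ℂ] B.carrier} {M : B.carrier →ₗ[ℂ] C.carrier}
    (h : IsChainMap S T L) (h' : IsChainMap T U M) : IsChainMap S U (M ∘ₗ L) where
  map_mem n a ha := h'.map_mem n _ (h.map_mem n a ha)
  map_d a := by rw [LinearMap.comp_apply, h.map_d, h'.map_d]; rfl
  map_ideal a ha := h'.map_ideal _ (h.map_ideal a ha)

theorem complexMap_comp {L : A.carrier →ₗ[ℂ] B.carrier} {M : B.carrier →ₗ[ℂ] C.carrier}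
    (h : IsChainMap S T L) (h' : IsChainMap T U M) :
    complexMap h ≫ complexMap h' = complexMap (h.comp h') := by
  ext n ⟨_, a, ha, rfl⟩
  rfl

theorem complexMap_congr {L M : A.carrier →ₗ[ℂ] B.carrier} (h : IsChainMap S T L)
    (h' : IsChainMap S T M) (e : L = M) : complexMap h = complexMap h' := by
  subst e
  rfl

theorem complexMap_id {L : A.carrier →ₗ[ℂ] A.carrier} (h : IsChainMap S S L)
    (e : L = LinearMap.id) : complexMap h = 𝟙 _ := by
  subst e
  ext n ⟨_, a, ha, rfl⟩
  rfl

/-- Mutually inverse linear maps that induce chain maps of quotients induce an isomorphism. -/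
def complexIso {L : A.carrier →ₗ[ℂ] B.carrier} {M : B.carrier →ₗ[ℂ] A.carrier}
    (h : IsChainMap S T L) (h' : IsChainMap T S M) (e : M ∘ₗ L = LinearMap.id)
    (e' : L ∘ₗ M = LinearMap.id) :
    toComplex.obj (A.quotient S) ≅ toComplex.obj (B.quotient T) where
  hom := complexMap h
  inv := complexMap h'
  hom_inv_id := by rw [complexMap_comp, complexMap_id _ e]
  inv_hom_id := by rw [complexMap_comp, complexMap_id _ e']

/-- The component `X_i → Y_j` of a linear map of degree `1` (zero unless `j = i + 1`). -/
def degreeOneComp {X Y : DGStarAlg.{u}} (G : X.carrier →ₗ[ℂ] Y.carrier)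
    (hG : ∀ n, ∀ a ∈ X.gr n, G a ∈ Y.gr (n + 1)) (i j : ℤ) : X.gr i →ₗ[ℂ] Y.gr j :=
  if h : i + 1 = j then G.restrict (fun a ha => by
    have := hG i a ha
    rwa [h] at this) else 0

theorem degreeOneComp_apply {X Y : DGStarAlg.{u}} (G : X.carrier →ₗ[ℂ] Y.carrier)
    (hG : ∀ n, ∀ a ∈ X.gr n, G a ∈ Y.gr (n + 1)) (i j : ℤ) (h : i + 1 = j) (a : X.gr i) :
    (degreeOneComp G hG i j a : Y.carrier) = G a := by
  simp [degreeOneComp, h]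

/-- `degreeOneComp` as a morphism between the terms of the underlying complexes. -/
def degreeOneHom {X Y : DGStarAlg.{u}} (G : X.carrier →ₗ[ℂ] Y.carrier)
    (hG : ∀ n, ∀ a ∈ X.gr n, G a ∈ Y.gr (n + 1)) (i j : ℤ) :
    (toComplex.obj X).X i ⟶ (toComplex.obj Y).X j := ModuleCat.ofHom (degreeOneComp G hG i j)

/-- A linear map `G` of degree `1` that maps the ideal generated by `S` into the one generated by
`T` and satisfies `L - M = d G + G d` induces a homotopy between the chain maps induced by `L` and
`M`. -/
def complexHomotopy {L M : A.carrier →ₗ[ℂ] B.carrier} (h : IsChainMap S T L)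
    (h' : IsChainMap S T M) (G : A.carrier →ₗ[ℂ] B.carrier)
    (hG : ∀ n, ∀ a ∈ A.gr n, G a ∈ B.gr (n + 1)) (hI : ∀ a ∈ A.dgIdeal S, G a ∈ B.dgIdeal T)
    (e : ∀ a, L a = B.d (G a) + G (A.d a) + M a) : Homotopy (complexMap h) (complexMap h') where
  hom i j := degreeOneHom (X := A.quotient S) (Y := B.quotient T) (qmap G hI)
    (fun n => qmap_mem G hI (hG n)) i j
  zero i j hij := by
    have h' : ¬ i + 1 = j := hij
    rw [degreeOneHom, degreeOneComp, dif_neg h']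
    rfl
  comm n := by
    have r1 : (ComplexShape.down ℤ).Rel n (n - 1) := by simp
    have r2 : (ComplexShape.down ℤ).Rel (n + 1) n := by simp
    rw [dNext_eq _ r1, prevD_eq _ r2]
    ext ⟨x, a, ha, rfl⟩
    apply Subtype.ext
    have e1 := degreeOneComp_apply (X := A.quotient S) (Y := B.quotient T) (qmap G hI)
      (fun n => qmap_mem G hI (hG n)) (n - 1) n (by omega)
      ((A.quotient S).dComp n (n - 1) ⟨_, a, ha, rfl⟩)
    rw [(A.quotient S).dComp_apply n (n - 1) (by omega)] at e1
    have e2 := (B.quotient T).dComp_apply (n + 1) n rfl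
      (degreeOneComp (X := A.quotient S) (Y := B.quotient T) (qmap G hI)
        (fun n => qmap_mem G hI (hG n)) n (n + 1) ⟨_, a, ha, rfl⟩)
    rw [degreeOneComp_apply (X := A.quotient S) (Y := B.quotient T) _ _ n (n + 1) rfl] at e2
    refine Eq.trans ?_ (congrArg (fun z : (B.quotient T).carrier => z + (B.proj T).toAlgHom (M a))
      (congrArg₂ (· + ·) e1 e2)).symm
    change B.qmk T (L a) = B.qmk T (G (A.d a)) + B.qmk T (B.d (G a)) + B.qmk T (M a)
    rw [e, map_add, map_add, add_comm (B.qmk T (B.d (G a)))]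

end ComplexMap

end DGStarAlg

/-! ### Change of the commutation relations -/

namespace TAlg

/-- A graded antisymmetric, closed, anti-self-adjoint bilinear form on `V` with values in the
subspace of `T_ℂ V` spanned by `1` and by the elements of `V` in the kernel of the form. It
describes the commutators of a two-step nilpotent dg Lie `*`-algebra with unit. -/
structure CentralForm (V : ChainComplex (ModuleCat.{u} ℝ) ℤ) where
  form : ∀ p q : ℤ, V.X p →ₗ[ℝ] V.X q →ₗ[ℝ] TAlg V
  mem_gr : ∀ p q v w, form p q v w ∈ gr V (p + q)
  antisymm : ∀ p q v w, form p q v w = -((-1 : ℂ) ^ (p * q) • form q p w v)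
  d_form : ∀ p q v w, d V (form p q v w) =
    form (p - 1) q (V.d p (p - 1) v) w + (-1 : ℂ) ^ p • form p (q - 1) v (V.d q (q - 1) w)
  star_form : ∀ p q v w, star V (form p q v w) = -form p q v w
  mem_center : ∀ p q v w, form p q v w ∈
    Submodule.span ℂ ({1} ∪ {a | ∃ n k, a = gen V n k ∧ ∀ q w, form n q k w = 0})

variable {V : ChainComplex (ModuleCat.{u} ℝ) ℤ}

/-- Induction on the number of factors, multiplying by generators from the left. -/
theorem left_induction {C : TAlg V → Prop} (h0 : C 0) (ha : ∀ a b, C a → C b → C (a + b))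
    (hs : ∀ (c : ℂ) a, C a → C (c • a)) (h1 : C 1)
    (hm : ∀ m v a, C a → C (gen V m v * a)) (a : TAlg V) : C a := by
  induction a using homogeneous_induction with
  | h0 => exact h0
  | ha a b h h' => exact ha a b h h'
  | hh n a h =>
    induction h using gr_induction with
    | h0 n => exact h0
    | ha n a b _ _ h h' => exact ha a b h h'
    | hs n c a _ h => exact hs c a h
    | h1 => exact h1
    | hm m n v a _ h => exact hm m v a h

namespace CentralForm

variable (ω : CentralForm V)

/-- The span of `1` and of the elements of `V` in the kernel of the form. -/
def center : Submodule ℂ (TAlg V) :=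
  Submodule.span ℂ ({1} ∪ {a | ∃ n k, a = gen V n k ∧ ∀ q w, ω.form n q k w = 0})

variable {ω} in
theorem center_induction {C : ∀ z, z ∈ ω.center → Prop} (h0 : C 0 (zero_mem _))
    (ha : ∀ a b p q, C a p → C b q → C (a + b) (add_mem p q))
    (hs : ∀ (c : ℂ) a p, C a p → C (c • a) (Submodule.smul_mem _ c p))
    (h1 : C 1 (Submodule.subset_span (Or.inl rfl)))
    (hk : ∀ n k, ∀ h : ∀ q w, ω.form n q k w = 0,
      C (gen V n k) (Submodule.subset_span (Or.inr ⟨n, k, rfl, h⟩))) {z : TAlg V}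
    (hz : z ∈ ω.center) : C z hz := by
  induction hz using Submodule.span_induction with
  | zero => exact h0
  | add x y p q hx hy => exact ha x y p q hx hy
  | smul c x p hx => exact hs c x p hx
  | mem x h =>
    obtain rfl | ⟨n, k, rfl, hk'⟩ := h
    · exact h1
    · exact hk n k hk'

/-- The relations `v w - (-1)^{|v||w|} w v - t ω(v, w)`. -/
def rel (t : ℂ) : Set (freeDG V).carrier :=
  {r | ∃ (p q : ℤ) (v : V.X p) (w : V.X q),
    r = gen V p v * gen V q w - (-1 : ℂ) ^ (p * q) • (gen V q w * gen V p v) - t • ω.form p q v w}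

/-- The two-sided ideal generated by the relations `v w - (-1)^{|v||w|} w v - t ω(v, w)`. -/
def ideal (t : ℂ) : Submodule ℂ (TAlg V) := (freeDG V).twoSided (ω.rel t)

variable {ω} in
theorem rel_mem_ideal (t : ℂ) (p q : ℤ) (v : V.X p) (w : V.X q) :
    gen V p v * gen V q w - (-1 : ℂ) ^ (p * q) • (gen V q w * gen V p v) - t • ω.form p q v w ∈
      ω.ideal t :=
  DGStarAlg.subset_twoSided (A := freeDG V) ⟨p, q, v, w, rfl⟩

theorem rel_mem_gr (t : ℂ) (p q : ℤ) (v : V.X p) (w : V.X q) :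
    gen V p v * gen V q w - (-1 : ℂ) ^ (p * q) • (gen V q w * gen V p v) - t • ω.form p q v w ∈
      gr V (p + q) := by
  refine sub_mem (sub_mem ?_ (Submodule.smul_mem _ _ ?_)) (Submodule.smul_mem _ _ (ω.mem_gr p q v w))
  · exact SetLike.GradedMul.mul_mem (gen_mem V p v) (gen_mem V q w)
  · rw [add_comm]
    exact SetLike.GradedMul.mul_mem (gen_mem V q w) (gen_mem V p v)

theorem mul_left_mem (t : ℂ) (a : TAlg V) {x : TAlg V} (h : x ∈ ω.ideal t) : a * x ∈ ω.ideal t :=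
  DGStarAlg.mul_left_mem_twoSided (A := freeDG V) a h

theorem mul_right_mem (t : ℂ) (a : TAlg V) {x : TAlg V} (h : x ∈ ω.ideal t) : x * a ∈ ω.ideal t :=
  DGStarAlg.mul_right_mem_twoSided (A := freeDG V) a h

variable {ω} in
theorem ideal_induction {t : ℂ} {C : TAlg V → Prop} (h0 : C 0)
    (ha : ∀ x y, C x → C y → C (x + y)) (hs : ∀ (c : ℂ) x, C x → C (c • x))
    (hm : ∀ (a b : TAlg V) p q v w, C (a * (gen V p v * gen V q w -
      (-1 : ℂ) ^ (p * q) • (gen V q w * gen V p v) - t • ω.form p q v w) * b))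
    {x : TAlg V} (hx : x ∈ ω.ideal t) : C x := by
  induction hx using Submodule.span_induction with
  | zero => exact h0
  | add x y _ _ hx hy => exact ha x y hx hy
  | smul c x _ hx => exact hs c x hx
  | mem x h =>
    obtain ⟨a, b, _, ⟨p, q, v, w, rfl⟩, rfl⟩ := h
    exact hm a b p q v w

/-- For `t` real, the two-sided ideal generated by the relations is the dg `*`-ideal. -/
theorem mem_dgIdeal_rel_iff {t : ℂ} (ht : conj t = t) (x : TAlg V) :
    x ∈ (freeDG V).dgIdeal (ω.rel t) ↔ x ∈ ω.ideal t := by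
  apply DGStarAlg.mem_dgIdeal_iff (A := freeDG V)
  · rintro _ ⟨p, q, v, w, rfl⟩
    exact ⟨p + q, ω.rel_mem_gr t p q v w⟩
  · rintro _ ⟨p, q, v, w, rfl⟩
    change d V _ ∈ ω.ideal t
    -- `d r(v, w) = r(dv, w) + (-1)^{|v|} r(v, dw)`
    have h := add_mem (rel_mem_ideal (ω := ω) t (p - 1) q (V.d p (p - 1) v) w)
      (Submodule.smul_mem _ ((-1 : ℂ) ^ p)
        (rel_mem_ideal (ω := ω) t p (q - 1) v (V.d q (q - 1) w)))
    convert h using 1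
    have e1 : (-1 : ℂ) ^ ((p - 1) * q) = (-1 : ℂ) ^ (p * q) * (-1 : ℂ) ^ q := by
      rw [sub_mul, one_mul, zpow_sub₀ (by norm_num), div_eq_mul_inv, ← inv_zpow]
      norm_num
    have e2 : (-1 : ℂ) ^ p * (-1 : ℂ) ^ (p * (q - 1)) = (-1 : ℂ) ^ (p * q) := by
      rw [← zpow_add₀ (by norm_num)]
      congr 1
      ring
    simp only [map_sub, map_smul, leibniz V p _ _ (gen_mem V p v),
      leibniz V q _ _ (gen_mem V q w), d_gen, ω.d_form, e1, smul_add, smul_sub, smul_smul, e2]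
    rw [mul_comm t ((-1 : ℂ) ^ p)]
    abel
  · rintro _ ⟨p, q, v, w, rfl⟩
    change star V _ ∈ ω.ideal t
    have h := neg_mem (rel_mem_ideal (ω := ω) t p q v w)
    convert h using 1
    have e : (-1 : ℂ) ^ (p * q) * (-1 : ℂ) ^ (q * p) = 1 := by
      rw [mul_comm q p, neg_one_zpow_mul_self]
    simp only [map_sub, LinearMap.map_smulₛₗ, star_mul V p q _ _ (gen_mem V p v) (gen_mem V q w),
      star_mul V q p _ _ (gen_mem V q w) (gen_mem V p v), star_gen, ω.star_form, map_zpow₀, map_neg,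
      map_one, ht, smul_smul, e, one_smul, smul_neg]
    abel

/-! #### Contractions -/

/-- The graded derivation `ω(v, ·)` of `T_ℂ V`. -/
def contract (p : ℤ) (v : V.X p) : TAlg V →ₗ[ℂ] TAlg V := skewDer p fun q => ω.form p q v

@[simp]
theorem contract_gen (p : ℤ) (v : V.X p) (q : ℤ) (w : V.X q) :
    ω.contract p v (gen V q w) = ω.form p q v w := skewDer_gen _ _ _ _

theorem isSkewDer_contract (p : ℤ) (v : V.X p) : IsSkewDer p (ω.contract p v) :=
  isSkewDer_skewDer _ _

theorem hasDegree_contract (p : ℤ) (v : V.X p) : HasDegree p (ω.contract p v) :=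
  (ω.isSkewDer_contract p v).hasDegree fun q w => by
    rw [contract_gen, add_comm]
    exact ω.mem_gr p q v w

theorem contract_add (p : ℤ) (v w : V.X p) :
    ω.contract p (v + w) = ω.contract p v + ω.contract p w :=
  (ω.isSkewDer_contract p _).ext ((ω.isSkewDer_contract p v).add (ω.isSkewDer_contract p w))
    fun n u => by simp

theorem contract_smul (p : ℤ) (c : ℝ) (v : V.X p) :
    ω.contract p (c • v) = (c : ℂ) • ω.contract p v :=
  (ω.isSkewDer_contract p _).ext ((ω.isSkewDer_contract p v).smul c)
    fun n u => by simp

theorem contract_eq_zero (p : ℤ) (v : V.X p) (h : ∀ q w, ω.form p q v w = 0) :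
    ω.contract p v = 0 :=
  (ω.isSkewDer_contract p _).ext IsSkewDer.zero fun n u => by simp [h]

theorem contract_center (p : ℤ) (v : V.X p) {z : TAlg V} (hz : z ∈ ω.center) :
    ω.contract p v z = 0 := by
  induction hz using center_induction with
  | h0 => simp
  | ha a b _ _ h h' => rw [map_add, h, h', add_zero]
  | hs c a _ h => rw [map_smul, h, smul_zero]
  | h1 => exact (ω.isSkewDer_contract p v).map_one
  | hk n k hk => rw [contract_gen, ω.antisymm, hk, smul_zero, neg_zero]

/-- Contractions commute in the graded sense: their graded commutator is a graded derivation that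
vanishes on generators, as the form takes values in the center. -/
theorem contract_contract (p q : ℤ) (v : V.X p) (w : V.X q) (a : TAlg V) :
    ω.contract p v (ω.contract q w a) =
      (-1 : ℂ) ^ (p * q) • ω.contract q w (ω.contract p v a) := by
  have h := ((ω.isSkewDer_contract p v).bracket (r := p * q) (ω.isSkewDer_contract q w)
    (fun a => by rw [(ω.hasDegree_contract q w).twist_comm, mul_comm q p])
    (fun a => by rw [(ω.hasDegree_contract p v).twist_comm]) rfl).ext
      (IsSkewDer.zero (V := V)) fun n u => by
        simp only [LinearMap.sub_apply, LinearMap.smul_apply, LinearMap.comp_apply, contract_gen,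
          ω.contract_center p v (ω.mem_center _ _ _ _),
          ω.contract_center q w (ω.mem_center _ _ _ _), smul_zero, sub_zero, LinearMap.zero_apply]
  exact sub_eq_zero.1 (DFunLike.congr_fun h a)

/-- The graded commutator of `d` with the contraction by `v` is the contraction by `dv`; this is the
closedness of the form. -/
theorem d_contract (p : ℤ) (v : V.X p) (a : TAlg V) :
    d V (ω.contract p v a) =
      ω.contract (p - 1) (V.d p (p - 1) v) a + (-1 : ℂ) ^ p • ω.contract p v (d V a) := by
  have e : twist V (p - 1) = twist V (1 + p) := by
    rw [← twist_add_two (p - 1)]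
    congr 1
    ring
  have h := ((isSkewDer_d (V := V)).bracket (r := p) (ω.isSkewDer_contract p v)
    (fun a => by rw [(ω.hasDegree_contract p v).twist_comm, mul_one])
    (fun a => by
      rw [hasDegree_d.twist_comm, neg_one_mul, zpow_neg, ← inv_zpow]
      norm_num) rfl).ext
      ((ω.isSkewDer_contract (p - 1) (V.d p (p - 1) v)).congr e) fun n u => by
        simp only [LinearMap.sub_apply, LinearMap.smul_apply, LinearMap.comp_apply, contract_gen,
          d_gen, ω.d_form, add_sub_cancel_right]
  exact sub_eq_iff_eq_add.1 (DFunLike.congr_fun h a)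

/-! #### The change of form -/

/-- The action of `V` on `T_ℂ V` by `a ↦ v a + c ω(v, ·) a`. -/
def changeFormAux (c : ℂ) : TAlg V →ₐ[ℂ] Module.End ℂ (TAlg V) :=
  lift fun n =>
    { toFun := fun v => LinearMap.mulLeft ℂ (gen V n v) + c • ω.contract n v
      map_add' := fun v w => by
        rw [contract_add]
        ext a
        simp [add_mul]
        abel
      map_smul' := fun x v => by
        rw [contract_smul, RingHom.id_apply, ← Complex.coe_smul]
        ext a
        simp [← Complex.coe_smul, smul_comm (x : ℂ)] }

/-- The linear map `Φ_c` of `T_ℂ V` with `Φ_c(1) = 1` and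
`Φ_c(v a) = v Φ_c(a) + c ω(v, ·) Φ_c(a)`. -/
def changeForm (c : ℂ) : TAlg V →ₗ[ℂ] TAlg V :=
  LinearMap.applyₗ (1 : TAlg V) ∘ₗ (ω.changeFormAux c).toLinearMap

theorem changeForm_one (c : ℂ) : ω.changeForm c 1 = 1 := by
  simp [changeForm]

theorem changeForm_gen_mul (c : ℂ) (n : ℤ) (v : V.X n) (a : TAlg V) :
    ω.changeForm c (gen V n v * a) =
      gen V n v * ω.changeForm c a + c • ω.contract n v (ω.changeForm c a) := by
  simp [changeForm, changeFormAux]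

theorem changeForm_center_mul (c : ℂ) (a : TAlg V) {z : TAlg V} (hz : z ∈ ω.center) :
    ω.changeForm c (z * a) = z * ω.changeForm c a := by
  induction hz using center_induction with
  | h0 => simp
  | ha x y _ _ h h' => rw [add_mul, map_add, h, h', add_mul]
  | hs x z _ h => rw [smul_mul_assoc, map_smul, h, smul_mul_assoc]
  | h1 => rw [one_mul, one_mul]
  | hk n k hk =>
    rw [changeForm_gen_mul, ω.contract_eq_zero n k hk, LinearMap.zero_apply, smul_zero, add_zero]

theorem changeForm_contract (c : ℂ) (p : ℤ) (v : V.X p) (a : TAlg V) :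
    ω.changeForm c (ω.contract p v a) = ω.contract p v (ω.changeForm c a) := by
  induction a using left_induction with
  | h0 => simp
  | ha a b h h' => simp only [map_add, h, h']
  | hs x a h => simp only [map_smul, h]
  | h1 => rw [changeForm_one, (ω.isSkewDer_contract p v).map_one, map_zero]
  | hm q w a h =>
    rw [ω.isSkewDer_contract p v, contract_gen, twist_gen, map_add,
      ω.changeForm_center_mul c _ (ω.mem_center _ _ _ _), smul_mul_assoc, map_smul,
      changeForm_gen_mul, h, changeForm_gen_mul, map_add, ω.isSkewDer_contract p v, contract_gen,
      twist_gen, map_smul, ω.contract_contract p q, smul_add, smul_mul_assoc, add_assoc,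
      smul_comm c]

theorem changeForm_neg_changeForm (c : ℂ) (a : TAlg V) :
    ω.changeForm (-c) (ω.changeForm c a) = a := by
  induction a using left_induction with
  | h0 => simp
  | ha a b h h' => simp only [map_add, h, h']
  | hs x a h => simp only [map_smul, h]
  | h1 => rw [changeForm_one, changeForm_one]
  | hm q w a h =>
    rw [changeForm_gen_mul, map_add, changeForm_gen_mul, map_smul, changeForm_contract, h,
      neg_smul, neg_add_cancel_right]

theorem changeForm_mem (c : ℂ) (n : ℤ) (a : TAlg V) (h : a ∈ gr V n) :
    ω.changeForm c a ∈ gr V n := by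
  induction h using gr_induction with
  | h0 n => simp
  | ha n a b _ _ h h' => rw [map_add]; exact add_mem h h'
  | hs n x a _ h => rw [map_smul]; exact Submodule.smul_mem _ x h
  | h1 => rw [changeForm_one]; exact SetLike.GradedOne.one_mem
  | hm m n v a _ h =>
    rw [changeForm_gen_mul]
    refine add_mem (SetLike.GradedMul.mul_mem (gen_mem V m v) h) (Submodule.smul_mem _ _ ?_)
    rw [add_comm]
    exact ω.hasDegree_contract m v n _ h

theorem changeForm_d (c : ℂ) (a : TAlg V) : ω.changeForm c (d V a) = d V (ω.changeForm c a) := by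
  induction a using left_induction with
  | h0 => simp
  | ha a b h h' => simp only [map_add, h, h']
  | hs x a h => simp only [map_smul, h]
  | h1 => rw [d_one, map_zero, changeForm_one, d_one]
  | hm m v a h =>
    rw [leibniz V m _ _ (gen_mem V m v), changeForm_gen_mul, map_add, map_add, map_smul, map_smul,
      leibniz V m _ _ (gen_mem V m v), d_gen, changeForm_gen_mul, changeForm_gen_mul, h,
      d_contract, smul_add, smul_add, smul_comm c]
    abel

/-- Elements of the center commute in the graded sense with generators modulo the relations. -/
theorem center_mul_gen (t : ℂ) (q : ℤ) (w : V.X q) {z : TAlg V} (hz : z ∈ ω.center) :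
    z * gen V q w - gen V q w * twist V q z ∈ ω.ideal t := by
  induction hz using center_induction with
  | h0 => simp
  | ha x y _ _ h h' =>
    convert add_mem h h' using 1
    rw [map_add]
    noncomm_ring
  | hs x z _ h =>
    convert Submodule.smul_mem _ x h using 1
    rw [map_smul, smul_mul_assoc, mul_smul_comm, smul_sub]
  | h1 => simp
  | hk n k hk =>
    convert rel_mem_ideal (ω := ω) t n q k w using 1
    rw [hk, smul_zero, sub_zero, twist_gen, mul_smul_comm, mul_comm q n]

theorem contract_mem_ideal (t : ℂ) (s : ℤ) (u : V.X s) {x : TAlg V} (hx : x ∈ ω.ideal t) :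
    ω.contract s u x ∈ ω.ideal t := by
  have hD := ω.isSkewDer_contract s u
  refine ideal_induction (C := fun x => ω.contract s u x ∈ ω.ideal t) ?_ ?_ ?_ ?_ hx
  · rw [map_zero]
    exact zero_mem _
  · intro x y hx hy
    rw [map_add]
    exact add_mem hx hy
  · intro c x hx
    rw [map_smul]
    exact Submodule.smul_mem _ c hx
  · intro a b p q v w
    set r := gen V p v * gen V q w - (-1 : ℂ) ^ (p * q) • (gen V q w * gen V p v) -
      t • ω.form p q v w with hr
    have hr0 : r ∈ ω.ideal t := rel_mem_ideal t p q v w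
    have hr1 : ω.contract s u r ∈ ω.ideal t := by
      have h1 := sub_mem (ω.center_mul_gen t q w (ω.mem_center s p u v)) (Submodule.smul_mem _
        ((-1 : ℂ) ^ (p * q)) (ω.center_mul_gen t p v (ω.mem_center s q u w)))
      convert h1 using 1
      have e1 : (-1 : ℂ) ^ (p * q) * (-1 : ℂ) ^ (s * q) = (-1 : ℂ) ^ (q * (s + p)) := by
        rw [← zpow_add₀ (by norm_num)]
        congr 1
        ring
      have e2 : (-1 : ℂ) ^ (p * q) * (-1 : ℂ) ^ (p * (s + q)) = (-1 : ℂ) ^ (s * p) := by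
        rw [← zpow_add₀ (by norm_num), show p * q + p * (s + q) = p * s + (p * q + p * q) by ring,
          zpow_add₀ (by norm_num), zpow_add₀ (by norm_num), neg_one_zpow_mul_self, mul_one,
          mul_comm p s]
      rw [hr, map_sub, map_sub, map_smul, map_smul, ω.contract_center s u (ω.mem_center _ _ _ _),
        hD, hD, contract_gen, contract_gen, twist_gen, twist_gen,
        twist_of_mem q (ω.mem_gr s p u v), twist_of_mem p (ω.mem_gr s q u w)]
      simp only [smul_add, smul_sub, mul_smul_comm, smul_mul_assoc, smul_smul, e1, e2, smul_zero,
        sub_zero]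
      abel
    have e : twist V s r = (-1 : ℂ) ^ (s * (p + q)) • r := twist_of_mem s (ω.rel_mem_gr t p q v w)
    rw [hD, hD, map_mul, e, add_mul]
    refine add_mem (add_mem (ω.mul_right_mem t _ (ω.mul_left_mem t _ hr0))
      (ω.mul_right_mem t _ (ω.mul_left_mem t _ hr1)))
      (ω.mul_right_mem t _ (ω.mul_left_mem t _ (Submodule.smul_mem _ _ hr0)))

/-- `Φ_c` maps the ideal of the relations for `t ω` into the one for `(t - 2c) ω`: in the image of
`v w - (-1)^{|v||w|} w v`, each of the two terms contributes `c ω(v, w)`. -/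
theorem changeForm_mem_ideal (c t t' : ℂ) (ht : t' = t - 2 * c) {x : TAlg V}
    (hx : x ∈ ω.ideal t) : ω.changeForm c x ∈ ω.ideal t' := by
  subst ht
  refine ideal_induction (C := fun x => ω.changeForm c x ∈ ω.ideal (t - 2 * c)) ?_ ?_ ?_ ?_ hx
  · rw [map_zero]
    exact zero_mem _
  · intro x y hx hy
    rw [map_add]
    exact add_mem hx hy
  · intro x y hy
    rw [map_smul]
    exact Submodule.smul_mem _ x hy
  · intro a b p q v w
    rw [mul_assoc]
    induction a using left_induction with
    | h0 => simp
    | ha a b h h' => rw [add_mul, map_add]; exact add_mem h h'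
    | hs x a h => rw [smul_mul_assoc, map_smul]; exact Submodule.smul_mem _ _ h
    | hm m v a h =>
      rw [mul_assoc, changeForm_gen_mul]
      exact add_mem (ω.mul_left_mem _ _ h) (Submodule.smul_mem _ _ (ω.contract_mem_ideal _ _ _ h))
    | h1 =>
      rw [one_mul]
      -- `Φ_c` turns the relation for `t` into the relation for `t - 2c`
      convert ω.mul_right_mem (t - 2 * c) (ω.changeForm c b)
        (rel_mem_ideal (ω := ω) (t - 2 * c) p q v w) using 1
      have e : (-1 : ℂ) ^ (p * q) * (-1 : ℂ) ^ (q * p) = 1 := by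
        rw [mul_comm q p, neg_one_zpow_mul_self]
      have hs : (-1 : ℂ) ^ (p * q) • ω.form q p w v = -ω.form p q v w := by
        rw [ω.antisymm p q v w, neg_neg]
      simp only [sub_mul, smul_mul_assoc, map_sub, map_smul, mul_assoc, changeForm_gen_mul, map_add,
        ω.changeForm_center_mul c _ (ω.mem_center p q v w), ω.isSkewDer_contract p v _ _,
        ω.isSkewDer_contract q w _ _, contract_gen, twist_gen, mul_add, mul_smul_comm, smul_add,
        ω.contract_contract p q v w, smul_smul]
      rw [show (-1 : ℂ) ^ (p * q) * (c * (-1 : ℂ) ^ (q * p)) = c by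
        rw [mul_left_comm, e, mul_one], show (-1 : ℂ) ^ (p * q) * c = c * (-1 : ℂ) ^ (p * q) from
        mul_comm _ _, mul_smul c ((-1 : ℂ) ^ (p * q)) (ω.form q p w v * _),
        ← smul_mul_assoc _ (ω.form q p w v), hs]
      simp only [neg_mul, smul_neg, sub_smul, two_mul, add_smul]
      rw [show (-1 : ℂ) ^ (p * q) * (c * c) = c * (c * (-1 : ℂ) ^ (p * q)) by ring]
      abel

theorem isChainMap_changeForm (c t t' : ℂ) (h : conj t = t) (h' : conj t' = t')
    (ht : t' = t - 2 * c) {S S' : Set (freeDG V).carrier}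
    (hS : (freeDG V).dgIdeal S = (freeDG V).dgIdeal (ω.rel t))
    (hS' : (freeDG V).dgIdeal S' = (freeDG V).dgIdeal (ω.rel t')) :
    DGStarAlg.IsChainMap (A := freeDG V) (B := freeDG V) S S' (ω.changeForm c) where
  map_mem := ω.changeForm_mem c
  map_d := ω.changeForm_d c
  map_ideal a ha := by
    rw [hS] at ha
    rw [hS']
    exact (ω.mem_dgIdeal_rel_iff h' _).2
      (ω.changeForm_mem_ideal c t t' ht ((ω.mem_dgIdeal_rel_iff h a).1 ha))

/-- The change of form is natural with respect to algebra homomorphisms that preserve the degrees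
and the forms and are linear on generators up to constants. -/
theorem map_changeForm {U : ChainComplex (ModuleCat.{u} ℝ) ℤ} (η : CentralForm U)
    (F : TAlg U →ₐ[ℂ] TAlg V) (f : ∀ n, U.X n → V.X n) (ε : ∀ n, U.X n → ℂ)
    (hmem : ∀ n, ∀ a ∈ gr U n, F a ∈ gr V n)
    (hF : ∀ n u, F (gen U n u) = gen V n (f n u) + algebraMap ℂ _ (ε n u))
    (hω : ∀ p q u u', F (η.form p q u u') = ω.form p q (f p u) (f q u')) (c : ℂ) (a : TAlg U) :
    F (η.changeForm c a) = ω.changeForm c (F a) := by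
  have htwist : ∀ p a, F (twist U p a) = twist V p (F a) := by
    intro p a
    induction a using homogeneous_induction with
    | h0 => simp
    | ha a b h h' => simp only [map_add, h, h']
    | hh n a h => rw [twist_of_mem p h, twist_of_mem p (hmem n a h), map_smul]
  have hcontract : ∀ p u a, F (η.contract p u a) = ω.contract p (f p u) (F a) := by
    intro p u a
    induction a using left_induction with
    | h0 => simp
    | ha a b h h' => simp only [map_add, h, h']
    | hs c a h => simp only [map_smul, h]
    | h1 =>
      rw [(η.isSkewDer_contract p u).map_one, map_one, (ω.isSkewDer_contract p _).map_one, map_zero]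
    | hm n v a h =>
      rw [η.isSkewDer_contract p u, contract_gen, map_add, map_mul, map_mul, h, hω, htwist, map_mul,
        ω.isSkewDer_contract p, hF, map_add (ω.contract p (f p u)), contract_gen,
        (ω.isSkewDer_contract p _).map_algebraMap, add_zero]
  induction a using left_induction with
  | h0 => simp
  | ha a b h h' => simp only [map_add, h, h']
  | hs c a h => simp only [map_smul, h]
  | h1 => rw [changeForm_one, map_one, changeForm_one]
  | hm n u a h =>
    rw [changeForm_gen_mul, map_add, map_mul, map_smul, hcontract, h, map_mul, hF, add_mul, add_mul,
      map_add, changeForm_gen_mul, ← Algebra.smul_def, ← Algebra.smul_def, map_smul]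
    abel

end CentralForm

end TAlg

/-! ### Graded symmetric algebras of deformation retracts -/

namespace TAlg

variable {V : ChainComplex (ModuleCat.{u} ℝ) ℤ}

variable (V) in
/-- The zero form, whose relations define the graded symmetric algebra. -/
def zeroForm : CentralForm V where
  form _ _ := 0
  mem_gr _ _ _ _ := zero_mem _
  antisymm _ _ _ _ := by simp
  d_form _ _ _ _ := by simp
  star_form _ _ _ _ := by simp
  mem_center _ _ _ _ := zero_mem _

theorem sym_rel_mem (p q : ℤ) (v : V.X p) (w : V.X q) :
    gen V p v * gen V q w - (-1 : ℂ) ^ (p * q) • (gen V q w * gen V p v) ∈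
      (zeroForm V).ideal 0 := by
  simpa using CentralForm.rel_mem_ideal (ω := zeroForm V) 0 p q v w

theorem sym_ideal_induction {C : TAlg V → Prop} (h0 : C 0)
    (ha : ∀ x y, C x → C y → C (x + y)) (hs : ∀ (c : ℂ) x, C x → C (c • x))
    (hm : ∀ (a b : TAlg V) p q v w, C (a * (gen V p v * gen V q w -
      (-1 : ℂ) ^ (p * q) • (gen V q w * gen V p v)) * b))
    {x : TAlg V} (hx : x ∈ (zeroForm V).ideal 0) : C x :=
  CentralForm.ideal_induction h0 ha hs (fun a b p q v w => by simpa using hm a b p q v w) hx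

section Retract

variable (π : V ⟶ V)

/-- The homomorphism `v ↦ π v + X (v - π v)`, which records in the exponent of `X` how many factors
lie in the kernel of the idempotent `π`. -/
def weightHom : TAlg V →ₐ[ℂ] Polynomial (TAlg V) :=
  lift fun n =>
    { toFun := fun v => Polynomial.monomial 0 (gen V n (π.f n v)) +
        Polynomial.monomial 1 (gen V n (v - π.f n v))
      map_add' := fun v w => by
        simp only [map_add, map_sub]
        abel
      map_smul' := fun c v => by
        have h : π.f n (c • v) = c • π.f n v := (π.f n).hom.map_smul c v
        simp only [h, ← smul_sub, map_smul, RingHom.id_apply, ← Complex.coe_smul, smul_add,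
          Polynomial.smul_monomial] }

theorem weightHom_gen (n : ℤ) (v : V.X n) : weightHom π (gen V n v) =
    Polynomial.monomial 0 (gen V n (π.f n v)) +
      Polynomial.monomial 1 (gen V n (v - π.f n v)) := lift_gen _ n v

/-- The projection to the part with `k` factors in the kernel of `π`. -/
def weight (k : ℕ) : TAlg V →ₗ[ℂ] TAlg V where
  toFun a := (weightHom π a).coeff k
  map_add' a b := by rw [map_add, Polynomial.coeff_add]
  map_smul' c a := by rw [map_smul, Polynomial.coeff_smul, RingHom.id_apply]

theorem weight_apply (k : ℕ) (a : TAlg V) : weight π k a = (weightHom π a).coeff k := rfl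

theorem weight_zero_gen_mul (n : ℤ) (v : V.X n) (a : TAlg V) :
    weight π 0 (gen V n v * a) = gen V n (π.f n v) * weight π 0 a := by
  rw [weight_apply, map_mul, weightHom_gen, Polynomial.mul_coeff_zero]
  simp [weight_apply]

theorem weight_succ_gen_mul (k : ℕ) (n : ℤ) (v : V.X n) (a : TAlg V) :
    weight π (k + 1) (gen V n v * a) =
      gen V n (π.f n v) * weight π (k + 1) a + gen V n (v - π.f n v) * weight π k a := by
  rw [weight_apply, map_mul, weightHom_gen, add_mul, Polynomial.coeff_add,
    Polynomial.coeff_monomial_zero_mul, Polynomial.coeff_monomial_mul]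
  rfl

theorem weight_one (k : ℕ) : weight π k 1 = if k = 0 then 1 else 0 := by
  rw [weight_apply, map_one, Polynomial.coeff_one]

theorem weight_zero_eq_map (a : TAlg V) : weight π 0 a = (freeDG.map π).toAlgHom a := by
  induction a using left_induction with
  | h0 => rw [map_zero]; exact (map_zero (freeDG.map π).toAlgHom).symm
  | ha a b h h' => rw [map_add, h, h']; exact (map_add (freeDG.map π).toAlgHom a b).symm
  | hs c a h => rw [map_smul, h]; exact (map_smul (freeDG.map π).toAlgHom c a).symm
  | h1 => rw [weight_one, if_pos rfl]; exact (map_one (freeDG.map π).toAlgHom).symm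
  | hm n v a h =>
    rw [weight_zero_gen_mul, h]
    exact ((map_mul (freeDG.map π).toAlgHom _ _).trans
      (congrArg (· * (freeDG.map π).toAlgHom a) (freeDG.map_gen π n v))).symm

theorem weight_mem (n : ℤ) (j : ℕ) (a : TAlg V) (h : a ∈ gr V n) : weight π j a ∈ gr V n := by
  induction h using gr_induction generalizing j with
  | h0 n => simp
  | ha n a b _ _ h h' => rw [map_add]; exact add_mem (h j) (h' j)
  | hs n c a _ h => rw [map_smul]; exact Submodule.smul_mem _ c (h j)
  | h1 =>
    rw [weight_one]
    split
    · exact SetLike.GradedOne.one_mem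
    · exact zero_mem _
  | hm m n v a _ h =>
    cases j with
    | zero =>
      rw [weight_zero_gen_mul]
      exact SetLike.GradedMul.mul_mem (gen_mem V m _) (h 0)
    | succ j =>
      rw [weight_succ_gen_mul]
      exact add_mem (SetLike.GradedMul.mul_mem (gen_mem V m _) (h _))
        (SetLike.GradedMul.mul_mem (gen_mem V m _) (h _))

theorem weight_d (j : ℕ) (a : TAlg V) : weight π j (d V a) = d V (weight π j a) := by
  have hc : ∀ n (v : V.X n), π.f (n - 1) (V.d n (n - 1) v) = V.d n (n - 1) (π.f n v) := by
    intro n v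
    exact congrArg (fun g => g.hom v) (π.comm n (n - 1)).symm
  induction a using left_induction generalizing j with
  | h0 => simp
  | ha a b h h' => simp only [map_add, h, h']
  | hs c a h => simp only [map_smul, h]
  | h1 => rw [d_one, map_zero, weight_one]; split <;> simp
  | hm m v a h =>
    rw [leibniz V m _ _ (gen_mem V m v), d_gen, map_add, map_smul]
    cases j with
    | zero =>
      rw [weight_zero_gen_mul, weight_zero_gen_mul, weight_zero_gen_mul,
        leibniz V m _ _ (gen_mem V m _), d_gen, h, hc]
    | succ j =>
      rw [weight_succ_gen_mul, weight_succ_gen_mul, weight_succ_gen_mul, map_add,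
        leibniz V m _ _ (gen_mem V m _), leibniz V m _ _ (gen_mem V m _), d_gen, d_gen, h, h, hc,
        map_sub (V.d m (m - 1)).hom, smul_add]
      abel

theorem weight_mem_ideal (k : ℕ) {x : TAlg V} (hx : x ∈ (zeroForm V).ideal 0) :
    weight π k x ∈ (zeroForm V).ideal 0 := by
  refine sym_ideal_induction (C := fun x => weight π k x ∈ (zeroForm V).ideal 0) ?_ ?_ ?_ ?_ hx
  · rw [map_zero]
    exact zero_mem _
  · intro x y hx hy
    rw [map_add]
    exact add_mem hx hy
  · intro c x hx
    rw [map_smul]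
    exact Submodule.smul_mem _ c hx
  · intro a b p q v w
    rw [weight_apply, map_mul, map_mul, Polynomial.coeff_mul]
    refine sum_mem fun i _ => CentralForm.mul_right_mem _ _ _ ?_
    rw [Polynomial.coeff_mul]
    refine sum_mem fun j _ => CentralForm.mul_left_mem _ _ _ ?_
    generalize j.2 = l
    set v₀ := π.f p v
    set w₀ := π.f q w
    -- the coefficients are again relations, between the components of `v` and `w`
    have e : weightHom π (gen V p v * gen V q w - (-1 : ℂ) ^ (p * q) • (gen V q w * gen V p v)) =
        Polynomial.monomial 0
          (gen V p v₀ * gen V q w₀ - (-1 : ℂ) ^ (p * q) • (gen V q w₀ * gen V p v₀)) +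
        Polynomial.monomial 1
          ((gen V p v₀ * gen V q (w - w₀) -
            (-1 : ℂ) ^ (p * q) • (gen V q (w - w₀) * gen V p v₀)) +
          (gen V p (v - v₀) * gen V q w₀ -
            (-1 : ℂ) ^ (p * q) • (gen V q w₀ * gen V p (v - v₀)))) +
        Polynomial.monomial 2
          (gen V p (v - v₀) * gen V q (w - w₀) -
            (-1 : ℂ) ^ (p * q) • (gen V q (w - w₀) * gen V p (v - v₀))) := by
      rw [map_sub, map_smul, map_mul, map_mul, weightHom_gen, weightHom_gen]
      generalize v - π.f p v = v₁
      generalize w - π.f q w = w₁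
      simp only [mul_add, add_mul, Polynomial.monomial_mul_monomial, map_add, map_sub, smul_add,
        Polynomial.smul_monomial, add_zero, zero_add, Nat.reduceAdd, v₀, w₀]
      abel
    rw [e, Polynomial.coeff_add, Polynomial.coeff_add, Polynomial.coeff_monomial,
      Polynomial.coeff_monomial, Polynomial.coeff_monomial]
    refine add_mem (add_mem ?_ ?_) ?_
    · split
      · exact sym_rel_mem _ _ _ _
      · exact zero_mem _
    · split
      · exact add_mem (sym_rel_mem _ _ _ _) (sym_rel_mem _ _ _ _)
      · exact zero_mem _
    · split
      · exact sym_rel_mem _ _ _ _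
      · exact zero_mem _

theorem exists_weight_bound (a : TAlg V) : ∃ m, ∀ k, m ≤ k → weight π k a = 0 := by
  refine ⟨(weightHom π a).natDegree + 1, fun k hk => ?_⟩
  exact Polynomial.coeff_eq_zero_of_natDegree_lt (Nat.lt_of_succ_le hk)

theorem sum_weight (a : TAlg V) : ∃ m, ∀ n, m ≤ n → ∑ k ∈ Finset.range n, weight π k a = a := by
  induction a using left_induction with
  | h0 => exact ⟨0, by simp⟩
  | ha a b h h' =>
    obtain ⟨m, h⟩ := h
    obtain ⟨m', h'⟩ := h'
    refine ⟨max m m', fun n hn => ?_⟩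
    simp only [map_add, Finset.sum_add_distrib, h n (le_of_max_le_left hn),
      h' n (le_of_max_le_right hn)]
  | hs c a h =>
    obtain ⟨m, h⟩ := h
    exact ⟨m, fun n hn => by simp only [map_smul, ← Finset.smul_sum, h n hn]⟩
  | h1 =>
    refine ⟨1, fun n hn => ?_⟩
    simp only [weight_one]
    rw [Finset.sum_ite_eq' (Finset.range n) 0, if_pos (Finset.mem_range.2 (by omega))]
  | hm p v a h =>
    obtain ⟨m, h⟩ := h
    refine ⟨m + 1, fun n hn => ?_⟩
    obtain ⟨n, rfl⟩ : ∃ l, n = l + 1 := ⟨n - 1, by omega⟩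
    rw [Finset.sum_range_succ']
    simp only [weight_succ_gen_mul, weight_zero_gen_mul, Finset.sum_add_distrib, ← Finset.mul_sum]
    have h' := h (n + 1) (by omega)
    rw [Finset.sum_range_succ'] at h'
    rw [h n (by omega), add_right_comm, ← mul_add, h', ← add_mul, ← map_add, add_sub_cancel]

/-- The operator that divides the component of weight `k` by `k` if `k ≠ 0`, and annihilates the
component of weight `0`. -/
def invWeight : TAlg V →ₗ[ℂ] TAlg V where
  toFun a := (weightHom π a).sum fun k x => (k : ℂ)⁻¹ • x
  map_add' a b := by
    rw [map_add]
    exact Polynomial.sum_add_index _ _ _ (fun _ => smul_zero _) (fun _ _ _ => smul_add _ _ _)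
  map_smul' c a := by
    rw [map_smul, RingHom.id_apply, Polynomial.smul_sum, Polynomial.sum_smul_index']
    · simp only [smul_comm c]
    · simp

theorem invWeight_eq {a : TAlg V} {n : ℕ} (h : ∀ k, n ≤ k → weight π k a = 0) :
    invWeight π a = ∑ k ∈ Finset.range n, (k : ℂ)⁻¹ • weight π k a := by
  refine Polynomial.sum_eq_of_subset _ (fun _ => smul_zero _) ?_
  intro k hk
  by_contra hn
  exact Polynomial.mem_support_iff.1 hk (h k (by simpa using hn))

theorem invWeight_mem (n : ℤ) (a : TAlg V) (h : a ∈ gr V n) : invWeight π a ∈ gr V n := by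
  obtain ⟨m, hm⟩ := exists_weight_bound π a
  rw [invWeight_eq π hm]
  exact sum_mem fun k _ => Submodule.smul_mem _ _ (weight_mem π n k a h)

theorem invWeight_mem_ideal {x : TAlg V} (hx : x ∈ (zeroForm V).ideal 0) :
    invWeight π x ∈ (zeroForm V).ideal 0 := by
  obtain ⟨m, hm⟩ := exists_weight_bound π x
  rw [invWeight_eq π hm]
  exact sum_mem fun k _ => Submodule.smul_mem _ _ (weight_mem_ideal π k hx)

theorem invWeight_d (a : TAlg V) : invWeight π (d V a) = d V (invWeight π a) := by
  obtain ⟨m, hm⟩ := exists_weight_bound π a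
  rw [invWeight_eq π hm, invWeight_eq π (n := m) fun k hk => by rw [weight_d, hm k hk, map_zero],
    map_sum]
  simp only [map_smul, weight_d]

variable {π} (t : Homotopy (𝟙 V) π)

/-- The graded derivation of degree `1` that extends a homotopy from the identity to `π`. -/
def homotopyDer : TAlg V →ₗ[ℂ] TAlg V :=
  skewDer 1 fun n => gen V (n + 1) ∘ₗ (t.hom n (n + 1)).hom

theorem homotopyDer_gen (n : ℤ) (v : V.X n) :
    homotopyDer t (gen V n v) = gen V (n + 1) (t.hom n (n + 1) v) := skewDer_gen _ _ _ _

theorem isSkewDer_homotopyDer : IsSkewDer 1 (homotopyDer t) := isSkewDer_skewDer _ _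

theorem hasDegree_homotopyDer : HasDegree 1 (homotopyDer t) :=
  (isSkewDer_homotopyDer t).hasDegree fun n v => by
    rw [homotopyDer_gen]
    exact gen_mem V _ _

theorem homotopyDer_mem_ideal {x : TAlg V} (hx : x ∈ (zeroForm V).ideal 0) :
    homotopyDer t x ∈ (zeroForm V).ideal 0 := by
  have hD := isSkewDer_homotopyDer t
  refine sym_ideal_induction (C := fun x => homotopyDer t x ∈ (zeroForm V).ideal 0) ?_ ?_ ?_ ?_ hx
  · rw [map_zero]
    exact zero_mem _
  · intro x y hx hy
    rw [map_add]
    exact add_mem hx hy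
  · intro c x hx
    rw [map_smul]
    exact Submodule.smul_mem _ c hx
  · intro a b p q v w
    set r := gen V p v * gen V q w - (-1 : ℂ) ^ (p * q) • (gen V q w * gen V p v) with hr
    have hr0 : r ∈ (zeroForm V).ideal 0 := sym_rel_mem p q v w
    have hr1 : homotopyDer t r ∈ (zeroForm V).ideal 0 := by
      have h := add_mem (sym_rel_mem (p + 1) q (t.hom p (p + 1) v) w)
        (Submodule.smul_mem _ ((-1 : ℂ) ^ p) (sym_rel_mem p (q + 1) v (t.hom q (q + 1) w)))
      convert h using 1
      have e1 : (-1 : ℂ) ^ ((p + 1) * q) = (-1 : ℂ) ^ (p * q) * (-1 : ℂ) ^ q := by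
        rw [add_mul, one_mul, zpow_add₀ (by norm_num)]
      have e2 : (-1 : ℂ) ^ p * (-1 : ℂ) ^ (p * (q + 1)) = (-1 : ℂ) ^ (p * q) := by
        rw [mul_add, mul_one, zpow_add₀ (by norm_num), mul_left_comm, neg_one_zpow_mul_self,
          mul_one]
      simp only [hr, map_sub, map_smul, hD _ _, homotopyDer_gen, twist_gen, one_mul, e1, smul_add,
        smul_sub, smul_smul, e2, smul_mul_assoc]
      abel
    have e : twist V 1 r ∈ (zeroForm V).ideal 0 := by
      simp only [hr, map_sub, map_smul, map_mul, twist_gen, smul_mul_smul_comm]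
      rw [mul_comm ((-1 : ℂ) ^ (1 * q)), smul_comm, ← smul_sub]
      exact Submodule.smul_mem _ _ hr0
    rw [hD, hD, map_mul, add_mul]
    exact add_mem (add_mem (CentralForm.mul_right_mem _ _ _ (CentralForm.mul_left_mem _ _ _ hr0))
      (CentralForm.mul_right_mem _ _ _ (CentralForm.mul_left_mem _ _ _ hr1)))
      (CentralForm.mul_right_mem _ _ _ (CentralForm.mul_left_mem _ _ _ e))

/-- The operator `d h + h d` for the derivation `h` that extends a homotopy from the identity to `π`.
It is an ungraded derivation and counts the factors in the kernel of `π`. -/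
def numberOp : TAlg V →ₗ[ℂ] TAlg V := d V ∘ₗ homotopyDer t + homotopyDer t ∘ₗ d V

theorem numberOp_mul (a b : TAlg V) : numberOp t (a * b) = numberOp t a * b + a * numberOp t b := by
  have h := (isSkewDer_d (V := V)).bracket (r := 1) (isSkewDer_homotopyDer t)
    (fun a => by rw [(hasDegree_homotopyDer t).twist_comm, mul_one])
    (fun a => by rw [hasDegree_d.twist_comm]; norm_num) (show (1 : ℤ) + 1 = 0 + 2 by norm_num) a b
  have e : twist V (0 + 2) a = a := by
    rw [twist_add_two]
    have : twist V 0 = AlgHom.id ℂ _ := algHom_ext fun n v => by simp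
    rw [this, AlgHom.id_apply]
  rw [e] at h
  simpa [numberOp] using h

theorem numberOp_one : numberOp t 1 = 0 := by
  simp [numberOp, (isSkewDer_homotopyDer t).map_one]

theorem numberOp_gen (n : ℤ) (v : V.X n) : numberOp t (gen V n v) = gen V n (v - π.f n v) := by
  have r1 : (ComplexShape.down ℤ).Rel n (n - 1) := by simp
  have r2 : (ComplexShape.down ℤ).Rel (n + 1) n := by simp
  have h := congrArg (fun g => g.hom v) (t.comm n)
  rw [dNext_eq _ r1, prevD_eq _ r2] at h
  have h' : v = t.hom (n - 1) n (V.d n (n - 1) v) + V.d (n + 1) n (t.hom n (n + 1) v) + π.f n v := h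
  -- `n + 1 - 1` and `n - 1 + 1` agree with `n` only propositionally
  have e1 : ∀ m (x : V.X (n + 1)), m = n →
      gen V m (V.d (n + 1) m x) = gen V n (V.d (n + 1) n x) := by
    rintro m x rfl
    rfl
  have e2 : ∀ m (x : V.X (n - 1)), m = n →
      gen V m (t.hom (n - 1) m x) = gen V n (t.hom (n - 1) n x) := by
    rintro m x rfl
    rfl
  rw [numberOp, LinearMap.add_apply, LinearMap.comp_apply, LinearMap.comp_apply, homotopyDer_gen,
    d_gen, d_gen, homotopyDer_gen, e1 _ _ (by omega), e2 _ _ (by omega), ← map_add]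
  congr 1
  rw [eq_sub_iff_add_eq, add_comm (V.d (n + 1) n _)]
  exact h'.symm

theorem numberOp_weight (hπ : π ≫ π = π) (k : ℕ) (a : TAlg V) :
    numberOp t (weight π k a) = (k : ℂ) • weight π k a := by
  have hπ' : ∀ n (v : V.X n), π.f n (π.f n v) = π.f n v := fun n v =>
    congrArg (fun g => (g.f n).hom v) hπ
  induction a using left_induction generalizing k with
  | h0 => simp
  | ha a b h h' => simp only [map_add, h, h', smul_add]
  | hs c a h => rw [map_smul, map_smul, h, smul_comm]
  | h1 =>
    rw [weight_one]
    split
    · next h => simp [h, numberOp_one]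
    · simp
  | hm m v a h =>
    cases k with
    | zero => simp [weight_zero_gen_mul, numberOp_mul, numberOp_gen, h, hπ']
    | succ k =>
      have e : π.f m (v - π.f m v) = 0 := by rw [map_sub, hπ', sub_self]
      simp only [weight_succ_gen_mul, map_add, numberOp_mul, numberOp_gen, h, hπ', e, sub_self,
        map_zero, zero_mul, zero_add, sub_zero, mul_smul_comm, Nat.cast_add, Nat.cast_one, add_smul,
        one_smul, smul_add]
      rw [mul_add, mul_smul_comm]
      abel

/-- With `h N⁻¹` for `h = homotopyDer t` and `N⁻¹ = invWeight π`, which commutes with `d`, this is the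
homotopy formula between the identity and the projection to weight `0`. -/
theorem numberOp_invWeight (hπ : π ≫ π = π) (a : TAlg V) :
    numberOp t (invWeight π a) = a - weight π 0 a := by
  obtain ⟨m, hm⟩ := exists_weight_bound π a
  obtain ⟨m', hm'⟩ := sum_weight π a
  have h1 := hm' (max m m' + 1) (by omega)
  rw [invWeight_eq π (n := max m m' + 1) fun k hk => hm k (by omega), map_sum]
  simp only [map_smul, numberOp_weight t hπ, smul_smul]
  rw [Finset.sum_range_succ'] at h1 ⊢
  conv_rhs => rw [← h1]
  rw [Nat.cast_zero, mul_zero, zero_smul, add_zero, add_sub_assoc]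
  have h2 : weight π 0 (∑ k ∈ Finset.range (max m m'), weight π (k + 1) a + weight π 0 a) =
    weight π 0 a := by rw [h1]
  rw [h2, sub_self, add_zero]
  refine Finset.sum_congr rfl fun k _ => ?_
  rw [inv_mul_cancel₀ (Nat.cast_ne_zero.2 (Nat.succ_ne_zero k)), one_smul]

end Retract

end TAlg

/-! ### The graded symmetric algebra preserves quasi-isomorphisms -/

namespace PoCh

/-- A chain complex with the zero Poisson structure. -/
def trivial (V : ChainComplex (ModuleCat.{u} ℝ) ℤ) : PoCh.{u} := ⟨V, 0, map_zero _⟩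

/-- Chain complexes as unshifted Poisson complexes with zero Poisson structure. -/
def trivialFunctor : ChainComplex (ModuleCat.{u} ℝ) ℤ ⥤ PoCh.{u} where
  obj := trivial
  map f := ⟨f, fun _ _ _ _ => rfl⟩

/-- The underlying complex of the complexified graded symmetric algebra `Sym V = CCR(V, 0)`. -/
def symComplex : ChainComplex (ModuleCat.{u} ℝ) ℤ ⥤ ChainComplex (ModuleCat.{u} ℂ) ℤ :=
  trivialFunctor ⋙ CCR ⋙ DGStarAlg.toComplex

theorem trivial_ccrRel {V : ChainComplex (ModuleCat.{u} ℝ) ℤ} (ω : TAlg.CentralForm V) :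
    (trivial V).ccrRel = ω.rel 0 := by
  refine Set.ext fun (r : TAlg V) => ?_
  refine exists_congr fun p => exists_congr fun q => exists_congr fun v => exists_congr fun w => ?_
  have h : (Complex.I * ((0 : ℝ) : ℂ)) • (1 : TAlg V) = (0 : ℂ) • ω.form p q v w := by simp
  exact Iff.of_eq (congrArg (fun z : TAlg V => r = TAlg.gen V p v * TAlg.gen V q w -
    (-1 : ℂ) ^ (p * q) • (TAlg.gen V q w * TAlg.gen V p v) - z) h)

variable {V W : ChainComplex (ModuleCat.{u} ℝ) ℤ}

/-- An idempotent chain map homotopic to the identity induces a map of the graded symmetric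
algebras that is homotopic to the identity. The homotopy is `h ∘ N⁻¹`, where `h` is the derivation
that extends the given homotopy and `N = d h + h d` counts the factors in the kernel of `π`. -/
def symHomotopy (π : V ⟶ V) (hπ : π ≫ π = π) (t : Homotopy (𝟙 V) π) :
    Homotopy (𝟙 (symComplex.obj V)) (symComplex.map π) :=
  have hI : ∀ x, x ∈ (freeDG V).dgIdeal (trivial V).ccrRel ↔ x ∈ (TAlg.zeroForm V).ideal 0 := by
    rw [trivial_ccrRel (TAlg.zeroForm V)]
    exact TAlg.CentralForm.mem_dgIdeal_rel_iff _ (map_zero _)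
  have h1 : DGStarAlg.IsChainMap (trivial V).ccrRel (trivial V).ccrRel
      (LinearMap.id : (freeDG V).carrier →ₗ[ℂ] (freeDG V).carrier) :=
    ⟨fun _ _ h => h, fun _ => rfl, fun _ h => h⟩
  have h2 := DGStarAlg.isChainMap_of_hom (freeDG.map π)
    (map_ccrRel (trivialFunctor.map π))
  (Homotopy.ofEq (DGStarAlg.complexMap_id h1 rfl).symm).trans <|
    (DGStarAlg.complexHomotopy (A := freeDG V) (B := freeDG V) h1 h2
      (TAlg.homotopyDer t ∘ₗ TAlg.invWeight π)
      (fun n a ha => TAlg.hasDegree_homotopyDer t n _ (TAlg.invWeight_mem π n a ha))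
      (fun a ha => (hI _).2 (TAlg.homotopyDer_mem_ideal t
        (TAlg.invWeight_mem_ideal π ((hI a).1 ha))))
      (fun (a : TAlg V) => by
        have h : TAlg.d V (TAlg.homotopyDer t (TAlg.invWeight π a)) +
            TAlg.homotopyDer t (TAlg.invWeight π (TAlg.d V a)) = a - TAlg.weight π 0 a := by
          rw [TAlg.invWeight_d]
          exact TAlg.numberOp_invWeight t hπ a
        exact (sub_eq_iff_eq_add.1 h.symm).trans
          (congrArg (fun z : TAlg V => _ + z) (TAlg.weight_zero_eq_map π a)))).trans <|
    Homotopy.ofEq (DGStarAlg.toComplex_map_quotientMap _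
      (map_ccrRel (trivialFunctor.map π)) h2).symm

/-- A deformation retract of complexes induces a homotopy equivalence of symmetric algebras. -/
def symHomotopyEquiv {H : ChainComplex (ModuleCat.{u} ℝ) ℤ} (i : H ⟶ V) (p : V ⟶ H)
    (h : i ≫ p = 𝟙 H) (t : Homotopy (𝟙 V) (p ≫ i)) :
    HomotopyEquiv (symComplex.obj H) (symComplex.obj V) where
  hom := symComplex.map i
  inv := symComplex.map p
  homotopyHomInvId := Homotopy.ofEq (by rw [← Functor.map_comp, h, symComplex.map_id])
  homotopyInvHomId := (Homotopy.ofEq (by rw [← Functor.map_comp])).trans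
    (symHomotopy (p ≫ i) (by rw [Category.assoc, reassoc_of% h]) t).symm

/-- Every linear map of vector spaces has a generalized inverse. -/
theorem exists_generalized_inverse {E F : Type*} [AddCommGroup E] [Module ℝ E] [AddCommGroup F]
    [Module ℝ F] (f : E →ₗ[ℝ] F) : ∃ g : F →ₗ[ℝ] E, ∀ x, f (g (f x)) = f x := by
  obtain ⟨r, hr⟩ := f.rangeRestrict.exists_rightInverse_of_surjective f.range_rangeRestrict
  obtain ⟨g, hg⟩ := r.exists_extend
  refine ⟨g, fun x => ?_⟩
  have h1 : g (f x) = r (f.rangeRestrict x) := DFunLike.congr_fun hg (f.rangeRestrict x)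
  have h2 : f.rangeRestrict (r (f.rangeRestrict x)) = f.rangeRestrict x :=
    DFunLike.congr_fun hr (f.rangeRestrict x)
  rw [h1]
  exact congrArg Subtype.val h2

/-- Every complex of real vector spaces deformation retracts onto a complex with zero
differential. -/
theorem exists_retract (V : ChainComplex (ModuleCat.{u} ℝ) ℤ) :
    ∃ (H : ChainComplex (ModuleCat.{u} ℝ) ℤ) (i : H ⟶ V) (p : V ⟶ H), i ≫ p = 𝟙 H ∧
      (∀ m n, H.d m n = 0) ∧ Nonempty (Homotopy (𝟙 V) (p ≫ i)) := by
  choose s hs using fun m n : ℤ => exists_generalized_inverse (V.d n m).hom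
  -- `d t + t d` is an idempotent `e` with `d e = d`, so that `1 - e` projects to a subcomplex on which
  -- `d` vanishes; the factor `1 - s d` in `t = s (1 - s d)` makes `e` idempotent
  let t : ∀ m n, (ComplexShape.down ℤ).Rel n m → (V.X m ⟶ V.X n) := fun m n _ =>
    ModuleCat.ofHom (s m n ∘ₗ (LinearMap.id - s (m - 1) m ∘ₗ (V.d m (m - 1)).hom))
  let e := Homotopy.nullHomotopicMap' t
  have hdd : ∀ l m n (v : V.X l), V.d m n (V.d l m v) = 0 := fun l m n v =>
    congrArg (fun f => f.hom v) (V.d_comp_d l m n)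
  have hs' : ∀ m n (v : V.X n), V.d n m (s m n (V.d n m v)) = V.d n m v := hs
  have he : ∀ n (v : V.X n), e.f n v = s (n - 1) n (V.d n (n - 1) v) +
      V.d (n + 1) n (s n (n + 1) (v - s (n - 1) n (V.d n (n - 1) v))) := by
    intro n v
    have r1 : (ComplexShape.down ℤ).Rel n (n - 1) := by simp
    have r2 : (ComplexShape.down ℤ).Rel (n + 1) n := by simp
    have h := congrArg (fun f => f.hom v) (Homotopy.nullHomotopicMap'_f r2 r1 t)
    refine h.trans ?_
    change s (n - 1) n (V.d n (n - 1) v -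
      s (n - 1 - 1) (n - 1) (V.d (n - 1) (n - 1 - 1) (V.d n (n - 1) v))) + _ = _
    rw [hdd, map_zero, sub_zero]
    rfl
  have hde : ∀ n (v : V.X n), V.d n (n - 1) (e.f n v) = V.d n (n - 1) v := by
    intro n v
    rw [he, map_add, hdd, add_zero, hs']
  have hee : e ≫ e = e := by
    ext n v
    change e.f n (e.f n v) = e.f n v
    rw [he n (e.f n v), hde, he n v, add_sub_cancel_left, hs']
  have hπ : (𝟙 V - e) ≫ (𝟙 V - e) = 𝟙 V - e := by
    rw [Preadditive.sub_comp, Preadditive.comp_sub, Preadditive.comp_sub, hee]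
    simp
  obtain ⟨H, i, p, hip, hpi⟩ := IsIdempotentComplete.idempotents_split V (𝟙 V - e) hπ
  refine ⟨H, i, p, hip, fun m n => ?_, ⟨?_⟩⟩
  · by_cases hmn : n + 1 = m
    · obtain rfl : n = m - 1 := by omega
      have h1 : V.d m (m - 1) ≫ (𝟙 V - e).f (m - 1) = 0 := by
        rw [← (𝟙 V - e).comm]
        ext v
        change V.d m (m - 1) (v - e.f m v) = 0
        rw [map_sub, hde, sub_self]
      calc H.d m (m - 1) = (i ≫ p).f m ≫ H.d m (m - 1) ≫ (i ≫ p).f (m - 1) := by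
            rw [hip]
            simp
        _ = i.f m ≫ (V.d m (m - 1) ≫ (p ≫ i).f (m - 1)) ≫ p.f (m - 1) := by simp
        _ = 0 := by rw [hpi, h1, Limits.zero_comp, Limits.comp_zero]
    · exact H.shape m n hmn
  · rw [hpi]
    exact Homotopy.equivSubZero.symm
      ((Homotopy.ofEq (sub_sub_cancel _ _)).trans (Homotopy.nullHomotopy' t))

/-- A quasi-isomorphism between complexes with zero differentials is an isomorphism. -/
theorem isIso_of_quasiIso_of_d_eq_zero (f : V ⟶ W) [hf : QuasiIso f]
    (hV : ∀ m n, V.d m n = 0) (hW : ∀ m n, W.d m n = 0) : IsIso f := by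
  have : ∀ n, IsIso (f.f n) := by
    intro n
    have h := (quasiIsoAt_iff f n).1 (hf.quasiIsoAt n)
    obtain ⟨h1, h2⟩ := (ShortComplex.quasiIso_iff_of_zeros _ (hV _ _) (hV _ _) (hW _ _)).1 h
    have h3 : Epi (f.f n) := (ShortComplex.exact_iff_epi _ (hW _ _)).1 h1
    have h4 : Mono (f.f n) := h2
    exact isIso_of_mono_of_epi _
  exact HomologicalComplex.Hom.isIso_of_components f

/-- `Sym` preserves quasi-isomorphisms: up to homotopy equivalence, a quasi-isomorphism is an
isomorphism between complexes with zero differentials. -/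
theorem quasiIso_symComplex_map (f : V ⟶ W) [QuasiIso f] : QuasiIso (symComplex.map f) := by
  obtain ⟨H, i, p, hip, hH, ⟨t⟩⟩ := exists_retract V
  obtain ⟨H', i', p', hip', hH', ⟨t'⟩⟩ := exists_retract W
  have hi : QuasiIso i := (HomotopyEquiv.mk i p (Homotopy.ofEq hip) t.symm).quasiIso_hom
  have hp' : QuasiIso p' := (HomotopyEquiv.mk p' i' t'.symm (Homotopy.ofEq hip')).quasiIso_hom
  have hg : IsIso (i ≫ f ≫ p') := isIso_of_quasiIso_of_d_eq_zero _ hH hH'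
  have h1 : QuasiIso (symComplex.map i) := (symHomotopyEquiv i p hip t).quasiIso_hom
  have h2 : QuasiIso (symComplex.map p') := (symHomotopyEquiv i' p' hip' t').symm.quasiIso_hom
  have h3 : QuasiIso (symComplex.map i ≫ symComplex.map f ≫ symComplex.map p') := by
    rw [← Functor.map_comp, ← Functor.map_comp]
    infer_instance
  have h4 := quasiIso_of_comp_left (symComplex.map i) _ (hφφ' := h3)
  exact quasiIso_of_comp_right _ (symComplex.map p')

end PoCh

/-! ### The CCR algebras and the enlarged Heisenberg algebra as symmetric algebras -/

section EvalForm

variable {V : ChainComplex (ModuleCat.{u} ℝ) ℤ}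

theorem evalForm_eq_zero {n : ℤ} (β : (homExtSq V).X n) {p q : ℤ} (h : p + q + n ≠ 0) (v : V.X p)
    (w : V.X q) : evalForm β p q v w = 0 := by
  rw [evalForm, (show extForm V n from β).2.1 p q h]
  rfl

theorem evalForm_antisymm {n : ℤ} (β : (homExtSq V).X n) (p q : ℤ) (v : V.X p) (w : V.X q) :
    evalForm β p q v w = -((-1 : ℝ) ^ (p * q) * evalForm β q p w v) :=
  (show extForm V n from β).2.2 p q v w

theorem evalForm_zero_d_eq_zero (β : (homExtSq V).X 0) (hβ : (homExtSq V).d 0 (-1) β = 0)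
    (p q : ℤ) (v : V.X p) (w : V.X q) : evalForm β (p - 1) q (V.d p (p - 1) v) w +
      (-1 : ℝ) ^ p * evalForm β p (q - 1) v (V.d q (q - 1) w) = 0 := by
  have h := evalForm_d (-1) β p q v w
  have h' : evalForm ((homExtSq V).d (-1 + 1) (-1) β) p q v w = 0 :=
    congrArg (fun γ => evalForm γ p q v w) hβ
  rw [h'] at h
  have h2 : (-1 : ℝ) ^ (-1 : ℤ) ≠ 0 := zpow_ne_zero _ (by norm_num)
  exact (mul_eq_zero.1 h.symm).resolve_left h2

theorem evalForm_one_d (β : (homExtSq V).X 1) (p q : ℤ) (v : V.X p) (w : V.X q) :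
    evalForm ((homExtSq V).d 1 0 β) p q v w = evalForm β (p - 1) q (V.d p (p - 1) v) w +
      (-1 : ℝ) ^ p * evalForm β p (q - 1) v (V.d q (q - 1) w) :=
  (evalForm_d 0 β p q v w).trans (by rw [zpow_zero, one_mul])

end EvalForm

namespace TAlg

variable {V W : ChainComplex (ModuleCat.{u} ℝ) ℤ}

/-- The bilinear map `(v, w) ↦ i b(v, w) z` for a real bilinear form `b`. -/
def imForm {M N : Type u} [AddCommGroup M] [Module ℝ M] [AddCommGroup N] [Module ℝ N]
    (b : M →ₗ[ℝ] N →ₗ[ℝ] ℝ) (z : TAlg V) : M →ₗ[ℝ] N →ₗ[ℝ] TAlg V :=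
  b.compr₂ (LinearMap.toSpanSingleton ℝ (TAlg V) (Complex.I • z))

theorem imForm_apply {M N : Type u} [AddCommGroup M] [Module ℝ M] [AddCommGroup N] [Module ℝ N]
    (b : M →ₗ[ℝ] N →ₗ[ℝ] ℝ) (z : TAlg V) (v : M) (w : N) :
    imForm b z v w = (Complex.I * (b v w : ℂ)) • z := by
  rw [imForm, LinearMap.compr₂_apply, LinearMap.toSpanSingleton_apply, ← Complex.coe_smul,
    smul_smul, mul_comm]

theorem star_algebraMap (c : ℂ) : star V (algebraMap ℂ _ c) = algebraMap ℂ _ (conj c) := by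
  rw [Algebra.algebraMap_eq_smul_one, LinearMap.map_smulₛₗ, star_one,
    ← Algebra.algebraMap_eq_smul_one]

/-- An algebra homomorphism between free dg `*`-algebras is a morphism of dg `*`-algebras if it is
compatible with degrees, differentials and involutions on generators. -/
def dgHom (F : TAlg V →ₐ[ℂ] TAlg W) (hmem : ∀ n v, F (gen V n v) ∈ gr W n)
    (hd : ∀ n v, F (gen V (n - 1) (V.d n (n - 1) v)) = d W (F (gen V n v)))
    (hs : ∀ n v, star W (F (gen V n v)) = F (gen V n v)) : freeDG V ⟶ freeDG W :=
  have hgr : ∀ n, ∀ a ∈ gr V n, F a ∈ gr W n := by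
    intro n a h
    induction h using gr_induction with
    | h0 n => simp
    | ha n a b _ _ h h' => rw [map_add]; exact add_mem h h'
    | hs n c a _ h => rw [map_smul]; exact Submodule.smul_mem _ c h
    | h1 => rw [map_one]; exact SetLike.GradedOne.one_mem
    | hm m n v a _ h =>
      rw [map_mul]
      exact SetLike.GradedMul.mul_mem (hmem m v) h
  have hd' : ∀ a, F (d V a) = d W (F a) := by
    intro a
    induction a using left_induction with
    | h0 => simp
    | ha a b h h' => simp only [map_add, h, h']
    | hs c a h => simp only [map_smul, h]
    | h1 => rw [d_one, map_zero, map_one, d_one]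
    | hm m v a h =>
      rw [leibniz V m _ _ (gen_mem V m v), d_gen, map_add, map_mul, map_smul, map_mul, map_mul, hd, h,
        leibniz W m _ _ (hmem m v)]
  have hs' : ∀ a, F (star V a) = star W (F a) := by
    intro a
    induction a using homogeneous_induction with
    | h0 => simp
    | ha a b h h' => simp only [map_add, h, h']
    | hh n a h =>
      induction h using gr_induction with
      | h0 n => simp
      | ha n a b _ _ h h' => simp only [map_add, h, h']
      | hs n c a _ h => rw [LinearMap.map_smulₛₗ, map_smul, map_smul, LinearMap.map_smulₛₗ, h]
      | h1 => rw [star_one, map_one, star_one]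
      | hm m n v a p h =>
        rw [star_mul V m n _ _ (gen_mem V m v) p, map_smul, map_mul, map_mul, h, star_gen,
          star_mul W m n _ _ (hmem m v) (hgr n a p), hs]
  ⟨F, hgr, hd', hs'⟩

end TAlg

namespace PoCh

open TAlg

/-- The form `i τ 1`, whose relations define the CCR algebra. -/
def ccrForm (P : PoCh.{u}) : CentralForm P.V where
  form p q := imForm (evalForm P.τ p q) 1
  mem_gr p q v w := by
    rw [imForm_apply]
    by_cases h : p + q = 0
    · rw [h]
      exact Submodule.smul_mem _ _ SetLike.GradedOne.one_mem
    · rw [evalForm_eq_zero P.τ (by simpa using h)]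
      simp
  antisymm p q v w := by
    rw [imForm_apply, imForm_apply, evalForm_antisymm]
    push_cast
    module
  d_form p q v w := by
    have h := congrArg (fun x : ℝ => (x : ℂ)) (evalForm_zero_d_eq_zero P.τ P.closed p q v w)
    push_cast at h
    rw [imForm_apply, imForm_apply, imForm_apply, map_smul, d_one, smul_zero]
    rw [smul_smul, ← add_smul, mul_left_comm, ← mul_add, h, mul_zero, zero_smul]
  star_form p q v w := by
    rw [imForm_apply, LinearMap.map_smulₛₗ, TAlg.star_one]
    simp
  mem_center p q v w := by
    rw [imForm_apply]
    exact Submodule.smul_mem _ _ (Submodule.subset_span (Or.inl rfl))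

theorem ccrForm_rel (P : PoCh.{u}) : P.ccrRel = P.ccrForm.rel 1 := by
  refine Set.ext fun (r : TAlg P.V) => ?_
  refine exists_congr fun p => exists_congr fun q => exists_congr fun v => exists_congr fun w => ?_
  have h : (Complex.I * (evalForm P.τ p q v w : ℂ)) • (1 : TAlg P.V) =
      (1 : ℂ) • P.ccrForm.form p q v w := by
    rw [one_smul]
    exact (imForm_apply _ _ _ _).symm
  exact Iff.of_eq (congrArg (fun z : TAlg P.V => r = gen P.V p v * gen P.V q w -
    (-1 : ℂ) ^ (p * q) • (gen P.V q w * gen P.V p v) - z) h)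

theorem isChainMap_changeForm_sym {V : ChainComplex (ModuleCat.{u} ℝ) ℤ} (ω : CentralForm V)
    (S : Set (freeDG V).carrier) (hS : (freeDG V).dgIdeal S = (freeDG V).dgIdeal (ω.rel 1)) :
    DGStarAlg.IsChainMap (A := freeDG V) (B := freeDG V) S (trivial V).ccrRel
      (ω.changeForm 2⁻¹) :=
  ω.isChainMap_changeForm 2⁻¹ 1 0 (map_one _) (map_zero _) (by norm_num) hS
    (congrArg (freeDG V).dgIdeal (trivial_ccrRel ω))

/-- The quotient of a free dg `*`-algebra by the relations of a central form is isomorphic, as a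
complex, to the graded symmetric algebra. -/
def isoSym {V : ChainComplex (ModuleCat.{u} ℝ) ℤ} (ω : CentralForm V) (S : Set (freeDG V).carrier)
    (hS : (freeDG V).dgIdeal S = (freeDG V).dgIdeal (ω.rel 1)) :
    DGStarAlg.toComplex.obj ((freeDG V).quotient S) ≅ symComplex.obj V :=
  DGStarAlg.complexIso (A := freeDG V) (B := freeDG V) (isChainMap_changeForm_sym ω S hS)
    (ω.isChainMap_changeForm (-2⁻¹) 0 1 (map_zero _) (map_one _) (by norm_num)
      (congrArg (freeDG V).dgIdeal (trivial_ccrRel ω)) hS)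
    (LinearMap.ext fun a => ω.changeForm_neg_changeForm 2⁻¹ a)
    (LinearMap.ext fun a => by
      have h := ω.changeForm_neg_changeForm (-2⁻¹) a
      rwa [neg_neg] at h)

/-- A morphism of quotients that is linear up to constants on generators and preserves the central
forms is a quasi-isomorphism if and only if the corresponding morphism of graded symmetric
algebras is. -/
theorem weq_quotientMap_iff {U V : ChainComplex (ModuleCat.{u} ℝ) ℤ} {η : CentralForm U}
    {ω : CentralForm V} {S : Set (freeDG U).carrier} {T : Set (freeDG V).carrier}
    (hS : (freeDG U).dgIdeal S = (freeDG U).dgIdeal (η.rel 1))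
    (hT : (freeDG V).dgIdeal T = (freeDG V).dgIdeal (ω.rel 1)) (F : freeDG U ⟶ freeDG V)
    (f : ∀ n, U.X n → V.X n) (ε : ∀ n, U.X n → ℂ)
    (hF : ∀ n u, F.toAlgHom (freeDG.gen U n u) =
      freeDG.gen V n (f n u) + algebraMap ℂ _ (ε n u))
    (hω : ∀ p q u u', F.toAlgHom (η.form p q u u') = ω.form p q (f p u) (f q u'))
    (h1 : ∀ a ∈ S, F.toAlgHom a ∈ T)
    (h0 : ∀ a ∈ (trivial U).ccrRel, F.toAlgHom a ∈ (trivial V).ccrRel) :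
    DGStarAlg.weq (DGStarAlg.quotientMap F h1) ↔
      DGStarAlg.weq (X := CCR.obj (trivial U)) (Y := CCR.obj (trivial V))
        (DGStarAlg.quotientMap F h0) := by
  have hsq : DGStarAlg.toComplex.map (DGStarAlg.quotientMap F h1) ≫ (isoSym ω T hT).hom =
      (isoSym η S hS).hom ≫ DGStarAlg.toComplex.map (DGStarAlg.quotientMap F h0) := by
    refine (congrArg (· ≫ (isoSym ω T hT).hom)
      (DGStarAlg.toComplex_map_quotientMap F h1 (DGStarAlg.isChainMap_of_hom F h1))).trans
      (Eq.trans ?_ (congrArg ((isoSym η S hS).hom ≫ ·)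
        (DGStarAlg.toComplex_map_quotientMap F h0 (DGStarAlg.isChainMap_of_hom F h0))).symm)
    refine (DGStarAlg.complexMap_comp (DGStarAlg.isChainMap_of_hom F h1)
      (isChainMap_changeForm_sym ω T hT)).trans (Eq.trans ?_
        (DGStarAlg.complexMap_comp (isChainMap_changeForm_sym η S hS)
          (DGStarAlg.isChainMap_of_hom F h0)).symm)
    refine DGStarAlg.complexMap_congr _ _ (LinearMap.ext fun a => ?_)
    exact (ω.map_changeForm η F.toAlgHom f ε F.map_mem hF hω 2⁻¹ a).symm
  exact quasiIso_iff_of_arrow_mk_iso _ _ (Arrow.isoMk (isoSym η S hS) (isoSym ω T hT) hsq.symm)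

/-- The CCR functor preserves weak equivalences. -/
theorem weq_CCR_map {P Q : PoCh.{u}} (f : P ⟶ Q) (hf : weq f) : DGStarAlg.weq (CCR.map f) := by
  refine (weq_quotientMap_iff (η := P.ccrForm) (ω := Q.ccrForm) (by rw [ccrForm_rel])
    (by rw [ccrForm_rel]) (freeDG.map f.hom) (fun n v => f.hom.f n v) (fun _ _ => 0) ?_ ?_
    (map_ccrRel f) (map_ccrRel (trivialFunctor.map f.hom))).2 ?_
  · intro n v
    rw [freeDG.map_gen, map_zero, add_zero]
  · intro p q v w
    change (freeDG.map f.hom).toAlgHom (imForm _ _ _ _) = imForm _ _ _ _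
    rw [imForm_apply, imForm_apply, f.map_τ]
    exact (map_smul _ _ _).trans (congrArg _ (map_one (freeDG.map f.hom).toAlgHom))
  · have : QuasiIso f.hom := hf
    exact quasiIso_symComplex_map f.hom

end PoCh

/-! ### Adjoining an acyclic disk -/

section WithDisk

variable (V : ChainComplex (ModuleCat.{u} ℝ) ℤ)

/-- The projection of `V ⊕ D` to `V` in degree `n`. -/
def vPart (n : ℤ) : (withDisk V).X n →ₗ[ℝ] V.X n := LinearMap.fst ℝ (V.X n) (diskX n)

/-- The projection of `V ⊕ D` to `D` in degree `n`. -/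
def diskPart (n : ℤ) : (withDisk V).X n →ₗ[ℝ] diskX n := LinearMap.snd ℝ (V.X n) (diskX n)

/-- The inclusion of `V` into `V ⊕ D` in degree `n`. -/
def vIncl (n : ℤ) : V.X n →ₗ[ℝ] (withDisk V).X n := LinearMap.inl ℝ (V.X n) (diskX n)

/-- The inclusion of `D` into `V ⊕ D` in degree `n`. -/
def diskIncl (n : ℤ) : diskX n →ₗ[ℝ] (withDisk V).X n := LinearMap.inr ℝ (V.X n) (diskX n)

variable {V}

theorem vIncl_add_diskIncl (n : ℤ) (u : (withDisk V).X n) :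
    vIncl V n (vPart V n u) + diskIncl V n (diskPart V n u) = u :=
  Prod.ext (add_zero _) (zero_add _)

theorem vPart_d (m n : ℤ) (u : (withDisk V).X m) :
    vPart V n ((withDisk V).d m n u) = V.d m n (vPart V m u) := rfl

theorem diskPart_d (m n : ℤ) (u : (withDisk V).X m) :
    diskPart V n ((withDisk V).d m n u) = diskD m n (diskPart V m u) := rfl

theorem vPart_vIncl (n : ℤ) (v : V.X n) : vPart V n (vIncl V n v) = v := rfl

theorem diskPart_vIncl (n : ℤ) (v : V.X n) : diskPart V n (vIncl V n v) = 0 := rfl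

theorem vPart_diskIncl (n : ℤ) (a : diskX n) : vPart V n (diskIncl V n a) = 0 := rfl

theorem diskPart_diskIncl (n : ℤ) (a : diskX n) : diskPart V n (diskIncl V n a) = a := rfl

theorem diskX_eq_zero {n : ℤ} (h0 : n ≠ 0) (h1 : n ≠ -1) (a : diskX n) : a = 0 := by
  obtain ⟨a, ha⟩ := a
  rw [diskX, if_neg (by tauto), Submodule.mem_bot] at ha
  exact Subtype.ext ha

variable (V)

/-- The inclusion `V → V ⊕ D` as a chain map. -/
def withDiskIncl : V ⟶ withDisk V where
  f n := ModuleCat.ofHom (vIncl V n)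
  comm' m n _ := by
    ext v
    exact Prod.ext rfl (diskD m n).map_zero

/-- The projection `V ⊕ D → V` as a chain map. -/
def withDiskProj : withDisk V ⟶ V where
  f n := ModuleCat.ofHom (vPart V n)
  comm' _ _ _ := rfl

theorem withDiskIncl_proj : withDiskIncl V ≫ withDiskProj V = 𝟙 V := rfl

/-- The contracting homotopy of `D`: the identity from degree `-1` to degree `0`. -/
def diskH (i j : ℤ) : diskX i →ₗ[ℝ] diskX j :=
  if h : i = -1 ∧ j = 0 then
    (diskX i).subtype.codRestrict (diskX j) (fun _ => by simp [diskX, h.2]) else 0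

theorem diskD_diskH_add (n : ℤ) (a : diskX n) :
    diskH (n - 1) n (diskD n (n - 1) a) + diskD (n + 1) n (diskH n (n + 1) a) = a := by
  by_cases h0 : n = 0
  · subst h0
    apply Subtype.ext
    simp [diskH, diskD]
    rfl
  by_cases h1 : n = -1
  · subst h1
    apply Subtype.ext
    simp [diskH, diskD]
    rfl
  · rw [diskX_eq_zero h0 h1 a]
    simp

/-- The inclusion and the projection form a deformation retract of `V ⊕ D` onto `V`. -/
def withDiskHomotopy : Homotopy (𝟙 (withDisk V)) (withDiskProj V ≫ withDiskIncl V) :=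
  let t : ∀ m n, (ComplexShape.down ℤ).Rel n m → ((withDisk V).X m ⟶ (withDisk V).X n) :=
    fun m n _ => ModuleCat.ofHom (diskIncl V n ∘ₗ diskH m n ∘ₗ diskPart V m)
  Homotopy.equivSubZero.symm ((Homotopy.ofEq (by
    ext n (u : (withDisk V).X n)
    have r1 : (ComplexShape.down ℤ).Rel n (n - 1) := by simp
    have r2 : (ComplexShape.down ℤ).Rel (n + 1) n := by simp
    have h := congrArg (fun f => f.hom u) (Homotopy.nullHomotopicMap'_f r2 r1 t)
    refine Eq.trans ?_ h.symm
    change u - vIncl V n (vPart V n u) =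
      diskIncl V n (diskH (n - 1) n (diskPart V (n - 1) ((withDisk V).d n (n - 1) u))) +
        (withDisk V).d (n + 1) n (diskIncl V (n + 1) (diskH n (n + 1) (diskPart V n u)))
    have h1 : (withDisk V).d (n + 1) n (diskIncl V (n + 1) (diskH n (n + 1) (diskPart V n u))) =
        diskIncl V n (diskD (n + 1) n (diskH n (n + 1) (diskPart V n u))) :=
      Prod.ext (V.d (n + 1) n).hom.map_zero rfl
    rw [h1, diskPart_d, ← map_add, diskD_diskH_add, sub_eq_iff_eq_add, add_comm,
      vIncl_add_diskIncl])).trans (Homotopy.nullHomotopy' t))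

end WithDisk

namespace PoCh

open TAlg

theorem quasiIso_symComplex_map_withDiskIncl (V : ChainComplex (ModuleCat.{u} ℝ) ℤ) :
    QuasiIso (symComplex.map (withDiskIncl V)) :=
  (symHomotopyEquiv _ _ (withDiskIncl_proj V) (withDiskHomotopy V)).quasiIso_hom

/-! #### Evaluation of the disk -/

section Evaluation

variable (V : ChainComplex (ModuleCat.{u} ℝ) ℤ) (c : ℝ)

/-- The value of the algebra homomorphism that evaluates `x` at `c` on the `D`-component of a
generator. -/
def evalConst (n : ℤ) : (withDisk V).X n →ₗ[ℝ] ℝ :=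
  if n = 0 then c • (diskX n).subtype ∘ₗ diskPart V n else 0

variable {V} in
theorem evalConst_apply (n : ℤ) (u : (withDisk V).X n) :
    evalConst V c n u = if n = 0 then c * (diskPart V n u : ℝ) else 0 := by
  rw [evalConst]
  split <;> rfl

variable {V} in
theorem evalConst_of_ne {n : ℤ} (h : n ≠ 0) (u : (withDisk V).X n) : evalConst V c n u = 0 := by
  rw [evalConst_apply, if_neg h]

variable {V} in
theorem evalConst_vIncl (n : ℤ) (v : V.X n) : evalConst V c n (vIncl V n v) = 0 := by
  rw [evalConst_apply, diskPart_vIncl]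
  simp

variable {V} in
theorem evalConst_d (n : ℤ) (u : (withDisk V).X n) :
    evalConst V c (n - 1) ((withDisk V).d n (n - 1) u) = 0 := by
  rw [evalConst_apply, diskPart_d]
  split
  · rw [diskD, dif_neg (by omega)]
    simp
  · rfl

/-- The algebra homomorphism `T(V ⊕ D) → T(V)` that is the identity on `V` and maps `x` to `c`
and `y` to `0`. -/
def evalAlgHom : TAlg (withDisk V) →ₐ[ℂ] TAlg V :=
  lift fun n => gen V n ∘ₗ vPart V n + LinearMap.toSpanSingleton ℝ (TAlg V) 1 ∘ₗ evalConst V c n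

variable {V} in
theorem evalAlgHom_gen (n : ℤ) (u : (withDisk V).X n) : evalAlgHom V c (gen (withDisk V) n u) =
    gen V n (vPart V n u) + algebraMap ℂ _ ((evalConst V c n u : ℝ) : ℂ) := by
  rw [evalAlgHom, lift_gen, LinearMap.add_apply, LinearMap.comp_apply, LinearMap.comp_apply,
    LinearMap.toSpanSingleton_apply, ← Complex.coe_smul, Algebra.algebraMap_eq_smul_one]

/-- `evalAlgHom` as a morphism of dg `*`-algebras. -/
def evalHom : freeDG (withDisk V) ⟶ freeDG V :=
  dgHom (evalAlgHom V c)
    (fun n u => by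
      rw [evalAlgHom_gen]
      refine add_mem (gen_mem V n _) ?_
      by_cases h : n = 0
      · subst h
        exact SetLike.algebraMap_mem_graded (gr V) _
      · rw [evalConst_of_ne c h]
        simp)
    (fun n u => by
      rw [evalAlgHom_gen, evalAlgHom_gen, evalConst_d, map_add, d_gen, d_algebraMap, vPart_d]
      simp)
    (fun n u => by
      rw [evalAlgHom_gen, map_add, star_gen, star_algebraMap, Complex.conj_ofReal])

variable {V}

theorem evalHom_gen (n : ℤ) (u : (withDisk V).X n) :
    (evalHom V c).toAlgHom (gen (withDisk V) n u) =
      gen V n (vPart V n u) + algebraMap ℂ (TAlg V) ((evalConst V c n u : ℝ) : ℂ) :=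
  evalAlgHom_gen c n u

theorem evalAlgHom_commutator (p q : ℤ) (u : (withDisk V).X p) (w : (withDisk V).X q) :
    evalAlgHom V c (gen (withDisk V) p u * gen (withDisk V) q w -
      (-1 : ℂ) ^ (p * q) • (gen (withDisk V) q w * gen (withDisk V) p u)) =
    gen V p (vPart V p u) * gen V q (vPart V q w) -
      (-1 : ℂ) ^ (p * q) • (gen V q (vPart V q w) * gen V p (vPart V p u)) := by
  simp only [map_sub, map_mul, map_smul, evalAlgHom_gen]
  by_cases hp : p = 0
  · subst hp
    by_cases hq : q = 0
    · subst hq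
      simp only [mul_zero, zpow_zero, one_smul, mul_add, add_mul, Algebra.algebraMap_eq_smul_one,
        smul_mul_assoc, mul_smul_comm, one_mul, mul_one, smul_smul, smul_add]
      rw [mul_comm ((evalConst V c 0 u : ℝ) : ℂ)]
      abel
    · rw [evalConst_of_ne c hq]
      simp only [zero_mul, zpow_zero, one_smul, mul_add, add_mul, Algebra.algebraMap_eq_smul_one,
        smul_mul_assoc, mul_smul_comm, one_mul, mul_one, Complex.ofReal_zero, zero_smul, add_zero]
      abel
  · rw [evalConst_of_ne c hp]
    by_cases hq : q = 0
    · subst hq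
      simp only [mul_zero, zpow_zero, one_smul, mul_add, add_mul, Algebra.algebraMap_eq_smul_one,
        smul_mul_assoc, mul_smul_comm, one_mul, mul_one, Complex.ofReal_zero, zero_smul, add_zero]
      abel
    · rw [evalConst_of_ne c hq]
      simp

theorem evalHom_trivial (r : TAlg (withDisk V)) (hr : r ∈ (trivial (withDisk V)).ccrRel) :
    (evalHom V c).toAlgHom r ∈ (trivial V).ccrRel := by
  rw [trivial_ccrRel (zeroForm _)] at hr
  obtain ⟨p, q, u, w, rfl⟩ := hr
  rw [trivial_ccrRel (zeroForm V)]
  refine ⟨p, q, vPart V p u, vPart V q w, ?_⟩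
  rw [zero_smul, zero_smul, sub_zero, sub_zero]
  exact evalAlgHom_commutator c p q u w

variable (V) in
/-- The evaluation of the disk on graded symmetric algebras. -/
def symEval : CCR.obj (trivial (withDisk V)) ⟶ CCR.obj (trivial V) :=
  DGStarAlg.quotientMap (evalHom V c) (evalHom_trivial c)

theorem map_withDiskIncl_symEval :
    CCR.map (trivialFunctor.map (withDiskIncl V)) ≫ symEval V c = 𝟙 (CCR.obj (trivial V)) := by
  apply freeDG.quotient_hom_ext
  intro n (v : V.X n)
  refine (congrArg ((freeDG V).qmk _) ((congrArg (evalHom V c).toAlgHom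
    (freeDG.map_gen (withDiskIncl V) n v)).trans (evalHom_gen c n _))).trans ?_
  refine congrArg ((freeDG V).qmk _) ?_
  change gen V n v + algebraMap ℂ (TAlg V) ((evalConst V c n (vIncl V n v) : ℝ) : ℂ) = gen V n v
  rw [evalConst_vIncl]
  simp

/-- The evaluation is a quasi-isomorphism, as it is a retraction of the quasi-isomorphism
`Sym V → Sym (V ⊕ D)`. -/
theorem weq_symEval : DGStarAlg.weq (symEval V c) := by
  have h1 := quasiIso_symComplex_map_withDiskIncl V
  have h2 : symComplex.map (withDiskIncl V) ≫ DGStarAlg.toComplex.map (symEval V c) =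
      𝟙 (symComplex.obj V) :=
    (DGStarAlg.toComplex.map_comp _ _).symm.trans
      ((congrArg DGStarAlg.toComplex.map (map_withDiskIncl_symEval c)).trans
        (DGStarAlg.toComplex.map_id _))
  have h4 : IsIso (symComplex.map (withDiskIncl V) ≫
      DGStarAlg.toComplex.map (symEval V c)) := by
    rw [h2]
    exact IsIso.id (symComplex.obj V)
  have h3 : QuasiIso (symComplex.map (withDiskIncl V) ≫
      DGStarAlg.toComplex.map (symEval V c)) := quasiIso_of_isIso _
  exact quasiIso_of_comp_left (symComplex.map (withDiskIncl V)) _ (hφφ' := h3)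

end Evaluation

end PoCh

/-! ### The zig-zag through the enlarged Heisenberg algebra -/

theorem one_mem_diskX_zero : (1 : ℝ) ∈ diskX 0 := by simp [diskX]

theorem one_mem_diskX_neg_one : (1 : ℝ) ∈ diskX (-1) := by simp [diskX]

theorem diskD_one : diskD 0 (-1) ⟨1, one_mem_diskX_zero⟩ = ⟨1, one_mem_diskX_neg_one⟩ := by
  rw [diskD, dif_pos ⟨rfl, rfl⟩]
  exact Subtype.ext (LinearMap.codRestrict_apply _ _ _)

theorem neg_one_zpow_neg_one_mul (q : ℤ) : (-1 : ℂ) ^ (-1 * q) = (-1 : ℂ) ^ q := by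
  rw [neg_one_mul, zpow_neg, ← inv_zpow]
  norm_num

namespace TAlg

variable (V : ChainComplex (ModuleCat.{u} ℝ) ℤ)

/-- The generator `x` of `T_ℂ (V ⊕ D)`. -/
def diskGenX : TAlg (withDisk V) := gen (withDisk V) 0 (diskIncl V 0 ⟨1, one_mem_diskX_zero⟩)

/-- The generator `y = dx` of `T_ℂ (V ⊕ D)`. -/
def diskGenY : TAlg (withDisk V) :=
  gen (withDisk V) (-1) (diskIncl V (-1) ⟨1, one_mem_diskX_neg_one⟩)

theorem d_diskGenX : d (withDisk V) (diskGenX V) = diskGenY V := by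
  have h : ∀ m, m = -1 → gen (withDisk V) m ((withDisk V).d 0 m
      (diskIncl V 0 ⟨1, one_mem_diskX_zero⟩)) = diskGenY V := by
    rintro _ rfl
    exact congrArg (gen (withDisk V) (-1)) (Prod.ext (V.d 0 (-1)).hom.map_zero diskD_one)
  exact (d_gen (withDisk V) 0 _).trans (h (0 - 1) (zero_sub 1))

theorem d_diskGenY : d (withDisk V) (diskGenY V) = 0 := by
  rw [← d_diskGenX, TAlg.d_d]

theorem gen_diskIncl_zero (a : diskX 0) :
    gen (withDisk V) 0 (diskIncl V 0 a) = ((a : ℝ) : ℂ) • diskGenX V := by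
  have h : a = (a : ℝ) • (⟨1, one_mem_diskX_zero⟩ : diskX 0) := Subtype.ext (mul_one _).symm
  rw [Complex.coe_smul, diskGenX, ← map_smul, ← map_smul, ← h]

theorem gen_diskIncl_neg_one (a : diskX (-1)) :
    gen (withDisk V) (-1) (diskIncl V (-1) a) = ((a : ℝ) : ℂ) • diskGenY V := by
  have h : a = (a : ℝ) • (⟨1, one_mem_diskX_neg_one⟩ : diskX (-1)) := Subtype.ext (mul_one _).symm
  rw [Complex.coe_smul, diskGenY, ← map_smul, ← map_smul, ← h]

end TAlg

namespace PoCh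

open TAlg

variable (P : PoCh.{u}) (ρ : (homExtSq P.V).X 1)

theorem yGen_eq : P.yGen = diskGenY P.V := d_diskGenX P.V

/-- The form `i ∂ρ x + i ρ y + i τ 1` on `V ⊕ D`, as a family of bilinear maps. -/
def enlargedBilin (p q : ℤ) :
    (withDisk P.V).X p →ₗ[ℝ] (withDisk P.V).X q →ₗ[ℝ] TAlg (withDisk P.V) :=
  (imForm (evalForm ((homExtSq P.V).d 1 0 ρ) p q) (diskGenX P.V) +
    imForm (evalForm ρ p q) (diskGenY P.V) +
    imForm (evalForm P.τ p q) 1).compl₁₂ (vPart P.V p) (vPart P.V q)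

theorem enlargedBilin_apply (p q : ℤ) (u : (withDisk P.V).X p) (w : (withDisk P.V).X q) :
    P.enlargedBilin ρ p q u w =
      (Complex.I * (evalForm ((homExtSq P.V).d 1 0 ρ) p q (vPart P.V p u) (vPart P.V q w) : ℂ)) •
        diskGenX P.V +
      (Complex.I * (evalForm ρ p q (vPart P.V p u) (vPart P.V q w) : ℂ)) • diskGenY P.V +
      (Complex.I * (evalForm P.τ p q (vPart P.V p u) (vPart P.V q w) : ℂ)) •
        (1 : TAlg (withDisk P.V)) := by
  rw [← imForm_apply, ← imForm_apply, ← imForm_apply]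
  rfl

theorem enlargedBilin_diskIncl (p q : ℤ) (a : diskX p) (w : (withDisk P.V).X q) :
    P.enlargedBilin ρ p q (diskIncl P.V p a) w = 0 := by
  rw [enlargedBilin_apply, vPart_diskIncl]
  simp

/-- The relations of the enlarged Heisenberg algebra in terms of `enlargedBilin`. -/
theorem mem_enlargedRel (r : TAlg (withDisk P.V)) : r ∈ P.enlargedRel ρ ↔
    (∃ p q v w, r = gen (withDisk P.V) p (vIncl P.V p v) * gen (withDisk P.V) q (vIncl P.V q w) -
      (-1 : ℂ) ^ (p * q) •
        (gen (withDisk P.V) q (vIncl P.V q w) * gen (withDisk P.V) p (vIncl P.V p v)) -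
      P.enlargedBilin ρ p q (vIncl P.V p v) (vIncl P.V q w)) ∨
    (∃ q u, r = diskGenX P.V * gen (withDisk P.V) q u - gen (withDisk P.V) q u * diskGenX P.V) ∨
    (∃ q u, r = diskGenY P.V * gen (withDisk P.V) q u -
      (-1 : ℂ) ^ q • (gen (withDisk P.V) q u * diskGenY P.V)) := by
  have h : ∀ (a : TAlg (withDisk P.V)) p q v w,
      a - P.enlargedBilin ρ p q (vIncl P.V p v) (vIncl P.V q w) = a -
        (Complex.I * (evalForm ((homExtSq P.V).d 1 0 ρ) p q v w : ℂ)) • diskGenX P.V -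
        (Complex.I * (evalForm ρ p q v w : ℂ)) • diskGenY P.V -
        (Complex.I * (evalForm P.τ p q v w : ℂ)) • (1 : TAlg (withDisk P.V)) := by
    intro a p q v w
    rw [enlargedBilin_apply, vPart_vIncl, vPart_vIncl, sub_sub, sub_sub, add_assoc]
  simp only [h]
  rw [enlargedRel, yGen_eq]
  exact or_assoc

/-- The form `i ∂ρ x + i ρ y + i τ 1`, whose relations define the enlarged Heisenberg algebra. It
is closed because `∂∂ρ = 0`, `∂τ = 0` and `dx = y`. -/
def enlargedForm : CentralForm (withDisk P.V) where
  form := P.enlargedBilin ρ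
  mem_gr p q u w := by
    rw [enlargedBilin_apply]
    refine add_mem (add_mem ?_ ?_) ?_
    · by_cases h : p + q = 0
      · rw [h]
        exact Submodule.smul_mem _ _ (gen_mem _ _ _)
      · rw [evalForm_eq_zero _ (by simpa using h)]
        simp
    · by_cases h : p + q = -1
      · rw [h]
        exact Submodule.smul_mem _ _ (gen_mem _ _ _)
      · rw [evalForm_eq_zero ρ (by omega)]
        simp
    · by_cases h : p + q = 0
      · rw [h]
        exact Submodule.smul_mem _ _ SetLike.GradedOne.one_mem
      · rw [evalForm_eq_zero P.τ (by simpa using h)]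
        simp
  antisymm p q u w := by
    rw [enlargedBilin_apply, enlargedBilin_apply, evalForm_antisymm _ p q, evalForm_antisymm ρ p q,
      evalForm_antisymm P.τ p q]
    push_cast
    module
  d_form p q u w := by
    have h1 := congrArg (fun x : ℝ => (x : ℂ)) (evalForm_zero_d_eq_zero P.τ P.closed p q
      (vPart P.V p u) (vPart P.V q w))
    have h2 := congrArg (fun x : ℝ => (x : ℂ)) (evalForm_zero_d_eq_zero ((homExtSq P.V).d 1 0 ρ)
      (congrArg (fun f => f.hom ρ) ((homExtSq P.V).d_comp_d 1 0 (-1))) p q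
      (vPart P.V p u) (vPart P.V q w))
    have h3 := congrArg (fun x : ℝ => (x : ℂ)) (evalForm_one_d ρ p q
      (vPart P.V p u) (vPart P.V q w))
    push_cast at h1 h2 h3
    rw [enlargedBilin_apply, enlargedBilin_apply, enlargedBilin_apply, map_add, map_add, map_smul,
      map_smul, map_smul, d_one, d_diskGenX, d_diskGenY, smul_zero, smul_zero, add_zero, add_zero,
      h3, vPart_d, vPart_d, eq_neg_of_add_eq_zero_left h1, eq_neg_of_add_eq_zero_left h2]
    module
  star_form p q u w := by
    have hx : star (withDisk P.V) (diskGenX P.V) = diskGenX P.V := star_gen _ _ _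
    have hy : star (withDisk P.V) (diskGenY P.V) = diskGenY P.V := star_gen _ _ _
    rw [enlargedBilin_apply, map_add, map_add, LinearMap.map_smulₛₗ, LinearMap.map_smulₛₗ,
      LinearMap.map_smulₛₗ, hx, hy, TAlg.star_one]
    simp only [map_mul, Complex.conj_I, Complex.conj_ofReal]
    module
  mem_center p q u w := by
    rw [enlargedBilin_apply]
    refine add_mem (add_mem ?_ ?_) ?_
    · refine Submodule.smul_mem _ _ (Submodule.subset_span (Or.inr ⟨0, _, rfl, ?_⟩))
      exact fun q w => P.enlargedBilin_diskIncl ρ 0 q _ w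
    · refine Submodule.smul_mem _ _ (Submodule.subset_span (Or.inr ⟨-1, _, rfl, ?_⟩))
      exact fun q w => P.enlargedBilin_diskIncl ρ (-1) q _ w
    · exact Submodule.smul_mem _ _ (Submodule.subset_span (Or.inl rfl))

/-- Elements of the disk are central in the graded sense modulo the relations of the enlarged
Heisenberg algebra. -/
theorem diskIncl_commutator_mem (p q : ℤ) (a : diskX p) (u : (withDisk P.V).X q) :
    gen (withDisk P.V) p (diskIncl P.V p a) * gen (withDisk P.V) q u -
      (-1 : ℂ) ^ (p * q) • (gen (withDisk P.V) q u * gen (withDisk P.V) p (diskIncl P.V p a)) ∈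
      (freeDG (withDisk P.V)).dgIdeal (P.enlargedRel ρ) := by
  have hsmul : ∀ (c : ℂ) (z : TAlg (withDisk P.V)), z ∈ P.enlargedRel ρ →
      c • z ∈ (freeDG (withDisk P.V)).dgIdeal (P.enlargedRel ρ) := by
    intro c z hz
    rw [Algebra.smul_def]
    exact Ideal.mul_mem_left _ _ ((freeDG (withDisk P.V)).subset_dgIdeal _ hz)
  -- every element of the disk is a real multiple of `x` or of `y`
  by_cases h0 : p = 0
  · subst h0
    rw [gen_diskIncl_zero, zero_mul, zpow_zero, one_smul, smul_mul_assoc, mul_smul_comm,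
      ← smul_sub]
    exact hsmul _ _ ((P.mem_enlargedRel ρ _).2 (Or.inr (Or.inl ⟨q, u, rfl⟩)))
  by_cases h1 : p = -1
  · subst h1
    rw [gen_diskIncl_neg_one, neg_one_zpow_neg_one_mul, smul_mul_assoc, mul_smul_comm,
      smul_comm, ← smul_sub]
    exact hsmul _ _ ((P.mem_enlargedRel ρ _).2 (Or.inr (Or.inr ⟨q, u, rfl⟩)))
  · rw [diskX_eq_zero h0 h1 a]
    simp only [map_zero, zero_mul, mul_zero, smul_zero, sub_zero]
    exact zero_mem _

/-- The defining relations of the enlarged Heisenberg algebra, with commutators of `V` and centrality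
of `x` and `y` listed separately, generate the same ideal as the relations of `enlargedForm`. -/
theorem dgIdeal_enlargedRel : (freeDG (withDisk P.V)).dgIdeal (P.enlargedRel ρ) =
    (freeDG (withDisk P.V)).dgIdeal ((P.enlargedForm ρ).rel 1) := by
  apply le_antisymm
  · refine (freeDG (withDisk P.V)).dgIdeal_le _ _
      ((freeDG (withDisk P.V)).dgIdeal_isDGStarIdeal _) fun (r : TAlg (withDisk P.V)) hr => ?_
    have hz : ∀ p q a w, (P.enlargedForm ρ).form p q (diskIncl P.V p a) w = 0 :=
      P.enlargedBilin_diskIncl ρ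
    apply (freeDG (withDisk P.V)).subset_dgIdeal
    obtain ⟨p, q, v, w, rfl⟩ | ⟨q, u, rfl⟩ | ⟨q, u, rfl⟩ := (P.mem_enlargedRel ρ r).1 hr
    · refine ⟨p, q, vIncl P.V p v, vIncl P.V q w, ?_⟩
      rw [one_smul]
      rfl
    · refine ⟨0, q, diskIncl P.V 0 ⟨1, one_mem_diskX_zero⟩, u, ?_⟩
      rw [hz, zero_mul, zpow_zero, one_smul, smul_zero, sub_zero]
      rfl
    · refine ⟨-1, q, diskIncl P.V (-1) ⟨1, one_mem_diskX_neg_one⟩, u, ?_⟩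
      rw [hz, neg_one_zpow_neg_one_mul, smul_zero, sub_zero]
      rfl
  · refine (freeDG (withDisk P.V)).dgIdeal_le _ _
      ((freeDG (withDisk P.V)).dgIdeal_isDGStarIdeal _) ?_
    rintro _ ⟨p, q, u, w, rfl⟩
    -- split both arguments into their components in `V` and `D`
    obtain ⟨v₁, a₁, rfl⟩ : ∃ v a, vIncl P.V p v + diskIncl P.V p a = u :=
      ⟨_, _, vIncl_add_diskIncl p u⟩
    obtain ⟨v₂, a₂, rfl⟩ : ∃ v a, vIncl P.V q v + diskIncl P.V q a = w :=
      ⟨_, _, vIncl_add_diskIncl q w⟩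
    have h1 := (freeDG (withDisk P.V)).subset_dgIdeal (P.enlargedRel ρ)
      ((P.mem_enlargedRel ρ _).2 (Or.inl ⟨p, q, v₁, v₂, rfl⟩))
    have h2 := P.diskIncl_commutator_mem ρ p q a₁ (vIncl P.V q v₂ + diskIncl P.V q a₂)
    have h3 := Ideal.mul_mem_left _ (algebraMap ℂ (TAlg (withDisk P.V)) (-(-1 : ℂ) ^ (p * q)))
      (P.diskIncl_commutator_mem ρ q p a₂ (vIncl P.V p v₁))
    have h := add_mem (add_mem h1 h2) h3
    refine Eq.mp (congrArg (· ∈ _) ?_) h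
    have e3 : (P.enlargedForm ρ).form p q (vIncl P.V p v₁ + diskIncl P.V p a₁)
        (vIncl P.V q v₂ + diskIncl P.V q a₂) =
        P.enlargedBilin ρ p q (vIncl P.V p v₁) (vIncl P.V q v₂) := by
      refine (P.enlargedBilin_apply ρ p q _ _).trans
        ((P.enlargedBilin_apply ρ p q _ _).trans ?_).symm
      simp only [map_add, vPart_diskIncl, add_zero]
    have e4 : (-1 : ℂ) ^ (p * q) * (-1 : ℂ) ^ (q * p) = 1 := by
      rw [mul_comm q p, neg_one_zpow_mul_self]
    have key : ∀ a b s t z : TAlg (withDisk P.V),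
        a * s - (-1 : ℂ) ^ (p * q) • (s * a) - z +
          (b * (s + t) - (-1 : ℂ) ^ (p * q) • ((s + t) * b)) +
          algebraMap ℂ _ (-(-1 : ℂ) ^ (p * q)) * (t * a - (-1 : ℂ) ^ (q * p) • (a * t)) =
        (a + b) * (s + t) - (-1 : ℂ) ^ (p * q) • ((s + t) * (a + b)) - (1 : ℂ) • z := by
      intro a b s t z
      rw [← Algebra.smul_def, smul_sub, smul_smul, neg_mul, e4]
      simp only [mul_add, add_mul, smul_add, neg_smul, one_smul]
      abel
    rw [e3, map_add, map_add]
    exact (key _ _ _ _ _).trans rfl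

/-- The evaluation `x ↦ c`, `y ↦ 0` maps the form of the enlarged Heisenberg algebra to the form
`i (τ + c ∂ρ) 1`. -/
theorem evalAlgHom_enlargedBilin (c : ℝ) (p q : ℤ) (u : (withDisk P.V).X p)
    (w : (withDisk P.V).X q) : evalAlgHom P.V c (P.enlargedBilin ρ p q u w) =
      (Complex.I * (c * evalForm ((homExtSq P.V).d 1 0 ρ) p q (vPart P.V p u) (vPart P.V q w) +
        evalForm P.τ p q (vPart P.V p u) (vPart P.V q w) : ℂ)) • (1 : TAlg P.V) := by
  have hx : evalAlgHom P.V c (diskGenX P.V) = (c : ℂ) • 1 := by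
    rw [diskGenX, evalAlgHom_gen, vPart_diskIncl, evalConst_apply, if_pos rfl, diskPart_diskIncl,
      map_zero, zero_add, mul_one, Algebra.algebraMap_eq_smul_one]
  have hy : evalAlgHom P.V c (diskGenY P.V) = 0 := by
    rw [diskGenY, evalAlgHom_gen, vPart_diskIncl, evalConst_of_ne c (by norm_num)]
    simp
  rw [enlargedBilin_apply, map_add, map_add, map_smul, map_smul, map_smul, hx, hy, map_one]
  module

section ZigZag

variable {P ρ}

theorem evalHom_mem_rel {c : ℝ} {ω : CentralForm P.V} (hω : ∀ p q v w, ω.form p q v w =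
      (Complex.I * (c * evalForm ((homExtSq P.V).d 1 0 ρ) p q v w +
        evalForm P.τ p q v w : ℂ)) • (1 : TAlg P.V)) (r : TAlg (withDisk P.V))
    (hr : r ∈ P.enlargedRel ρ) : evalAlgHom P.V c r ∈ ω.rel 1 := by
  have h0 : (0 : TAlg P.V) ∈ ω.rel 1 := ⟨0, 0, 0, 0, by simp; rfl⟩
  obtain ⟨p, q, v, w, rfl⟩ | ⟨q, u, rfl⟩ | ⟨q, u, rfl⟩ := (P.mem_enlargedRel ρ r).1 hr
  · refine ⟨p, q, v, w, ?_⟩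
    rw [one_smul, hω, map_sub, evalAlgHom_commutator, evalAlgHom_enlargedBilin]
    simp only [vPart_vIncl]
    rfl
  · have h1 := evalAlgHom_commutator (V := P.V) c 0 q (diskIncl P.V 0 ⟨1, one_mem_diskX_zero⟩) u
    rw [vPart_diskIncl, map_zero, zero_mul, mul_zero, smul_zero, sub_zero, zero_mul, zpow_zero,
      one_smul] at h1
    rw [diskGenX, h1]
    exact h0
  · have h1 := evalAlgHom_commutator (V := P.V) c (-1) q
      (diskIncl P.V (-1) ⟨1, one_mem_diskX_neg_one⟩) u
    rw [vPart_diskIncl, map_zero, zero_mul, mul_zero, smul_zero, sub_zero,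
      neg_one_zpow_neg_one_mul] at h1
    rw [diskGenY, h1]
    exact h0

/-- The evaluation `x ↦ c`, `y ↦ 0` is a weak equivalence from the enlarged Heisenberg algebra to
the CCR algebra of `τ + c ∂ρ`. -/
theorem weq_evalHom {c : ℝ} {ω : CentralForm P.V} (hω : ∀ p q v w, ω.form p q v w =
      (Complex.I * (c * evalForm ((homExtSq P.V).d 1 0 ρ) p q v w +
        evalForm P.τ p q v w : ℂ)) • (1 : TAlg P.V)) {T : Set (freeDG P.V).carrier}
    (hT : T = ω.rel 1) (h : ∀ r ∈ P.enlargedRel ρ, (evalHom P.V c).toAlgHom r ∈ T) :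
    DGStarAlg.weq (DGStarAlg.quotientMap (evalHom P.V c) h) := by
  refine (weq_quotientMap_iff (η := P.enlargedForm ρ) (ω := ω) (P.dgIdeal_enlargedRel ρ)
    (by rw [hT]) (evalHom P.V c) (fun n u => vPart P.V n u)
    (fun n u => ((evalConst P.V c n u : ℝ) : ℂ)) (evalHom_gen c) ?_ h (evalHom_trivial c)).2
    (weq_symEval c)
  intro p q u w
  exact (P.evalAlgHom_enlargedBilin ρ c p q u w).trans (hω p q _ _).symm

end ZigZag

/-- The enlarged Heisenberg algebra maps to the two CCR algebras by `x ↦ 0` and by `x ↦ 1`. -/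
theorem exists_zigzag : ∃ (φ : P.enlarged ρ ⟶ CCR.obj P)
    (ψ : P.enlarged ρ ⟶ CCR.obj (P.perturb ρ)),
    DGStarAlg.weq φ ∧ DGStarAlg.weq ψ := by
  have h0 : ∀ p q v w, P.ccrForm.form p q v w =
      (Complex.I * ((0 : ℝ) * evalForm ((homExtSq P.V).d 1 0 ρ) p q v w +
        evalForm P.τ p q v w : ℂ)) • (1 : TAlg P.V) := by
    intro p q v w
    refine (imForm_apply _ _ _ _).trans ?_
    rw [Complex.ofReal_zero, zero_mul, zero_add]
  let ω : CentralForm P.V := (P.perturb ρ).ccrForm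
  have h1 : ∀ p q v w, ω.form p q v w =
      (Complex.I * ((1 : ℝ) * evalForm ((homExtSq P.V).d 1 0 ρ) p q v w +
        evalForm P.τ p q v w : ℂ)) • (1 : TAlg P.V) := by
    intro p q v w
    have h : evalForm (P.perturb ρ).τ p q v w =
        evalForm P.τ p q v w + evalForm ((homExtSq P.V).d 1 0 ρ) p q v w := rfl
    refine (imForm_apply _ _ _ _).trans
      ((congrArg (fun r : ℝ => (Complex.I * (r : ℂ)) • (1 : TAlg P.V)) h).trans ?_)
    rw [Complex.ofReal_one, one_mul, Complex.ofReal_add, add_comm]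
  have e0 : P.ccrRel = P.ccrForm.rel 1 := P.ccrForm_rel
  have e1 : (P.perturb ρ).ccrRel = ω.rel 1 := (P.perturb ρ).ccrForm_rel
  have m0 : ∀ r ∈ P.enlargedRel ρ, (evalHom P.V 0).toAlgHom r ∈ P.ccrRel := fun r hr =>
    Eq.mp (congrArg ((evalHom P.V 0).toAlgHom r ∈ ·) e0.symm) (evalHom_mem_rel h0 r hr)
  have m1 : ∀ r ∈ P.enlargedRel ρ, (evalHom P.V 1).toAlgHom r ∈ (P.perturb ρ).ccrRel :=
    fun r hr => Eq.mp (congrArg ((evalHom P.V 1).toAlgHom r ∈ ·) e1.symm) (evalHom_mem_rel h1 r hr)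
  exact ⟨DGStarAlg.quotientMap (evalHom P.V 0) m0,
    DGStarAlg.quotientMap (A := freeDG (withDisk P.V)) (B := freeDG P.V) (evalHom P.V 1) m1,
    weq_evalHom h0 e0 m0, weq_evalHom h1 e1 m1⟩

end PoCh

end

theorem mainTheorem2 :
    -- (a) the CCR functor preserves weak equivalences
    (∀ (P Q : PoCh.{u}) (f : P ⟶ Q), PoCh.weq f → DGStarAlg.weq (CCR.map f)) ∧
    -- (b) the zig-zag of weak equivalences CCR(V,τ) ← A_(V,τ,ρ) → CCR(V,τ+∂ρ)
    (∀ (P : PoCh.{u}) (ρ : (homExtSq P.V).X 1),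
      ∃ (φ : P.enlarged ρ ⟶ CCR.obj P) (ψ : P.enlarged ρ ⟶ CCR.obj (P.perturb ρ)),
        DGStarAlg.weq φ ∧ DGStarAlg.weq ψ) := by
  exact ⟨fun _ _ f hf => PoCh.weq_CCR_map f hf, fun P ρ => P.exists_zigzag ρ⟩
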